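/- **Notation.** Work over $\mathbb{Q}(q,t)$. For $m>0$ let $X_1,\dots,X_m$ be variables and put $X_{i+km}=q^{-k}X_i$ for $1\le i\le m$, $k\in\mathbb{Z}$. On $\mathbb{Q}(q,t)[X_1^{\pm1},\dots,X_m^{\pm1}]$ consider the operators $$\Pi F=X_1F(X_2,\dots,X_m,X_{m+1}),\qquad T_iF=t\,s_i(F)+(t-1)\frac{F-s_i(F)}{1-X_iX_{i+1}^{-1}}\quad(i\in\mathbb{Z}/m\mathbb{Z},\ m\ge 2),$$ where $s_i$ exchanges $X_i$ and $X_{i+1}$ for $1\le i\le m-1$, and $s_0F=X_1X_0^{-1}F(X_0,X_2,\dots,X_{m-1},X_{m+1})$. For integers $e<i$ put $$S^{(m)}_{i,e}=1+T_i^{-1}+T_{i+1}^{-1}T_i^{-1}+\cdots+T_{m+e-1}^{-1}\cdots T_i^{-1}\ \text{ if } e\ge i-m,\qquad S^{(m)}_{i,e}=0\ \text{ if } e<i-m,$$ and for $1\le i\le m$ put $Y_i=t^{m-i}T_{i-1}\cdots T_1\Pi T_{m-1}^{-1}\cdots T_i^{-1}$. The operators $Y_1,\dots,Y_m$ commute,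 and $\mathsf q_{(m)}\colon F(Y)\mapsto F(Y)\cdot 1$ is a linear isomorphism $\mathbb{Q}(q,t)[Y_1,\dots,Y_m]\to\mathbb{Q}(q,t)[X_1,\dots,X_m]$; put $F\star G=\mathsf q_{(m)}\bigl(\mathsf q_{(m)}^{-1}(F)\,\mathsf q_{(m)}^{-1}(G)\bigr)$. Let $\Lambda$ be the ring of symmetric functions over $\mathbb{Q}(q,t)$, i.e. families, indexed by $m>0$, of symmetric polynomials in $m$ variables, of bounded degree and compatible with setting the last variables equal to $0$. The limit $q\to\infty$ of an element whose coefficients lie in $\mathbb{Q}(t)[q^{-1}]$ is its reduction modulo $q^{-1}$. Put $[k]_t=\frac{1-t^k}{1-t}$ and $[k]_t!=\prod_{i=1}^k[i]_t$; let $e_r$ be the elementary symmetric functions and $e_\lambda=\prod_ie_{\lambda_i}$. Let $n\ge0$ and let $\mathsf e=(\mathsf e(1)\le\cdots\le\mathsf e(n))$ be integers with $0\le\mathsf e(i)<i$; put $|\mathsf e|=\sum_i\mathsf e(i)$. Let $\Gamma$ be the corresponding unit interval graph: its vertices are $1,\dots,n$ and its oriented edges are $j\to i$ for $\mathsf e(i)<j<i$.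 Its chromatic quasisymmetric function is $\mathbf Y_\Gamma(t)=\sum_\kappa t^{\mathrm{asc}(\kappa)}\prod_vY_{\kappa(v)}$, summed over the proper colorings $\kappa\colon\{1,\dots,n\}\to\mathbb{Z}_{>0}$, where $\mathrm{asc}(\kappa)$ is the number of edges $v\to w$ with $\kappa(v)<\kappa(w)$. **Theorem C.** (i) There is a symmetric function $\mathbf X_\Gamma(q,t)\in\Lambda$ whose truncation to $m$ variables is $t^{n(m-1)}S^{(m)}_{1,\mathsf e(1)}\cdots S^{(m)}_{n,\mathsf e(n)}\Pi^n\cdot 1$ for every $m>0$. Its coefficients lie in $\mathbb{Q}(t)[q^{-1}]$, and $$\lim_{q\to\infty}\mathbf X_\Gamma(q,t)=t^{n(n-1)/2-|\mathsf e|}\,[n]_t!\,e_n(X).$$ (ii) For every partition $\lambda=(\lambda_1,\dots,\lambda_l)$ of $n$ there is a symmetric function $e^{(q,t)}_\lambda(X)\in\Lambda$ whose truncation to $m$ variables is $e_{\lambda_1}(X_1,\dots,X_m)\star\cdots\star e_{\lambda_l}(X_1,\dots,X_m)$ for every $m>0$. Its coefficients lie in $\mathbb{Q}(t)[q^{-1}]$,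 and $$\lim_{q\to\infty}e^{(q,t)}_\lambda(X)=\frac{[n]_t!}{\prod_{i=1}^l[\lambda_i]_t!}\,e_n(X).$$ (iii) There are unique $c_\lambda(\Gamma;t)\in\mathbb{Q}(t)$, for $\lambda\vdash n$, with $\mathbf Y_\Gamma(t)=\sum_{\lambda\vdash n}c_\lambda(\Gamma;t)\,e_\lambda(Y)$, and they satisfy $$\sum_{\lambda\vdash n}t^{|\mathsf e|-|\mathsf e_\lambda|}\,\frac{c_\lambda(\Gamma;t)}{\prod_i[\lambda_i]_t!}=1,\qquad\text{where } |\mathsf e_\lambda|=\sum_{i<j}\lambda_i\lambda_j.$$ -/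

import Mathlib

noncomputable section

namespace QTChromatic

/-! ## The polynomial representation of the affine Hecke algebra of `GL_m`

Everything is defined over a field `K` with two elements `q ≠ 0` and `t`; later `K = ℚ(q,t)`.
The variables `X_1, …, X_m` are indexed by `Fin m`, so `X_i` is the variable of index `i - 1`.
The Laurent polynomial ring `K[X_1^±1, …, X_m^±1]` is regarded as a subring of the field of rational
functions `K(X_1, …, X_m)`, in which the divided differences are honest quotients. -/

section Hecke

variable {K : Type*} [Field K]

/-- The field `K(X_1, …, X_m)`, which contains the ring of Laurent polynomials. -/
abbrev RatFun (K : Type*) [Field K] (m : ℕ) : Type _ := FractionRing (MvPolynomial (Fin m) K)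

/-- The substitution `X_j ↦ c_j X_{σ j}` on polynomials. -/
def substPoly {m : ℕ} (c : Fin m → Kˣ) (σ : Equiv.Perm (Fin m)) :
    MvPolynomial (Fin m) K ≃ₐ[K] MvPolynomial (Fin m) K :=
  AlgEquiv.ofAlgHom
    (MvPolynomial.aeval fun j => MvPolynomial.C (c j : K) * MvPolynomial.X (σ j))
    (MvPolynomial.aeval fun j =>
      MvPolynomial.C (((c (σ.symm j))⁻¹ : Kˣ) : K) * MvPolynomial.X (σ.symm j))
    (by
      ext1 j
      simp only [AlgHom.comp_apply, MvPolynomial.aeval_X, map_mul, MvPolynomial.algHom_C,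
        MvPolynomial.algebraMap_eq, Equiv.apply_symm_apply, AlgHom.id_apply]
      rw [← mul_assoc, ← MvPolynomial.C_mul, Units.inv_mul, MvPolynomial.C_1, one_mul])
    (by
      ext1 j
      simp only [AlgHom.comp_apply, MvPolynomial.aeval_X, map_mul, MvPolynomial.algHom_C,
        MvPolynomial.algebraMap_eq, Equiv.symm_apply_apply, AlgHom.id_apply]
      rw [← mul_assoc, ← MvPolynomial.C_mul, Units.mul_inv, MvPolynomial.C_1, one_mul])

/-- The substitution `X_j ↦ c_j X_{σ j}` on rational functions. -/
def subst {m : ℕ} (c : Fin m → Kˣ) (σ : Equiv.Perm (Fin m)) : RatFun K m ≃ₐ[K] RatFun K m :=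
  IsFractionRing.algEquivOfAlgEquiv (substPoly c σ)

variable (q : Kˣ) (t : K) (m : ℕ) [NeZero m]

/-- The variable `X_j` for every integer `j`: `X_{i + k m} = q^{-k} X_i` for `1 ≤ i ≤ m`. -/
def extVar (j : ℤ) : RatFun K m :=
  algebraMap K (RatFun K m) ((q ^ (-((j - 1) / (m : ℤ))) : Kˣ) : K) *
    algebraMap (MvPolynomial (Fin m) K) (RatFun K m)
      (MvPolynomial.X (Fin.ofNat m ((j - 1) % (m : ℤ)).toNat))

/-- The operator `s_i`, with `i` read modulo `m`: for `1 ≤ i ≤ m - 1` it exchanges `X_i` and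
`X_{i+1}`; for `i = 0` it sends `F` to `X_1 X_0⁻¹ F(X_0, X_2, …, X_{m-1}, X_{m+1})`, where
`X_0 = q X_m` and `X_{m+1} = q⁻¹ X_1`. -/
def opS (i : ℕ) : Module.End K (RatFun K m) :=
  if i % m = 0 then
    LinearMap.mulLeft K (extVar q m 1 / extVar q m 0) *
      (subst (fun j : Fin m => if j = Fin.ofNat m 0 then q
          else if j = Fin.ofNat m (m - 1) then q⁻¹ else 1)
        (Equiv.swap (Fin.ofNat m 0) (Fin.ofNat m (m - 1)))).toLinearMap
  else
    (subst (fun _ => (1 : Kˣ))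
      (Equiv.swap (Fin.ofNat m (i % m - 1)) (Fin.ofNat m (i % m)))).toLinearMap

/-- The operator `T_i F = t s_i(F) + (t - 1) (F - s_i(F)) / (1 - X_i X_{i+1}⁻¹)`, with `i` read
modulo `m`. -/
def opT (i : ℕ) : Module.End K (RatFun K m) :=
  t • opS q m i +
    (t - 1) • (LinearMap.mulLeft K (1 - extVar q m i * (extVar q m (i + 1))⁻¹)⁻¹ * (1 - opS q m i))

/-- The operator `T_i⁻¹` (for `m ≥ 2` and `t ≠ 0` the operator `T_i` is invertible). -/
def opTinv (i : ℕ) : Module.End K (RatFun K m) := Ring.inverse (opT q t m i)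

/-- The operator `Π F = X_1 F(X_2, …, X_m, X_{m+1})`, where `X_{m+1} = q⁻¹ X_1`. -/
def opPi : Module.End K (RatFun K m) :=
  LinearMap.mulLeft K (extVar q m 1) *
    (subst (fun j : Fin m => if j = Fin.ofNat m (m - 1) then q⁻¹ else 1)
      (finRotate m)).toLinearMap

/-- `T_{i+k-1}⁻¹ ⋯ T_{i+1}⁻¹ T_i⁻¹`, a product of `k` factors. -/
def descTinv (i : ℕ) : ℕ → Module.End K (RatFun K m)
  | 0 => 1
  | k + 1 => opTinv q t m (i + k) * descTinv i k

/-- `T_{i+k-1} ⋯ T_{i+1} T_i`, a product of `k` factors. -/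
def descT (i : ℕ) : ℕ → Module.End K (RatFun K m)
  | 0 => 1
  | k + 1 => opT q t m (i + k) * descT i k

/-- The partial symmetrizer
`S_{i,e} = 1 + T_i⁻¹ + T_{i+1}⁻¹ T_i⁻¹ + ⋯ + T_{m+e-1}⁻¹ ⋯ T_i⁻¹` if `e ≥ i - m`, and `0` if
`e < i - m`. -/
def partialSymm (i e : ℕ) : Module.End K (RatFun K m) :=
  if i ≤ m + e then ∑ k ∈ Finset.range (m + e - i + 1), descTinv q t m i k else 0

/-- `Y_i = t^{m-i} T_{i-1} ⋯ T_1 Π T_{m-1}⁻¹ ⋯ T_i⁻¹` for `1 ≤ i ≤ m`. -/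
def opY (i : ℕ) : Module.End K (RatFun K m) :=
  t ^ (m - i) • (descT q t m 1 (i - 1) * opPi q m * descTinv q t m i (m - i))

/-- The linear map `F(Y) ↦ F(Y) • 1` from `K[Y_1, …, Y_m]`: the monomial
`Y_1^{a_1} ⋯ Y_m^{a_m}` acts by the corresponding product of the (commuting) operators `Y_i`. -/
def qMap : MvPolynomial (Fin m) K →ₗ[K] RatFun K m :=
  (MvPolynomial.basisMonomials (Fin m) K).constr K fun a =>
    (List.ofFn fun i : Fin m => opY q t m (i + 1) ^ a i).prod 1

/-- The quantum multiplication `F ⋆ G = 𝗊(𝗊⁻¹(F) 𝗊⁻¹(G))` on `K[X_1, …, X_m]`, where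
`𝗊 : F(Y) ↦ F(Y) • 1`. -/
def qStar (F G : RatFun K m) : RatFun K m :=
  qMap q t m (Function.invFun (qMap q t m) F * Function.invFun (qMap q t m) G)

/-- `e_{λ_1}(X_1, …, X_m) ⋆ ⋯ ⋆ e_{λ_l}(X_1, …, X_m)`. -/
def qtElemTrunc {n : ℕ} (lam : n.Partition) : RatFun K m :=
  ((lam.parts.sort (· ≥ ·)).map fun r =>
    algebraMap (MvPolynomial (Fin m) K) (RatFun K m) (MvPolynomial.esymm (Fin m) K r)).foldr
      (qStar q t m) 1

end Hecke

/-! ## Symmetric functions -/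

/-- The truncation `X_{m'+1} = ⋯ = X_m = 0`. -/
def trunc (R : Type*) [CommRing R] (m m' : ℕ) :
    MvPolynomial (Fin m) R →ₐ[R] MvPolynomial (Fin m') R :=
  MvPolynomial.aeval fun j : Fin m =>
    if h : (j : ℕ) < m' then MvPolynomial.X (⟨j, h⟩ : Fin m') else 0

/-- Families of polynomials, one in `m` variables for every `m > 0`. -/
abbrev Family (R : Type*) [CommRing R] : Type _ := (m : ℕ+) → MvPolynomial (Fin (m : ℕ)) R

/-- The ring of symmetric functions over `R`: families of symmetric polynomials in `m` variables,
`m > 0`, of bounded degree, that are compatible with the truncations. -/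
def SymmFun (R : Type*) [CommRing R] : Subalgebra R (Family R) where
  carrier := {F | (∀ m m' : ℕ+, m' < m → trunc R m m' (F m) = F m') ∧
    (∀ m, (F m).IsSymmetric) ∧ ∃ d, ∀ m, (F m).totalDegree ≤ d}
  mul_mem' := by
    rintro F G ⟨h1, h2, d, h3⟩ ⟨h1', h2', d', h3'⟩
    refine ⟨fun m m' h => ?_, fun m => (h2 m).mul (h2' m), d + d', fun m => ?_⟩
    · rw [Pi.mul_apply, map_mul, h1 m m' h, h1' m m' h, Pi.mul_apply]
    · exact (MvPolynomial.totalDegree_mul _ _).trans (add_le_add (h3 m) (h3' m))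
  add_mem' := by
    rintro F G ⟨h1, h2, d, h3⟩ ⟨h1', h2', d', h3'⟩
    refine ⟨fun m m' h => ?_, fun m => (h2 m).add (h2' m), max d d', fun m => ?_⟩
    · rw [Pi.add_apply, map_add, h1 m m' h, h1' m m' h, Pi.add_apply]
    · exact (MvPolynomial.totalDegree_add _ _).trans (max_le_max (h3 m) (h3' m))
  algebraMap_mem' r := by
    refine ⟨fun m m' _ => ?_, fun m => MvPolynomial.IsSymmetric.C r, 0, fun m => ?_⟩
    · exact (trunc R m m').commutes r
    · exact (MvPolynomial.totalDegree_C r).le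

/-- The elementary symmetric function `e_r`. -/
def elemSymm (R : Type*) [CommRing R] (r : ℕ) : Family R := fun m => MvPolynomial.esymm (Fin m) R r

/-- The elementary symmetric function `e_λ = e_{λ_1} ⋯ e_{λ_l}`. -/
def elemSymmPart (R : Type*) [CommRing R] {n : ℕ} (lam : n.Partition) : Family R :=
  (lam.parts.map (elemSymm R)).prod

/-! ## Unit interval graphs and chromatic quasisymmetric functions -/

/-- The sequences `0 ≤ e(1) ≤ ⋯ ≤ e(n)` with `e(i) < i`; the element `v` of `Fin n` stands for
`i = v + 1`. -/
structure ESeq (n : ℕ) where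
  /-- The values of the sequence. -/
  val : Fin n → ℕ
  val_lt : ∀ v : Fin n, val v < v + 1
  mono : Monotone val

/-- `|e| = e(1) + ⋯ + e(n)`. -/
def ESeq.size {n : ℕ} (e : ESeq n) : ℕ := ∑ v, e.val v

/-- The unit interval graph of `e`: there is an oriented edge `j → i` exactly when
`e(i) + 1 ≤ j ≤ i - 1` (for vertices labelled `1, …, n`). -/
def ESeq.graph {n : ℕ} (e : ESeq n) : Digraph (Fin n) where
  Adj u v := e.val v + 1 ≤ (u : ℕ) + 1 ∧ (u : ℕ) + 1 ≤ v

open Classical in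
/-- The chromatic quasisymmetric function of an oriented graph: the sum of
`t^{asc κ} ∏_v X_{κ v}` over the proper colorings `κ`, where `asc κ` is the number of edges `u → v`
with `κ u < κ v`. In `m` variables only the colorings with colors `1, …, m` contribute. -/
def chromQS {R : Type*} [CommRing R] (t : R) {V : Type*} [Fintype V] (Γ : Digraph V) : Family R :=
  fun m => ∑ κ : V → Fin m with ∀ u v, Γ.Adj u v → κ u ≠ κ v,
    MvPolynomial.C (t ^ (Finset.univ.filter fun p : V × V => Γ.Adj p.1 p.2 ∧ κ p.1 < κ p.2).card) *
      ∏ v, MvPolynomial.X (κ v)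

/-! ## The `(q,t)`-chromatic and `(q,t)`-elementary symmetric functions -/

section Hecke

variable {K : Type*} [Field K] (q : Kˣ) (t : K)

/-- The `m`-truncated `(q,t)`-chromatic symmetric function
`t^{n(m-1)} S_{1,e(1)} ⋯ S_{n,e(n)} Π^n • 1`. -/
def qtChromTrunc (m : ℕ) [NeZero m] {n : ℕ} (e : ESeq n) : RatFun K m :=
  (t ^ (n * (m - 1)) •
    ((List.ofFn fun v : Fin n => partialSymm q t m (v + 1) (e.val v)).prod * opPi q m ^ n)) 1

/-- `F` is the symmetric function `𝐗_Γ(q,t)` for the unit interval graph `Γ` of `e`: a symmetric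
function whose truncation to `m` variables is the `m`-truncated one, for every `m > 0`. -/
def IsQTChrom {n : ℕ} (e : ESeq n) (F : Family K) : Prop :=
  F ∈ SymmFun K ∧
    ∀ m : ℕ+, algebraMap (MvPolynomial (Fin m) K) (RatFun K m) (F m) = qtChromTrunc q t m e

/-- `F` is the `(q,t)`-elementary symmetric function `e_{λ_1} ⋆ ⋯ ⋆ e_{λ_l}`: a symmetric
function whose truncation to `m` variables is the quantum product of the truncations of the
`e_{λ_i}`, for every `m > 0`. -/
def IsQTElem {n : ℕ} (lam : n.Partition) (F : Family K) : Prop :=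
  F ∈ SymmFun K ∧
    ∀ m : ℕ+, algebraMap (MvPolynomial (Fin m) K) (RatFun K m) (F m) = qtElemTrunc q t m lam

end Hecke

/-! ## The field `ℚ(q,t)` and the limit `q → ∞` -/

/-- The field `ℚ(t)`. -/
abbrev Qt : Type := RatFunc ℚ

/-- The field `ℚ(q,t) = ℚ(t)(q)`. -/
abbrev Qqt : Type := RatFunc Qt

/-- The parameter `t` in `ℚ(t)`. -/
def tt : Qt := RatFunc.X

/-- The parameter `q` in `ℚ(q,t)`, a nonzero element. -/
def qq : Qqtˣ := Units.mk0 RatFunc.X RatFunc.X_ne_zero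

/-- `lim_{q → ∞} F = G`: the coefficients of `F` lie in the subring `ℚ(t)[q⁻¹]` of `ℚ(q,t)`, and
reduction modulo `q⁻¹` gives `G`. -/
def HasLimit (F : Family Qqt) (G : Family Qt) : Prop :=
  ∀ m : ℕ+, ∃ P : MvPolynomial (Fin m) (Polynomial Qt),
    MvPolynomial.map (Polynomial.aeval ((qq⁻¹ : Qqtˣ) : Qqt)).toRingHom P = F m ∧
    MvPolynomial.map (Polynomial.evalRingHom 0) P = G m

/-- The `t`-integer `[k]_t = (1 - t^k) / (1 - t)`. -/
def tInt (k : ℕ) : Qt := (1 - tt ^ k) / (1 - tt)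

/-- The `t`-factorial `[k]_t! = [1]_t ⋯ [k]_t`. -/
def tFact (k : ℕ) : Qt := ∏ i ∈ Finset.Icc 1 k, tInt i

/-- The product of `[λ_i]_t!` over the parts of `λ`. -/
def tFactPart {n : ℕ} (lam : n.Partition) : Qt := (lam.parts.map tFact).prod

/-- `|e_λ| = ∑_{i<j} λ_i λ_j`, the second elementary symmetric polynomial of the parts. -/
def partSize {n : ℕ} (lam : n.Partition) : ℕ := lam.parts.esymm 2

/-- The `c_λ` are the coefficients in `𝐘_Γ(t) = ∑_{λ ⊢ n} c_λ e_λ`, for the unit interval graph `Γ`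
of `e`. -/
def IsElemExpansion {n : ℕ} (e : ESeq n) (c : n.Partition → Qt) : Prop :=
  chromQS tt e.graph = ∑ lam, c lam • elemSymmPart Qt lam

end QTChromatic

end

set_option linter.unusedSectionVars false

noncomputable section

namespace QTChromatic

/-! ## Demazure–Lusztig operators on polynomials in countably many variables -/

section Poly

open MvPolynomial

variable {R : Type*} [CommRing R]

/-! With variables numbered from 0, `u = t⁻¹` and `p = q⁻¹`, the inverse operator `T_i⁻¹` becomes `F
↦ u F + (u X_{i+1} - X_i) ∂_i F` on polynomials, where `∂_i` is the divided difference (`opN`).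
Since `Π T_i = T_{i+1} Π` in the affine Hecke algebra, the powers of `Π` can be distributed among
the partial symmetrizers, and `S_{1,e(1)} ⋯ S_{n,e(n)} Π^n · 1` becomes a `word`: the product of the
operators `S_{1,-d_v} Π` applied to 1, where `d_v` counts the smaller neighbours of the vertex `v`
(`ofFn_partialSymm_prod`). As `d_{v+1} ≤ d_v + 1`, each symmetrizer meets a polynomial that is
already symmetric in enough variables, so the word is symmetric (`dd_word`). Setting a variable to
zero costs one factor `u` per letter (`kill_word`), which the power `t^{n(m-1)}` absorbs.

A word is polynomial in `p`, so the limit `q → ∞` is the specialization `p = 0`. There `Π` is a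
shift followed by multiplication by `X_0`, and symmetrizing `X_0 e_r(X_1, …, X_M)` gives `t^{-M}
[r+1]_t e_{r+1}` (`pSym_X_mul_es`). Induction on the word gives `cut_word_zero`, hence (i).

For (ii), the `T_i` satisfy the same relations with the `Y_j` as with the `X_j`, so `F ↦ F(Y) · 1`
commutes with them (`quant_opN`), and `Π` corresponds to `t^{1-m} X_0 T_0 ⋯ T_{m-2}` (`opR_quant`).
Thus the word of a disjoint union of cliques is the image of a product of elementary symmetric
polynomials (`word_cliques`). A single clique gives `e_r(Y) · 1 = t^{r(r-1)/2} e_r(X)` (`quant_es`).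
So the quantum products of the `e_{λ_i}` are scalar multiples of words, and the limit computed for
(i) applies to them. The inverse map in the definition of `⋆` is controlled by a dimension count in
bounded degree (`qMap_injective`).

For (iii), `𝐘_Γ` is symmetric by an induction over vertices that tracks two adjacent colors
(`exists_colSum_setWt`), so it has a unique expansion. The colors can be summed greedily in the
principal specialization `x_c = t^c`, `c < m`: this gives `∏_v (t^{k_v} - t^m)/(1-t)`, with `k_v`
the number of larger neighbours of `v` (`colSum_pow`). The specialization of `e_r` is `∏_{j<r} (t^j
- t^m)`, divided by `(1-t)^r [r]_t!` (`prod_mul_es`). Comparing both sides as polynomials in `z =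
t^m` and setting `z = 0` gives the identity. -/

/-- The exchange of `X_i` and `X_{i+1}`. -/
def sw (R : Type*) [CommRing R] (i : ℕ) : MvPolynomial ℕ R →ₐ[R] MvPolynomial ℕ R :=
  rename (Equiv.swap i (i + 1))

theorem sw_X (i j : ℕ) : sw R i (X j) = X (Equiv.swap i (i + 1) j) := rename_X _ _

@[simp] theorem sw_X_left (i : ℕ) : sw R i (X i) = X (i + 1) := by simp [sw_X]

@[simp] theorem sw_X_right (i : ℕ) : sw R i (X (i + 1)) = X i := by simp [sw_X]

theorem sw_X_of_ne {i j : ℕ} (h1 : j ≠ i) (h2 : j ≠ i + 1) : sw R i (X j) = X j := by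
  rw [sw_X, Equiv.swap_apply_of_ne_of_ne h1 h2]

@[simp] theorem sw_sw (i : ℕ) (F : MvPolynomial ℕ R) : sw R i (sw R i F) = F := by
  have : (sw R i).comp (sw R i) = AlgHom.id R _ := by
    ext1 j; simp [sw_X]
  exact DFunLike.congr_fun this F

/-- Modulo `X_i - X_{i+1}` the exchange fixes every variable, hence is the identity on the quotient.
-/
theorem dvd_sub_sw (i : ℕ) (F : MvPolynomial ℕ R) :
    (X i - X (i + 1) : MvPolynomial ℕ R) ∣ F - sw R i F := by
  rw [← Ideal.mem_span_singleton, ← Ideal.Quotient.eq]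
  set I := Ideal.span {(X i - X (i + 1) : MvPolynomial ℕ R)}
  have : (Ideal.Quotient.mkₐ R I) = (Ideal.Quotient.mkₐ R I).comp (sw R i) := by
    ext1 j
    simp only [AlgHom.comp_apply, Ideal.Quotient.mkₐ_eq_mk]
    have h : (Ideal.Quotient.mk I) (X i) = (Ideal.Quotient.mk I) (X (i + 1)) :=
      Ideal.Quotient.eq.2 (Ideal.mem_span_singleton_self _)
    by_cases h1 : j = i
    · subst h1; simpa using h
    by_cases h2 : j = i + 1
    · subst h2; simpa using h.symm
    rw [sw_X_of_ne h1 h2]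
  exact DFunLike.congr_fun this F

variable [IsDomain R]

theorem X_sub_X_ne_zero (i : ℕ) : (X i - X (i + 1) : MvPolynomial ℕ R) ≠ 0 := by
  rw [sub_ne_zero]
  exact fun h => by simpa using X_injective h

/-- The divided difference `(F - s_i F) / (X_i - X_{i+1})`. -/
def dd (i : ℕ) : MvPolynomial ℕ R →ₗ[R] MvPolynomial ℕ R where
  toFun F := (dvd_sub_sw i F).choose
  map_add' F G := by
    apply mul_left_cancel₀ (X_sub_X_ne_zero (R := R) i)
    rw [mul_add, ← (dvd_sub_sw i F).choose_spec, ← (dvd_sub_sw i G).choose_spec,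
      ← (dvd_sub_sw i (F + G)).choose_spec, map_add]
    ring
  map_smul' r F := by
    apply mul_left_cancel₀ (X_sub_X_ne_zero (R := R) i)
    rw [RingHom.id_apply, mul_smul_comm, ← (dvd_sub_sw i F).choose_spec,
      ← (dvd_sub_sw i (r • F)).choose_spec, map_smul, smul_sub]

theorem dd_spec (i : ℕ) (F : MvPolynomial ℕ R) :
    (X i - X (i + 1)) * dd i F = F - sw R i F :=
  (dvd_sub_sw i F).choose_spec.symm

theorem dd_eq_of {i : ℕ} {F D : MvPolynomial ℕ R} (h : (X i - X (i + 1)) * D = F - sw R i F) :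
    dd i F = D :=
  mul_left_cancel₀ (X_sub_X_ne_zero (R := R) i) ((dd_spec i F).trans h.symm)

theorem sw_eq (i : ℕ) (F : MvPolynomial ℕ R) : sw R i F = F - (X i - X (i + 1)) * dd i F := by
  rw [dd_spec]; ring

theorem dd_eq_zero_iff {i : ℕ} {F : MvPolynomial ℕ R} : dd i F = 0 ↔ sw R i F = F := by
  constructor
  · intro h; rw [sw_eq, h]; ring
  · intro h; apply dd_eq_of; rw [h]; ring

theorem dd_mul (i : ℕ) (F G : MvPolynomial ℕ R) :
    dd i (F * G) = dd i F * G + sw R i F * dd i G := by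
  apply dd_eq_of
  rw [map_mul, mul_add, ← mul_assoc, dd_spec, mul_left_comm, dd_spec]
  ring

theorem dd_mul_of_dd_eq_zero {i : ℕ} {P : MvPolynomial ℕ R} (h : dd i P = 0)
    (F : MvPolynomial ℕ R) : dd i (P * F) = P * dd i F := by
  rw [dd_mul, h, dd_eq_zero_iff.1 h]; ring

@[simp] theorem dd_dd (i : ℕ) (F : MvPolynomial ℕ R) : dd i (dd i F) = 0 := by
  rw [dd_eq_zero_iff]
  apply mul_left_cancel₀ (X_sub_X_ne_zero (R := R) i)
  have h := congrArg (sw R i) (dd_spec i F)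
  simp only [map_mul, map_sub, sw_X_left, sw_X_right, sw_sw] at h
  linear_combination -h - dd_spec i F

@[simp] theorem dd_X_left (i : ℕ) : dd i (X i : MvPolynomial ℕ R) = 1 :=
  dd_eq_of (by simp)

@[simp] theorem dd_X_right (i : ℕ) : dd i (X (i + 1) : MvPolynomial ℕ R) = -1 :=
  dd_eq_of (by simp)

theorem dd_X_of_ne {i j : ℕ} (h1 : j ≠ i) (h2 : j ≠ i + 1) : dd i (X j : MvPolynomial ℕ R) = 0 :=
  dd_eq_zero_iff.2 (sw_X_of_ne h1 h2)

@[simp] theorem dd_C (i : ℕ) (r : R) : dd i (C r) = 0 :=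
  dd_eq_zero_iff.2 (AlgHom.commutes _ _)

@[simp] theorem dd_one (i : ℕ) : dd i (1 : MvPolynomial ℕ R) = 0 := by
  rw [← C_1, dd_C]

/-- The inverse Demazure–Lusztig operator `T_i⁻¹`, where `u = t⁻¹`. -/
def opN (u : R) (i : ℕ) : Module.End R (MvPolynomial ℕ R) :=
  u • 1 + LinearMap.mulLeft R (C u * X (i + 1) - X i) * dd i

theorem opN_apply (u : R) (i : ℕ) (F : MvPolynomial ℕ R) :
    opN u i F = C u * F + (C u * X (i + 1) - X i) * dd i F := by
  simp [opN, smul_eq_C_mul]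

theorem opN_of_dd_eq_zero {u : R} {i : ℕ} {F : MvPolynomial ℕ R} (h : dd i F = 0) :
    opN u i F = C u * F := by
  rw [opN_apply, h]; ring

theorem C_mul_X_sub_X_ne_zero (u : R) (i : ℕ) :
    (C u * X (i + 1) - X i : MvPolynomial ℕ R) ≠ 0 := by
  intro h
  have := congrArg (coeff (Finsupp.single i 1)) h
  simp [coeff_C_mul, coeff_X, Finsupp.single_left_inj] at this

/-- Symmetry in `X_i, X_{i+1}` is an eigenvalue condition, so it can be carried through products of
operators by Hecke relations alone. The converse direction cancels the nonzero factor `u X_{i+1} -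
X_i`. -/
theorem opN_eq_iff {u : R} {i : ℕ} {F : MvPolynomial ℕ R} :
    opN u i F = C u * F ↔ dd i F = 0 := by
  refine ⟨fun h => ?_, opN_of_dd_eq_zero⟩
  rw [opN_apply, add_eq_left, mul_eq_zero] at h
  exact h.resolve_left (C_mul_X_sub_X_ne_zero u i)

theorem opN_mul_of_dd_eq_zero {u : R} {i : ℕ} {P : MvPolynomial ℕ R} (h : dd i P = 0)
    (F : MvPolynomial ℕ R) : opN u i (P * F) = P * opN u i F := by
  simp only [opN_apply, dd_mul_of_dd_eq_zero h]; ring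

theorem opN_C_mul (u : R) (i : ℕ) (r : R) (F : MvPolynomial ℕ R) :
    opN u i (C r * F) = C r * opN u i F :=
  opN_mul_of_dd_eq_zero (dd_C i r) F

/-- The cross relations: together with the action on constants, this lemma and the next two
determine `opN`. The operators `Y_i` will satisfy the same relations. -/
theorem opN_X_left (u : R) (i : ℕ) (F : MvPolynomial ℕ R) :
    opN u i (X i * F) = X (i + 1) * opN u i F + (C u - 1) * (X i * F) := by
  simp only [opN_apply, dd_mul, dd_X_left, sw_X_left]; ring

theorem opN_X_right (u : R) (i : ℕ) (F : MvPolynomial ℕ R) :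
    opN u i (X (i + 1) * F) = X i * opN u i F - (C u - 1) * (X i * F) := by
  simp only [opN_apply, dd_mul, dd_X_right, sw_X_right]; ring

theorem opN_X_of_ne (u : R) {i j : ℕ} (h1 : j ≠ i) (h2 : j ≠ i + 1) (F : MvPolynomial ℕ R) :
    opN u i (X j * F) = X j * opN u i F :=
  opN_mul_of_dd_eq_zero (dd_X_of_ne h1 h2) F

/-- The quadratic relation `(T_i⁻¹ - u)(T_i⁻¹ + 1) = 0`; it holds because `∂_i T_i⁻¹ = -∂_i`. -/
theorem opN_opN (u : R) (i : ℕ) (F : MvPolynomial ℕ R) :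
    opN u i (opN u i F) = (C u - 1) * opN u i F + C u * F := by
  have h : dd i (opN u i F) = - dd i F := by
    rw [opN_apply, map_add, dd_mul_of_dd_eq_zero (dd_C i u), mul_comm,
      mul_comm (C u * X (i + 1) - X i : MvPolynomial ℕ R), dd_mul_of_dd_eq_zero (dd_dd i F)]
    simp only [map_sub, dd_mul_of_dd_eq_zero (dd_C i u), dd_X_left, dd_X_right]
    ring
  rw [opN_apply, h, opN_apply]
  ring

/-- Both sides agree on constants, and the cross relations move a variable past them in the same
way, so induction on the polynomial suffices. The braid relation below is proved in the same manner.
-/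
theorem opN_comm_aux (u : R) {i j : ℕ} (h : i + 2 ≤ j) (F : MvPolynomial ℕ R) :
    opN u i (opN u j F) = opN u j (opN u i F) := by
  induction F using MvPolynomial.induction_on with
  | C a => simp only [opN_of_dd_eq_zero (dd_C _ a), opN_C_mul]
  | add p q hp hq => simp only [map_add, hp, hq]
  | mul_X p k hp =>
    rw [mul_comm]
    have hc : ∀ (j : ℕ) (F : MvPolynomial ℕ R),
        opN u j ((C u - 1) * F) = (C u - 1) * opN u j F := by
      intro j F; rw [← C_1, ← C_sub, opN_C_mul]
    by_cases h1 : k = i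
    · subst h1
      simp only [opN_X_left, map_add, hc, opN_X_of_ne u (show k ≠ j by omega)
        (show k ≠ j + 1 by omega), opN_X_of_ne u (show k + 1 ≠ j by omega)
        (show k + 1 ≠ j + 1 by omega), hp]
    by_cases h2 : k = i + 1
    · subst h2
      simp only [opN_X_right, map_sub, hc, opN_X_of_ne u (show i ≠ j by omega)
        (show i ≠ j + 1 by omega), opN_X_of_ne u (show i + 1 ≠ j by omega)
        (show i + 1 ≠ j + 1 by omega), hp]
    by_cases h3 : k = j
    · subst h3
      simp only [opN_X_left, map_add, hc, opN_X_of_ne u h1 h2,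
        opN_X_of_ne u (show k + 1 ≠ i by omega) (show k + 1 ≠ i + 1 by omega), hp]
    by_cases h4 : k = j + 1
    · subst h4
      simp only [opN_X_right, map_sub, hc, opN_X_of_ne u h1 h2,
        opN_X_of_ne u (show j ≠ i by omega) (show j ≠ i + 1 by omega), hp]
    simp only [opN_X_of_ne u h1 h2, opN_X_of_ne u h3 h4, hp]

theorem opN_comm (u : R) {i j : ℕ} (h : i + 2 ≤ j ∨ j + 2 ≤ i) :
    opN u i * opN u j = opN u j * opN u i := by
  refine LinearMap.ext fun F => ?_
  rcases h with h | h
  · exact opN_comm_aux u h F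
  · exact (opN_comm_aux u h F).symm

theorem opN_braid_apply (u : R) (i : ℕ) (F : MvPolynomial ℕ R) :
    opN u i (opN u (i + 1) (opN u i F)) = opN u (i + 1) (opN u i (opN u (i + 1) F)) := by
  induction F using MvPolynomial.induction_on with
  | C a => simp only [opN_of_dd_eq_zero (dd_C _ a), opN_C_mul]
  | add p q hp hq => simp only [map_add, hp, hq]
  | mul_X p k hp =>
    rw [mul_comm]
    have hc : ∀ (j : ℕ) (F : MvPolynomial ℕ R),
        opN u j ((C u - 1) * F) = (C u - 1) * opN u j F := by
      intro j F; rw [← C_1, ← C_sub, opN_C_mul]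
    have e1 : ∀ F : MvPolynomial ℕ R, opN u (i + 1) (X i * F) = X i * opN u (i + 1) F :=
      opN_X_of_ne u (by omega) (by omega)
    have e2 : ∀ F : MvPolynomial ℕ R, opN u i (X (i + 1 + 1) * F) = X (i + 1 + 1) * opN u i F :=
      opN_X_of_ne u (by omega) (by omega)
    by_cases h1 : k = i
    · subst h1
      simp only [opN_X_left, opN_X_right, map_add, hc, e1, e2, opN_opN, mul_add, hp]
      ring
    by_cases h2 : k = i + 1
    · subst h2
      simp only [opN_X_left, opN_X_right, map_add, map_sub, hc, e1, e2, mul_add, hp]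
      ring
    by_cases h3 : k = i + 1 + 1
    · subst h3
      simp only [opN_X_right, map_sub, hc, e1, e2, opN_opN, mul_add, hp]
      ring
    simp only [opN_X_of_ne u h1 h2, opN_X_of_ne u h2 h3, hp]

theorem opN_braid (u : R) (i : ℕ) :
    opN u i * opN u (i + 1) * opN u i = opN u (i + 1) * opN u i * opN u (i + 1) :=
  LinearMap.ext (opN_braid_apply u i)

/-- A ring homomorphism that intertwines exchanges of variables intertwines divided differences. -/
theorem map_dd {R' : Type*} [CommRing R'] [IsDomain R']
    (φ : MvPolynomial ℕ R →+* MvPolynomial ℕ R') {i j : ℕ}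
    (h : φ (X i - X (i + 1)) = X j - X (j + 1))
    (hs : ∀ F, φ (sw R i F) = sw R' j (φ F)) (F : MvPolynomial ℕ R) :
    φ (dd i F) = dd j (φ F) := by
  symm
  apply dd_eq_of
  rw [← h, ← map_mul, dd_spec, map_sub, hs]

theorem map_opN {R' : Type*} [CommRing R'] [IsDomain R']
    (φ : MvPolynomial ℕ R →+* MvPolynomial ℕ R') {u : R} {u' : R'} (hu : φ (C u) = C u') {i j : ℕ}
    (h : φ (X i) = X j) (h' : φ (X (i + 1)) = X (j + 1))
    (hs : ∀ F, φ (sw R i F) = sw R' j (φ F)) (F : MvPolynomial ℕ R) :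
    φ (opN u i F) = opN u' j (φ F) := by
  rw [opN_apply, opN_apply, ← map_dd φ (by rw [map_sub, h, h']) hs]
  simp only [map_add, map_mul, map_sub, hu, h, h']

theorem totalDegree_dd (i : ℕ) {F : MvPolynomial ℕ R} (h : dd i F ≠ 0) :
    (dd i F).totalDegree + 1 ≤ F.totalDegree := by
  have h1 : (X i - X (i + 1) : MvPolynomial ℕ R).totalDegree = 1 := by
    have : (X i - X (i + 1) : MvPolynomial ℕ R).IsHomogeneous 1 :=
      (isHomogeneous_X R i).sub (isHomogeneous_X R (i + 1))
    exact this.totalDegree (X_sub_X_ne_zero i)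
  have h2 := totalDegree_mul_of_isDomain (X_sub_X_ne_zero (R := R) i) h
  rw [dd_spec, h1] at h2
  have h3 : (F - sw R i F).totalDegree ≤ F.totalDegree :=
    (totalDegree_sub _ _).trans (max_le le_rfl (totalDegree_rename_le _ _))
  omega

theorem totalDegree_opN_le (u : R) (i : ℕ) (F : MvPolynomial ℕ R) :
    (opN u i F).totalDegree ≤ F.totalDegree := by
  rw [opN_apply]
  refine (totalDegree_add _ _).trans (max_le ?_ ?_)
  · exact (totalDegree_mul _ _).trans (by simp)
  · by_cases h : dd i F = 0
    · simp [h]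
    · have h1 : (C u * X (i + 1) - X i : MvPolynomial ℕ R).totalDegree ≤ 1 := by
        refine (totalDegree_sub _ _).trans (max_le ((totalDegree_mul _ _).trans ?_) ?_) <;> simp
      have := totalDegree_mul (C u * X (i + 1) - X i : MvPolynomial ℕ R) (dd i F)
      have := totalDegree_dd i h
      omega

theorem totalDegree_aeval_le {σ τ : Type*} {R : Type*} [CommRing R]
    {f : σ → MvPolynomial τ R} (hf : ∀ i, (f i).totalDegree ≤ 1) (F : MvPolynomial σ R) :
    (aeval f F).totalDegree ≤ F.totalDegree := by
  rw [aeval_def, eval₂_eq]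
  refine totalDegree_finsetSum_le fun d hd => ?_
  refine (totalDegree_mul _ _).trans ?_
  rw [algebraMap_eq, totalDegree_C, zero_add]
  exact (totalDegree_finsetProd _ _).trans (le_trans (Finset.sum_le_sum fun i _ =>
    (totalDegree_pow _ _).trans (mul_le_of_le_one_right' (hf i))) (le_totalDegree hd))

end Poly

section Poly

open MvPolynomial

variable {R : Type*} [CommRing R] [IsDomain R]

/-! ## Partial symmetrizers -/

/-- `T_{k-1}⁻¹ ⋯ T_0⁻¹`. -/
def desc (u : R) : ℕ → Module.End R (MvPolynomial ℕ R)
  | 0 => 1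
  | k + 1 => opN u k * desc u k

@[simp] theorem desc_zero (u : R) (F : MvPolynomial ℕ R) : desc u 0 F = F := rfl

theorem desc_succ (u : R) (k : ℕ) (F : MvPolynomial ℕ R) :
    desc u (k + 1) F = opN u k (desc u k F) := rfl

/-- The partial symmetrizer `1 + T_0⁻¹ + ⋯ + T_{M-2}⁻¹ ⋯ T_0⁻¹`. -/
def pSym (u : R) (M : ℕ) : Module.End R (MvPolynomial ℕ R) :=
  ∑ k ∈ Finset.range M, desc u k

theorem pSym_apply (u : R) (M : ℕ) (F : MvPolynomial ℕ R) :
    pSym u M F = ∑ k ∈ Finset.range M, desc u k F := by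
  simp [pSym]

@[simp] theorem pSym_zero (u : R) (F : MvPolynomial ℕ R) : pSym u 0 F = 0 := by
  simp [pSym_apply]

theorem pSym_succ (u : R) (M : ℕ) (F : MvPolynomial ℕ R) :
    pSym u (M + 1) F = pSym u M F + desc u M F := by
  simp [pSym_apply, Finset.sum_range_succ]

theorem opN_desc_of_lt (u : R) {j k : ℕ} (h : k < j) (F : MvPolynomial ℕ R) :
    opN u j (desc u k F) = desc u k (opN u j F) := by
  induction k with
  | zero => rfl
  | succ k ih =>
    rw [desc_succ, ← opN_comm_aux u (i := k) (j := j) (by omega), ih (by omega), desc_succ]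

/-- The braid relation raises the index by one at the factors `T_{j+1}⁻¹ T_j⁻¹`; all other factors
commute. -/
theorem opN_desc_of_add_two_le (u : R) {j k : ℕ} (h : j + 2 ≤ k) (F : MvPolynomial ℕ R) :
    opN u j (desc u k F) = desc u k (opN u (j + 1) F) := by
  induction k, h using Nat.le_induction with
  | base => rw [desc_succ, desc_succ, opN_braid_apply, opN_desc_of_lt u (Nat.lt_succ_self j)]; rfl
  | succ k hk ih => rw [desc_succ, opN_comm_aux u hk, ih, desc_succ]

theorem dd_desc_eq_zero {u : R} {j k : ℕ} (h : k < j) {F : MvPolynomial ℕ R} (hF : dd j F = 0) :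
    dd j (desc u k F) = 0 := by
  rw [← opN_eq_iff (u := u), opN_desc_of_lt u h, opN_of_dd_eq_zero hF, ← smul_eq_C_mul, map_smul,
    smul_eq_C_mul]

/-- Symmetrization: `pSym M` sends polynomials symmetric in `X_1, …, X_{M-1}` to polynomials
symmetric in `X_0, …, X_{M-1}`. -/
theorem dd_pSym_eq_zero {u : R} {M : ℕ} {G : MvPolynomial ℕ R}
    (hG : ∀ j, 1 ≤ j → j + 1 < M → dd j G = 0) {j : ℕ} (hj : j + 1 < M) :
    dd j (pSym u M G) = 0 := by
  rw [← opN_eq_iff (u := u)]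
  obtain ⟨K, rfl⟩ : ∃ K, M = j + 2 + K := ⟨M - (j + 2), by omega⟩
  have hC : ∀ (k : ℕ) (F : MvPolynomial ℕ R), desc u k (C u * F) = C u * desc u k F := by
    intro k F; rw [← smul_eq_C_mul, map_smul, smul_eq_C_mul]
  have h1 : ∀ k < j, opN u j (desc u k G) = C u * desc u k G := fun k hk => by
    rw [opN_desc_of_lt u hk, opN_of_dd_eq_zero (hG j (by omega) hj), hC]
  have h2 : ∀ k < K, opN u j (desc u (j + 2 + k) G) = C u * desc u (j + 2 + k) G :=
    fun k hk => by
      rw [opN_desc_of_add_two_le u (by omega),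
        opN_of_dd_eq_zero (hG (j + 1) (by omega) (by omega)), hC]
  -- Every term with `k < j` or `k ≥ j + 2` is itself an eigenvector of `T_j⁻¹`. The remaining two
  -- have the form `D + T_j⁻¹ D`, which has eigenvalue `u` by the quadratic relation.
  rw [pSym_apply, Finset.sum_range_add, Finset.sum_range_succ, Finset.sum_range_succ]
  simp only [map_add, map_sum, mul_add, Finset.mul_sum]
  rw [Finset.sum_congr rfl fun k hk => h1 k (Finset.mem_range.1 hk),
    Finset.sum_congr rfl fun k hk => h2 k (Finset.mem_range.1 hk), desc_succ, opN_opN]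
  ring

theorem pSym_mul {u : R} {M : ℕ} {P : MvPolynomial ℕ R} (hP : ∀ j, j + 1 < M → dd j P = 0)
    (F : MvPolynomial ℕ R) : pSym u M (P * F) = P * pSym u M F := by
  have : ∀ k < M, desc u k (P * F) = P * desc u k F := by
    intro k hk
    induction k with
    | zero => rfl
    | succ k ih => rw [desc_succ, ih (by omega), opN_mul_of_dd_eq_zero (hP k hk), desc_succ]
  rw [pSym_apply, pSym_apply, Finset.mul_sum]
  exact Finset.sum_congr rfl fun k hk => this k (Finset.mem_range.1 hk)

theorem map_pSym {R' : Type*} [CommRing R'] [IsDomain R']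
    (φ : MvPolynomial ℕ R →+* MvPolynomial ℕ R') {u : R} {u' : R'} {M : ℕ}
    (h : ∀ i, i + 1 < M → ∀ F, φ (opN u i F) = opN u' i (φ F)) (F : MvPolynomial ℕ R) :
    φ (pSym u M F) = pSym u' M (φ F) := by
  have : ∀ k < M, φ (desc u k F) = desc u' k (φ F) := by
    intro k hk
    induction k with
    | zero => rfl
    | succ k ih => rw [desc_succ, h k hk, ih (by omega), desc_succ]
  rw [pSym_apply, pSym_apply, map_sum]
  exact Finset.sum_congr rfl fun k hk => this k (Finset.mem_range.1 hk)

theorem totalDegree_pSym_le (u : R) (M : ℕ) (F : MvPolynomial ℕ R) :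
    (pSym u M F).totalDegree ≤ F.totalDegree := by
  rw [pSym_apply]
  have h : ∀ k, (desc u k F).totalDegree ≤ F.totalDegree := fun k => by
    induction k with
    | zero => rw [desc_zero]
    | succ k ih => rw [desc_succ]; exact (totalDegree_opN_le _ _ _).trans ih
  exact (totalDegree_finsetSum _ _).trans (Finset.sup_le fun k _ => h k)

/-! ## Setting variables to zero -/

/-- The substitution `X_M ↦ 0` followed by a renumbering of the variables. -/
def kill (R : Type*) [CommRing R] (M : ℕ) : MvPolynomial ℕ R →ₐ[R] MvPolynomial ℕ R :=
  aeval fun j => if j < M then X j else if j = M then 0 else X (j - 1)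

theorem kill_X {R : Type*} [CommRing R] (M j : ℕ) :
    kill R M (X j) = if j < M then X j else if j = M then 0 else X (j - 1) := by
  simp [kill]

/-- The substitution `X_j ↦ 0` for `j ≥ M`. -/
def cut (R : Type*) [CommRing R] (M : ℕ) : MvPolynomial ℕ R →ₐ[R] MvPolynomial ℕ R :=
  aeval fun j => if j < M then X j else 0

theorem cut_X {R : Type*} [CommRing R] (M j : ℕ) : cut R M (X j) = if j < M then X j else 0 := by
  simp [cut]

theorem kill_opN (u : R) {M i : ℕ} (h : i + 1 < M) (F : MvPolynomial ℕ R) :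
    kill R M (opN u i F) = opN u i (kill R M F) := by
  refine map_opN (kill R M).toRingHom (i := i) (j := i) (by simp) ?_ ?_ (fun F => ?_) F
  · simp [kill_X]; omega
  · simp [kill_X, h]
  · have : (kill R M).comp (sw R i) = (sw R i).comp (kill R M) := by
      ext1 j
      simp only [AlgHom.comp_apply, sw_X, kill_X]
      rcases lt_trichotomy j M with hj | hj | hj
      · rw [if_pos hj, sw_X, if_pos]
        rw [Equiv.swap_apply_def]; split_ifs <;> omega
      · subst hj
        rw [Equiv.swap_apply_of_ne_of_ne (show j ≠ i by omega) (show j ≠ i + 1 by omega)]; simp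
      · rw [Equiv.swap_apply_of_ne_of_ne (by omega) (by omega), if_neg (by omega),
          if_neg (by omega), sw_X_of_ne (by omega) (by omega)]
    exact DFunLike.congr_fun this F

theorem cut_opN (u : R) {M i : ℕ} (h : i + 1 < M) (F : MvPolynomial ℕ R) :
    cut R M (opN u i F) = opN u i (cut R M F) := by
  refine map_opN (cut R M).toRingHom (i := i) (j := i) (by simp) ?_ ?_ (fun F => ?_) F
  · simp [cut_X]; omega
  · simp [cut_X, h]
  · have : (cut R M).comp (sw R i) = (sw R i).comp (cut R M) := by
      ext1 j
      simp only [AlgHom.comp_apply, sw_X, cut_X]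
      by_cases hj : j < M
      · rw [if_pos hj, sw_X, if_pos]
        rw [Equiv.swap_apply_def]; split_ifs <;> omega
      · simp [Equiv.swap_apply_of_ne_of_ne (show j ≠ i by omega) (show j ≠ i + 1 by omega), hj]
    exact DFunLike.congr_fun this F

theorem kill_succ_sw (M : ℕ) (F : MvPolynomial ℕ R) : kill R (M + 1) (sw R M F) = kill R M F := by
  have : (kill R (M + 1)).comp (sw R M) = kill R M := by
    ext1 j
    simp only [AlgHom.comp_apply, sw_X, kill_X]
    by_cases h1 : j = M
    · subst h1; simp
    by_cases h2 : j = M + 1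
    · subst h2; simp
    rw [Equiv.swap_apply_of_ne_of_ne h1 h2]
    split_ifs <;> first | rfl | omega
  exact DFunLike.congr_fun this F

/-- At `X_{k+1} = 0` the operator reads `F ↦ (u - 1) F + s_k F`, and exchanging `X_k, X_{k+1}`
before killing `X_{k+1}` amounts to killing `X_k`. -/
theorem kill_succ_opN (u : R) (k : ℕ) (F : MvPolynomial ℕ R) :
    kill R (k + 1) (opN u k F) = (C u - 1) * kill R (k + 1) F + kill R k F := by
  have h : kill R (k + 1) (X (k + 1)) = 0 := by simp [kill_X]
  have h' : kill R (k + 1) (C u : MvPolynomial ℕ R) = C u := AlgHom.commutes _ _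
  rw [← kill_succ_sw k F, sw_eq, opN_apply]
  simp only [map_add, map_mul, map_sub, h, h']
  ring

/-- For a polynomial symmetric in `X_k, …, X_M` it does not matter which of these variables is
killed. -/
theorem kill_eq_of_dd {M k : ℕ} (hk : k ≤ M) {F : MvPolynomial ℕ R}
    (h : ∀ j, k ≤ j → j < M → dd j F = 0) : kill R M F = kill R k F := by
  induction M, hk using Nat.le_induction with
  | base => rfl
  | succ M hM ih =>
    rw [← ih fun j h1 h2 => h j h1 (by omega), ← kill_succ_sw M F,
      dd_eq_zero_iff.1 (h M hM (by omega))]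

/-- Compatibility of partial symmetrizers with setting the last variable to zero. -/
theorem kill_pSym {u : R} {M : ℕ} {G : MvPolynomial ℕ R}
    (hG : ∀ j, 1 ≤ j → j < M → dd j G = 0) (h0 : kill R 0 G = 0) :
    kill R M (pSym u (M + 1) G) = C u * pSym u M (kill R M G) := by
  have h1 : ∀ k < M, kill R M (desc u k G) = desc u k (kill R M G) := by
    intro k hk
    induction k with
    | zero => rfl
    | succ k ih => rw [desc_succ, kill_opN u (by omega), ih (by omega), desc_succ]
  -- The last term of the symmetrizer collapses to `u - 1` times the sum of all earlier ones, whence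
  -- the factor `u`. The recursion on `k` replaces the killed variable by an earlier one, using the
  -- symmetry in later variables, and ends at `X_0`, which divides out `G` by `h0`.
  have h2 : ∀ k ≤ M, kill R k (desc u k G) =
      (C u - 1) * ∑ j ∈ Finset.range k, desc u j (kill R M G) := by
    intro k hk
    induction k with
    | zero => simpa using h0
    | succ k ih =>
      rw [desc_succ, kill_succ_opN, ih (by omega), Finset.sum_range_succ, ← h1 k (by omega),
        kill_eq_of_dd hk fun j h3 h4 => dd_desc_eq_zero h3 (hG j (by omega) h4)]
      ring
  rw [pSym_succ, map_add, h2 M le_rfl, pSym_apply, pSym_apply, map_sum,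
    Finset.sum_congr rfl fun k hk => h1 k (Finset.mem_range.1 hk)]
  ring

/-! ## The operator `Π` -/

/-- The substitution `X_j ↦ X_{j+1}` for `j < m - 1` and `X_{m-1} ↦ p X_0`. -/
def rot (p : R) (m : ℕ) : MvPolynomial ℕ R →ₐ[R] MvPolynomial ℕ R :=
  aeval fun j => if j + 1 < m then X (j + 1) else if j + 1 = m then C p * X 0 else X j

theorem rot_X {R : Type*} [CommRing R] (p : R) (m j : ℕ) : rot p m (X j) =
    if j + 1 < m then X (j + 1) else if j + 1 = m then C p * X 0 else X j := by
  simp [rot]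

/-- The operator `Π` in `m` variables, where `p = q⁻¹`. -/
def opR (p : R) (m : ℕ) : Module.End R (MvPolynomial ℕ R) :=
  LinearMap.mulLeft R (X 0) * (rot p m).toLinearMap

theorem opR_apply (p : R) (m : ℕ) (F : MvPolynomial ℕ R) : opR p m F = X 0 * rot p m F := rfl

theorem rot_sw (p : R) {m i : ℕ} (h : i + 2 < m) (F : MvPolynomial ℕ R) :
    rot p m (sw R i F) = sw R (i + 1) (rot p m F) := by
  have : (rot p m).comp (sw R i) = (sw R (i + 1)).comp (rot p m) := by
    ext1 j
    simp only [AlgHom.comp_apply, sw_X, rot_X]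
    by_cases h1 : j = i
    · subst h1
      rw [Equiv.swap_apply_left, if_pos (by omega), if_pos (by omega), sw_X_left]
    by_cases h2 : j = i + 1
    · subst h2
      rw [Equiv.swap_apply_right, if_pos (by omega), if_pos (by omega), sw_X_right]
    rw [Equiv.swap_apply_of_ne_of_ne h1 h2]
    have h3 : sw R (i + 1) (C p : MvPolynomial ℕ R) = C p := AlgHom.commutes _ _
    split_ifs
    · rw [sw_X_of_ne (by omega) (by omega)]
    · rw [map_mul, h3, sw_X_of_ne (by omega) (by omega)]
    · rw [sw_X_of_ne (by omega) (by omega)]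
  exact DFunLike.congr_fun this F

theorem opR_opN (p u : R) {m i : ℕ} (h : i + 2 < m) (F : MvPolynomial ℕ R) :
    opR p m (opN u i F) = opN u (i + 1) (opR p m F) := by
  rw [opR_apply, opR_apply, opN_X_of_ne u (by omega) (by omega)]
  congr 1
  refine map_opN (rot p m).toRingHom (by simp) ?_ ?_ (rot_sw p h) F
  · simp [rot_X]; omega
  · simp [rot_X]; omega

theorem dd_opR (p : R) {m i : ℕ} (h : i + 2 < m) {F : MvPolynomial ℕ R} (hF : dd i F = 0) :
    dd (i + 1) (opR p m F) = 0 := by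
  rw [← opN_eq_iff (u := 1), ← opR_opN p 1 h, opN_of_dd_eq_zero hF]
  simp

theorem totalDegree_opR_le (p : R) (m : ℕ) (F : MvPolynomial ℕ R) :
    (opR p m F).totalDegree ≤ F.totalDegree + 1 := by
  have h : (rot p m F).totalDegree ≤ F.totalDegree := by
    refine totalDegree_aeval_le (fun i => ?_) F
    split_ifs
    · simp
    · exact (totalDegree_mul _ _).trans (by simp)
    · simp
  rw [opR_apply]
  have := totalDegree_mul (X 0 : MvPolynomial ℕ R) (rot p m F)
  rw [totalDegree_X] at this
  omega

theorem kill_opR (p : R) {m M : ℕ} (hM : M < m) (F : MvPolynomial ℕ R) :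
    kill R (M + 1) (opR p (m + 1) F) = opR p m (kill R M F) := by
  have : (kill R (M + 1)).comp (rot p (m + 1)) = (rot p m).comp (kill R M) := by
    ext1 j
    simp only [AlgHom.comp_apply, rot_X, kill_X]
    have h3 : kill R (M + 1) (C p : MvPolynomial ℕ R) = C p := AlgHom.commutes _ _
    rcases lt_trichotomy j M with hj | hj | hj
    · rw [if_pos hj, if_pos (by omega), rot_X, if_pos (by omega), kill_X, if_pos (by omega)]
    · subst hj; simp [hM, kill_X]
    · have e : (if j < M then X j else if j = M then 0 else X (j - 1) : MvPolynomial ℕ R) =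
          X (j - 1) := by rw [if_neg (by omega), if_neg (by omega)]
      rw [e, rot_X]
      rcases lt_trichotomy j m with hm | hm | hm
      · rw [if_pos (by omega), if_pos (by omega), kill_X, if_neg (by omega), if_neg (by omega)]
        congr 1; omega
      · subst hm
        rw [if_neg (by omega), if_pos rfl, if_neg (by omega), if_pos (by omega), map_mul, h3,
          kill_X, if_pos (by omega)]
      · rw [if_neg (by omega), if_neg (by omega), if_neg (by omega), if_neg (by omega), kill_X,
          if_neg (by omega), if_neg (by omega)]
  rw [opR_apply, opR_apply, map_mul, kill_X, if_pos (by omega)]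
  congr 1
  exact DFunLike.congr_fun this F

/-! ## The iterated operators -/

/-- `(pSym (m - d_1) Π) ⋯ (pSym (m - d_n) Π) · 1` for a list `[d_1, …, d_n]`. -/
def word (u p : R) (m : ℕ) : List ℕ → MvPolynomial ℕ R
  | [] => 1
  | d :: ds => pSym u (m - d) (opR p m (word u p m ds))

/-- Lists `[d_1, …, d_n]` with `d_{i+1} ≤ d_i + 1`. -/
def IsArea : List ℕ → Prop
  | [] => True
  | d :: ds => ds.headD 0 ≤ d + 1 ∧ IsArea ds

theorem totalDegree_word_le (u p : R) (m : ℕ) (ds : List ℕ) :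
    (word u p m ds).totalDegree ≤ ds.length := by
  induction ds with
  | nil => simp [word]
  | cons d ds ih =>
    exact (totalDegree_pSym_le _ _ _).trans ((totalDegree_opR_le _ _ _).trans (by simpa using ih))

/-- `Π` moves the symmetric range `X_0, …, X_{m-d'-1}` of the tail, whose head is `d'`, up by one
index, within the `m` variables. Since `d' ≤ d + 1`, it then covers `X_1, …, X_{m-d-1}`, as the
symmetrizer requires. -/
theorem dd_word (u p : R) (m : ℕ) {ds : List ℕ} (h : IsArea ds) {j : ℕ}
    (hj : j + 1 < m - ds.headD 0) : dd j (word u p m ds) = 0 := by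
  induction ds generalizing j with
  | nil => simp [word]
  | cons d ds ih =>
    rw [List.headD_cons] at hj
    refine dd_pSym_eq_zero (fun i h1 h2 => ?_) hj
    obtain ⟨i, rfl⟩ : ∃ k, i = k + 1 := ⟨i - 1, by omega⟩
    refine dd_opR p (by omega) (ih h.2 ?_)
    have := h.1
    omega

theorem word_eq_zero (u p : R) {m : ℕ} {ds : List ℕ} (h : m ≤ ds.headD 0) (hm : 0 < m) :
    word u p m ds = 0 := by
  cases ds with
  | nil => simp at h; omega
  | cons d ds =>
    rw [List.headD_cons] at h
    rw [word, Nat.sub_eq_zero_of_le h, pSym_zero]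

/-- Each letter contributes one factor `u` through `kill_pSym`, while `Π` in `m + 1` variables turns
into `Π` in `m` variables. -/
theorem kill_word (u p : R) {m : ℕ} (hm : 0 < m) {ds : List ℕ} (h : IsArea ds)
    (hd : ds.headD 0 ≤ m) :
    kill R (m - ds.headD 0) (word u p (m + 1) ds) = C u ^ ds.length * word u p m ds := by
  induction ds with
  | nil => simp [word]
  | cons d ds ih =>
    rw [List.headD_cons] at hd ⊢
    have hA := h.1
    have hG : ∀ j, 1 ≤ j → j < m + 1 - ds.headD 0 → j < m →
        dd j (opR p (m + 1) (word u p (m + 1) ds)) = 0 := by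
      intro j h1 h2 h3
      obtain ⟨i, rfl⟩ : ∃ k, j = k + 1 := ⟨j - 1, by omega⟩
      exact dd_opR p (by omega) (dd_word u p (m + 1) h.2 (by omega))
    have h0 : kill R 0 (opR p (m + 1) (word u p (m + 1) ds)) = 0 := by
      rw [opR_apply, map_mul, kill_X]; simp
    rw [word, show m + 1 - d = m - d + 1 by omega,
      kill_pSym (fun j h1 h2 => hG j h1 (by omega) (by omega)) h0, word, List.length_cons]
    rcases Nat.eq_zero_or_pos (m - d) with hz | hpos
    · rw [hz]; simp
    have key : kill R (m - d) (opR p (m + 1) (word u p (m + 1) ds)) =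
        C u ^ ds.length * opR p m (word u p m ds) := by
      rcases Nat.lt_or_ge m (ds.headD 0) with hlt | hge
      · rw [word_eq_zero u p (ds := ds) (m := m + 1) (by omega) (by omega),
          word_eq_zero u p (ds := ds) (m := m) (by omega) hm]
        simp
      -- Killing `X_M` commutes with `Π` only for `M < m`. When the tail starts with 0 its range
      -- reaches `X_m`, so by symmetry `X_{m-1}` is killed instead.
      · have e1 : kill R (min (m - ds.headD 0) (m - 1)) (word u p (m + 1) ds) =
            kill R (m - ds.headD 0) (word u p (m + 1) ds) :=
          (kill_eq_of_dd (by omega)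
            fun j h1 h2 => dd_word u p (m + 1) h.2 (by omega)).symm
        have e2 := kill_opR p (m := m) (M := min (m - ds.headD 0) (m - 1)) (by omega)
          (word u p (m + 1) ds)
        rw [e1, ih h.2 hge] at e2
        rw [← kill_eq_of_dd (k := m - d) (M := min (m - ds.headD 0) (m - 1) + 1) (by omega)
          fun j h1 h2 => hG j (by omega) (by omega) (by omega), e2, ← map_pow, ← smul_eq_C_mul,
          map_smul, smul_eq_C_mul]
    rw [key, ← map_pow, pSym_mul fun j _ => dd_C j _, map_pow]
    ring

/-- This base change replaces limits by specializations: a word over `ℚ(t)[p]` gives both the word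
at `p = q⁻¹` and the word at `p = 0`. -/
theorem map_word {R' : Type*} [CommRing R'] [IsDomain R'] (f : R →+* R') (u p : R) (m : ℕ)
    (ds : List ℕ) : map f (word u p m ds) = word (f u) (f p) m ds := by
  induction ds with
  | nil => simp [word]
  | cons d ds ih =>
    rw [word, word, ← ih, opR_apply, opR_apply]
    rw [map_pSym (map f) (u' := f u)]
    · have : (map f).comp (rot p m).toRingHom = (rot (f p) m).toRingHom.comp (map f) := by
        refine ringHom_ext (fun r => ?_) fun j => ?_
        · simp
        · simp only [AlgHom.toRingHom_eq_coe, RingHom.comp_apply, RingHom.coe_coe, rot_X, map_X]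
          split_ifs <;> simp
      have := DFunLike.congr_fun this (word u p m ds)
      simp only [AlgHom.toRingHom_eq_coe, RingHom.comp_apply, RingHom.coe_coe] at this
      rw [map_mul, map_X, this]
    · intro i _ F
      refine map_opN (map f) (by simp) (by simp) (by simp) (fun F => ?_) F
      rw [sw, sw, map_rename]

end Poly

/-! ## Elementary symmetric polynomials -/

section Esymm

variable {S : Type*} [CommRing S]

/-- The elementary symmetric polynomial `e_r(a_0, …, a_{M-1})`. -/
def es (a : ℕ → S) : ℕ → ℕ → S
  | _, 0 => 1
  | 0, _ + 1 => 0
  | M + 1, r + 1 => es a M (r + 1) + a M * es a M r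

@[simp] theorem es_zero_right (a : ℕ → S) (M : ℕ) : es a M 0 = 1 := by cases M <;> rfl

@[simp] theorem es_zero_left (a : ℕ → S) (r : ℕ) : es a 0 (r + 1) = 0 := rfl

theorem es_succ (a : ℕ → S) (M r : ℕ) :
    es a (M + 1) (r + 1) = es a M (r + 1) + a M * es a M r := rfl

theorem es_eq_esymm (a : ℕ → S) (M r : ℕ) : es a M r = ((Multiset.range M).map a).esymm r := by
  induction M generalizing r with
  | zero => cases r <;> simp [Multiset.esymm, Multiset.powersetCard_zero_right]
  | succ M ih =>
    cases r with
    | zero => simp [Multiset.esymm]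
    | succ r =>
      rw [es_succ, ih, ih, Multiset.range_succ, Multiset.map_cons, Multiset.esymm, Multiset.esymm,
        Multiset.esymm, Multiset.powersetCard_cons, Multiset.map_add, Multiset.sum_add,
        Multiset.map_map, ← Multiset.sum_map_mul_left]
      simp

theorem map_es {S' F : Type*} [CommRing S'] [FunLike F S S'] [RingHomClass F S S'] (φ : F)
    (a : ℕ → S) (M r : ℕ) : φ (es a M r) = es (fun i => φ (a i)) M r := by
  induction M generalizing r with
  | zero => cases r <;> simp
  | succ M ih => cases r <;> simp [es_succ, ih]

theorem es_congr {a b : ℕ → S} {M : ℕ} (h : ∀ i < M, a i = b i) (r : ℕ) :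
    es a M r = es b M r := by
  induction M generalizing r with
  | zero => cases r <;> rfl
  | succ M ih =>
    have h' : ∀ i < M, a i = b i := fun i hi => h i (by omega)
    cases r with
    | zero => rfl
    | succ r => rw [es_succ, es_succ, ih h', ih h', h M (by omega)]

theorem es_of_eq_zero {a : ℕ → S} {K M : ℕ} (hKM : K ≤ M) (h : ∀ i, K ≤ i → i < M → a i = 0)
    (r : ℕ) : es a M r = es a K r := by
  induction M, hKM using Nat.le_induction generalizing r with
  | base => rfl
  | succ M hM ih =>
    cases r with
    | zero => simp
    | succ r =>
      rw [es_succ, h M hM (by omega), zero_mul, add_zero, ih fun i h1 h2 => h i h1 (by omega)]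

theorem aeval_esymm_fin {R : Type*} [CommRing R] [Algebra R S] (m r : ℕ) (a : ℕ → S) :
    MvPolynomial.aeval (fun i : Fin m => a i) (MvPolynomial.esymm (Fin m) R r) = es a m r := by
  rw [MvPolynomial.aeval_esymm_eq_multiset_esymm, es_eq_esymm]
  congr 1
  have := congrArg (Multiset.map a) (congrArg Finset.val (Fin.map_valEmbedding_univ (n := m)))
  rw [Finset.map_val, Multiset.map_map, Nat.Iio_eq_range] at this
  exact this

/-- The `t`-integer `1 + t + ⋯ + t^{r-1}`. -/
def tNum (t : S) (r : ℕ) : S := ∑ i ∈ Finset.range r, t ^ i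

/-- The `t`-factorial. -/
def tFac (t : S) (n : ℕ) : S := ∏ i ∈ Finset.range n, tNum t (i + 1)

theorem tNum_succ (t : S) (r : ℕ) : tNum t (r + 1) = tNum t r + t ^ r :=
  Finset.sum_range_succ _ _

theorem tNum_succ' (t : S) (r : ℕ) : tNum t (r + 1) = t * tNum t r + 1 := by
  rw [tNum, Finset.sum_range_succ', tNum, Finset.mul_sum]
  simp [pow_succ']

theorem tFac_succ (t : S) (n : ℕ) : tFac t (n + 1) = tFac t n * tNum t (n + 1) :=
  Finset.prod_range_succ _ _

theorem map_tNum {S' F : Type*} [CommRing S'] [FunLike F S S'] [RingHomClass F S S'] (φ : F)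
    (t : S) (r : ℕ) : φ (tNum t r) = tNum (φ t) r := by simp [tNum]

theorem map_tFac {S' F : Type*} [CommRing S'] [FunLike F S S'] [RingHomClass F S S'] (φ : F)
    (t : S) (r : ℕ) : φ (tFac t r) = tFac (φ t) r := by simp [tFac, map_tNum]

end Esymm

/-! ### Partial symmetrizers applied to elementary symmetric polynomials -/

section Poly

open MvPolynomial

variable {R : Type*} [CommRing R] [IsDomain R]

theorem dd_es_of_lt {i M : ℕ} (h : M ≤ i) (r : ℕ) :
    dd i (es X M r : MvPolynomial ℕ R) = 0 := by
  rw [dd_eq_zero_iff, map_es]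
  exact es_congr (fun j hj => sw_X_of_ne (by omega) (by omega)) r

theorem dd_es {i M : ℕ} (h : i + 1 < M) (r : ℕ) : dd i (es X M r : MvPolynomial ℕ R) = 0 := by
  induction M, h using Nat.le_induction generalizing r with
  | base =>
    rcases r with _ | _ | r
    · simp
    · rw [es_succ, es_succ, map_add, map_add, dd_es_of_lt le_rfl]; simp
    · have h1 : dd i (X (i + 1) * X i : MvPolynomial ℕ R) = 0 := by
        rw [dd_mul]; simp
      have e : (es X (i + 1 + 1) (r + 2) : MvPolynomial ℕ R) = es X i (r + 2) +
          es X i (r + 1) * (X i + X (i + 1)) + es X i r * (X (i + 1) * X i) := by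
        simp only [es_succ]; ring
      rw [Nat.succ_eq_add_one, e, map_add, map_add, dd_es_of_lt le_rfl,
        dd_mul_of_dd_eq_zero (dd_es_of_lt le_rfl _), dd_mul_of_dd_eq_zero (dd_es_of_lt le_rfl _),
        h1]
      simp
  | succ M hM ih =>
    cases r with
    | zero => simp
    | succ r =>
      rw [es_succ, map_add, ih, zero_add,
        dd_mul_of_dd_eq_zero (dd_X_of_ne (by omega) (by omega)), ih, mul_zero]

theorem desc_mul_of_ge {u : R} {k : ℕ} {P : MvPolynomial ℕ R} (hP : ∀ j < k, dd j P = 0)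
    (F : MvPolynomial ℕ R) : desc u k (P * F) = P * desc u k F := by
  induction k with
  | zero => rfl
  | succ k ih =>
    rw [desc_succ, ih fun j hj => hP j (by omega), opN_mul_of_dd_eq_zero (hP k (by omega)),
      desc_succ]

/-- A closed form for one term of the symmetrizer. The induction on `M` splits `X_{M+1}` off the
elementary symmetric polynomial, since `X_{M+1}` commutes with the first `M` operators. -/
theorem desc_X_mul_es {u t : R} (hut : u * t = 1) (M r : ℕ) :
    C t ^ M * desc u M (X 0 * es (fun i => X (i + 1)) M r) =
      X M * es X M r + (1 - C t ^ (r + 1)) * es X M (r + 1) := by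
  have hut' : (C u * C t : MvPolynomial ℕ R) = 1 := by rw [← C_mul, hut, C_1]
  have hN : ∀ (c F : MvPolynomial ℕ R) (M : ℕ), dd M c = 0 → opN u M (c * F) = c * opN u M F :=
    fun c F M h => opN_mul_of_dd_eq_zero h F
  have hc : ∀ (M k : ℕ), dd M ((1 - C t ^ k) : MvPolynomial ℕ R) = 0 := by
    intro M k; rw [← C_pow, map_sub, dd_one, dd_C, sub_zero]
  have hcc : ∀ (M k : ℕ), dd M (C t ^ k : MvPolynomial ℕ R) = 0 := by
    intro M k; rw [← C_pow, dd_C]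
  have hX : ∀ M, opN u M (X M : MvPolynomial ℕ R) = C u * X (M + 1) + (C u - 1) * X M := by
    intro M
    rw [opN_apply, dd_X_left]; ring
  have hX' : ∀ M, opN u M (X (M + 1) : MvPolynomial ℕ R) = X M := by
    intro M
    rw [opN_apply, dd_X_right]; ring
  have hE : ∀ M r, dd M (es X M r : MvPolynomial ℕ R) = 0 := fun M r => dd_es_of_lt le_rfl r
  induction M generalizing r with
  | zero => cases r <;> simp
  | succ M ih =>
    rw [desc_succ]
    have hXM : dd M (X (M + 1) * X M : MvPolynomial ℕ R) = 0 := by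
      rw [dd_mul]; simp
    cases r with
    | zero =>
      have h0 := ih 0
      simp only [es_zero_right, mul_one] at h0 ⊢
      rw [pow_succ', mul_assoc, ← hN _ _ _ (hcc M M), h0]
      rw [map_add, hX, hN _ _ _ (hc _ _), opN_of_dd_eq_zero (hE _ _), es_succ, es_zero_right]
      linear_combination (X (M + 1) + X M + (1 - C t) * es X M 1) * hut'
    | succ r =>
      have e : desc u M (X 0 * es (fun i => (X (i + 1) : MvPolynomial ℕ R)) (M + 1) (r + 1)) =
          desc u M (X 0 * es (fun i => X (i + 1)) M (r + 1)) +
          X (M + 1) * desc u M (X 0 * es (fun i => X (i + 1)) M r) := by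
        rw [es_succ, mul_add, map_add, mul_left_comm,
          desc_mul_of_ge (P := X (M + 1)) fun j hj => dd_X_of_ne (by omega) (by omega)]
      rw [pow_succ', mul_assoc, ← hN _ _ _ (hcc M M), e, mul_add, mul_left_comm, ih, ih,
        mul_add (X (M + 1)), ← mul_assoc (X (M + 1)), mul_left_comm (X (M + 1)),
        mul_comm (X M) (es X M (r + 1)), mul_comm (X (M + 1)) (es X M (r + 1)),
        mul_comm (X (M + 1) * X M) (es X M r)]
      simp only [map_add, hN _ _ _ (hE _ _), hN _ _ _ (hc _ _), hX, hX', opN_of_dd_eq_zero hXM,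
        opN_of_dd_eq_zero (hE _ _), es_succ]
      linear_combination (es X M (r + 1) * X (M + 1) + es X M (r + 1) * X M +
        (1 - C t ^ (r + 2)) * es X M (r + 2) + es X M r * X (M + 1) * X M) * hut'

/-- The symmetrization of `X_0 e_r(X_1, …, X_M)`. -/
theorem pSym_X_mul_es {u t : R} (hut : u * t = 1) (M r : ℕ) :
    C t ^ M * pSym u (M + 1) (X 0 * es (fun i => X (i + 1)) M r) =
      C (tNum t (r + 1)) * es X (M + 1) (r + 1) := by
  have hC : ∀ k, (C (tNum t (k + 1)) : MvPolynomial ℕ R) = C t * C (tNum t k) + 1 := by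
    intro k; rw [tNum_succ', C_add, C_mul, C_1]
  have hC' : ∀ k, (C (tNum t (k + 1)) : MvPolynomial ℕ R) = C (tNum t k) + C t ^ k := by
    intro k; rw [tNum_succ, C_add, C_pow]
  induction M generalizing r with
  | zero => cases r <;> simp [pSym_apply, es_succ, tNum]
  | succ M ih =>
    rw [pSym_succ, mul_add, desc_X_mul_es hut, pow_succ', mul_assoc]
    cases r with
    | zero =>
      have h0 := ih 0
      simp only [es_zero_right, mul_one] at h0 ⊢
      rw [h0, es_succ _ (M + 1)]
      have e : (C (tNum t (0 + 1)) : MvPolynomial ℕ R) = 1 := by simp [tNum]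
      rw [e, es_zero_right]
      ring
    | succ r =>
      rw [es_succ _ M, mul_add (X 0), map_add, mul_left_comm (X 0),
        pSym_mul (P := X (M + 1)) fun j hj => dd_X_of_ne (by omega) (by omega), mul_add (C t ^ M), mul_left_comm (C t ^ M), ih, ih,
        es_succ _ (M + 1)]
      -- This uses both recursions `[k+1] = t [k] + 1` and `[k+1] = [k] + t^k`.
      linear_combination es X (M + 1) (r + 1 + 1) * (hC' (r + 2) - hC (r + 2)) -
        X (M + 1) * es X (M + 1) (r + 1) * hC (r + 1)

/-- The value of `word` at `p = 0`, modulo the last variables. -/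
theorem cut_word_zero {u t : R} (hut : u * t = 1) {m : ℕ} (hm : 0 < m) {ds : List ℕ}
    (h : IsArea ds) :
    C t ^ (ds.length * (m - 1)) * cut R (m - ds.headD 0) (word u 0 m ds) =
      C (t ^ ds.sum * tFac t ds.length) * es X (m - ds.headD 0) ds.length := by
  induction ds with
  | nil => simp [word, tFac]
  | cons d ds ih =>
    rw [List.headD_cons, List.length_cons]
    rcases Nat.lt_or_ge d m with hd | hd
    swap
    · rw [word, Nat.sub_eq_zero_of_le hd]; simp
    obtain ⟨K, hK⟩ : ∃ K, m - d = K + 1 := ⟨m - d - 1, by omega⟩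
    have hA := h.1
    -- At `p = 0` the wrapped variable vanishes, so the rotation is only a shift of indices.
    have hrot : ∀ F : MvPolynomial ℕ R, cut R (K + 1) (rot 0 m F) =
        rename (fun i => i + 1) (cut R K F) := by
      intro F
      have : (cut R (K + 1)).comp (rot 0 m) = (rename fun i => i + 1).comp (cut R K) := by
        ext1 j
        simp only [AlgHom.comp_apply, rot_X, cut_X]
        by_cases hj : j < K
        · rw [if_pos hj, if_pos (by omega), cut_X, if_pos (by omega), rename_X]
        · rw [if_neg hj, map_zero]
          split_ifs
          · rw [cut_X, if_neg (by omega), map_zero]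
          · simp
          · rw [cut_X, if_neg (by omega), map_zero]
      exact DFunLike.congr_fun this F
    have hcut : ∀ F : MvPolynomial ℕ R, cut R K F = cut R K (cut R (m - ds.headD 0) F) := by
      intro F
      have : cut R K = (cut R K).comp (cut R (m - ds.headD 0)) := by
        ext1 j
        simp only [AlgHom.comp_apply, cut_X]
        by_cases hj : j < K
        · rw [if_pos (show j < m - ds.headD 0 by omega), cut_X]
        · rw [if_neg hj]
          split_ifs
          · rw [cut_X, if_neg hj]
          · simp
      exact DFunLike.congr_fun this F
    have hes : cut R K (es X (m - ds.headD 0) ds.length) = es X K ds.length := by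
      rw [map_es, es_of_eq_zero (show K ≤ m - ds.headD 0 by omega)
        fun i h1 _ => by rw [cut_X, if_neg (by omega)]]
      exact es_congr (fun i hi => by rw [cut_X, if_pos hi]) _
    have e0 := congrArg (fun F => rename (fun i => i + 1) (cut R K F)) (ih h.2)
    simp only [map_mul, map_pow, hes] at e0
    rw [← hcut, map_es] at e0
    simp only [algHom_C, rename_X, algebraMap_eq] at e0
    have hps : ∀ F, cut R (K + 1) (pSym u (K + 1) F) = pSym u (K + 1) (cut R (K + 1) F) :=
      map_pSym (cut R (K + 1)).toRingHom fun i hi F => cut_opN u hi F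
    rw [hK, word, hK, hps, opR_apply, map_mul, cut_X, if_pos (by omega), hrot]
    -- Of the factor `t^{m-1}` belonging to this letter, `t^K` normalizes the symmetrization in `K +
    -- 1` variables, and `t^d` remains and accumulates to `t^{ds.sum}`.
    have e1 : (C t ^ ((ds.length + 1) * (m - 1)) : MvPolynomial ℕ R) =
        C t ^ d * C t ^ K * C t ^ (ds.length * (m - 1)) := by
      rw [← pow_add, ← pow_add]; congr 1; rw [show m - 1 = d + K by omega]; ring
    have e2 : ∀ (F : MvPolynomial ℕ R) (k : ℕ), C t ^ k * pSym u (K + 1) F =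
        pSym u (K + 1) (C t ^ k * F) := by
      intro F k
      rw [pSym_mul fun j _ => by rw [← C_pow, dd_C]]
    rw [e1, mul_assoc, e2, mul_left_comm, e0, mul_left_comm (X 0), pSym_mul fun j _ => by
      simp only [← C_pow, ← C_mul, dd_C], mul_left_comm (C t ^ d * C t ^ K), mul_assoc (C t ^ d),
      pSym_X_mul_es hut, List.sum_cons, tFac_succ]
    simp only [C_mul, C_pow, pow_add]
    ring

end Poly

/-! ## Polynomials as rational functions -/

section Hecke

open MvPolynomial

/-- The restriction to `X_0, …, X_{m-1}`, where the other variables are set to zero. -/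
def toFin (R : Type*) [CommRing R] (m : ℕ) : MvPolynomial ℕ R →ₐ[R] MvPolynomial (Fin m) R :=
  aeval fun j => if h : j < m then X ⟨j, h⟩ else 0

theorem toFin_X {R : Type*} [CommRing R] {m j : ℕ} (h : j < m) :
    toFin R m (X j) = X ⟨j, h⟩ := by simp [toFin, h]

theorem toFin_X_of_le {R : Type*} [CommRing R] {m j : ℕ} (h : m ≤ j) :
    toFin R m (X j) = 0 := by simp [toFin, not_lt.2 h]

variable {K : Type*} [Field K]

/-- Polynomials as rational functions in `X_0, …, X_{m-1}`. -/
def toRat (K : Type*) [Field K] (m : ℕ) : MvPolynomial ℕ K →ₐ[K] RatFun K m :=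
  (IsScalarTower.toAlgHom K (MvPolynomial (Fin m) K) (RatFun K m)).comp (toFin K m)

theorem toRat_apply (m : ℕ) (F : MvPolynomial ℕ K) :
    toRat K m F = algebraMap (MvPolynomial (Fin m) K) (RatFun K m) (toFin K m F) := rfl

variable (q : Kˣ) (t : K) (m : ℕ) [NeZero m]

theorem subst_algebraMap (c : Fin m → Kˣ) (σ : Equiv.Perm (Fin m)) (P : MvPolynomial (Fin m) K) :
    subst c σ (algebraMap _ _ P) = algebraMap _ _ (substPoly c σ P) :=
  IsFractionRing.algEquivOfAlgEquiv_algebraMap _ _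

theorem subst_X (c : Fin m → Kˣ) (σ : Equiv.Perm (Fin m)) (j : Fin m) :
    subst c σ (algebraMap (MvPolynomial (Fin m) K) _ (X j)) =
      algebraMap K _ (c j) * algebraMap (MvPolynomial (Fin m) K) _ (X (σ j)) := by
  rw [subst_algebraMap]
  simp [substPoly, IsScalarTower.algebraMap_apply K (MvPolynomial (Fin m) K) (RatFun K m)]

theorem ratFun_algHom_ext {φ ψ : RatFun K m →ₐ[K] RatFun K m}
    (h : ∀ j, φ (algebraMap (MvPolynomial (Fin m) K) _ (X j)) =
      ψ (algebraMap (MvPolynomial (Fin m) K) _ (X j))) : φ = ψ := by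
  have h1 : φ.comp (IsScalarTower.toAlgHom K (MvPolynomial (Fin m) K) (RatFun K m)) =
      ψ.comp (IsScalarTower.toAlgHom K (MvPolynomial (Fin m) K) (RatFun K m)) := by
    ext1 j; exact h j
  have h2 : φ.toRingHom = ψ.toRingHom := by
    apply IsLocalization.ringHom_ext (nonZeroDivisors (MvPolynomial (Fin m) K))
    exact RingHom.ext fun P => DFunLike.congr_fun h1 P
  exact AlgHom.ext fun x => DFunLike.congr_fun h2 x

/-! ### The variables `X_j`, `j ∈ ℤ` -/

theorem extVar_eq (k : ℤ) {r : ℕ} (hr : r < m) :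
    extVar q m (m * k + r + 1) = algebraMap K (RatFun K m) ((q ^ (-k) : Kˣ) : K) *
      algebraMap (MvPolynomial (Fin m) K) (RatFun K m) (X ⟨r, hr⟩) := by
  have hm : (0 : ℤ) < m := by exact_mod_cast NeZero.pos m
  have h1 : ((m : ℤ) * k + r + 1 - 1) / m = k := by
    rw [add_sub_cancel_right, Int.mul_add_ediv_left _ _ hm.ne',
      Int.ediv_eq_zero_of_lt (by omega) (by omega), add_zero]
  have h2 : ((m : ℤ) * k + r + 1 - 1) % m = r := by
    rw [add_sub_cancel_right, Int.mul_add_emod_self_left,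
      Int.emod_eq_of_lt (by omega) (by omega)]
  rw [extVar, h1, h2]
  congr 3
  ext
  simp [Nat.mod_eq_of_lt hr]

theorem exists_index (j : ℤ) : ∃ (k : ℤ) (r : ℕ), r < m ∧ j = m * k + r + 1 := by
  have hm : (0 : ℤ) < m := by exact_mod_cast NeZero.pos m
  refine ⟨(j - 1) / m, ((j - 1) % m).toNat, ?_, ?_⟩
  · have := Int.emod_lt_of_pos (j - 1) hm
    have := Int.emod_nonneg (j - 1) hm.ne'
    omega
  · have := Int.emod_nonneg (j - 1) hm.ne'
    have := Int.mul_ediv_add_emod (j - 1) m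
    omega

theorem extVar_ne_zero (j : ℤ) : extVar q m j ≠ 0 := by
  obtain ⟨k, r, hr, rfl⟩ := exists_index m j
  rw [extVar_eq q m k hr]
  refine mul_ne_zero ?_ ?_
  · rw [Ne, FaithfulSMul.algebraMap_eq_zero_iff]
    exact Units.ne_zero _
  · rw [Ne, FaithfulSMul.algebraMap_eq_zero_iff]
    exact X_ne_zero _

theorem extVar_succ {i : ℕ} (h : i < m) : extVar q m ((i + 1 : ℕ) : ℤ) = toRat K m (X i) := by
  have := extVar_eq q m 0 h
  rw [mul_zero, zero_add] at this
  rw [Nat.cast_add, Nat.cast_one, this, toRat_apply, toFin_X h]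
  simp

theorem ratFun_algHom_ext' {φ ψ : RatFun K m →ₐ[K] RatFun K m}
    (h : ∀ j, φ (extVar q m j) = ψ (extVar q m j)) : φ = ψ := by
  refine ratFun_algHom_ext m fun j => ?_
  have h1 := h (m * 0 + (j : ℕ) + 1)
  rw [extVar_eq q m 0 j.2] at h1
  simpa using h1

/-- The substitution in `Π`. -/
def substPi : RatFun K m ≃ₐ[K] RatFun K m :=
  subst (fun j : Fin m => if j = Fin.ofNat m (m - 1) then q⁻¹ else 1) (finRotate m)

theorem opPi_eq : opPi q m = LinearMap.mulLeft K (extVar q m 1) * (substPi q m).toLinearMap := rfl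

theorem finRotate_eq (j : Fin m) :
    finRotate m j = if h : (j : ℕ) + 1 < m then ⟨j + 1, h⟩ else ⟨0, NeZero.pos m⟩ := by
  obtain ⟨n, rfl⟩ : ∃ n, m = n + 1 := ⟨m - 1, by have := NeZero.pos m; omega⟩
  split_ifs with h
  · exact finRotate_of_lt (by omega)
  · have : j = Fin.last n := Fin.ext (by have := j.2; simp; omega)
    rw [this, finRotate_last]; rfl

theorem substPi_extVar (j : ℤ) : substPi q m (extVar q m j) = extVar q m (j + 1) := by
  obtain ⟨k, r, hr, rfl⟩ := exists_index m j
  rw [extVar_eq q m k hr, map_mul, AlgEquiv.commutes, substPi, subst_X, finRotate_eq]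
  by_cases h : r + 1 < m
  · rw [dif_pos (by simpa using h), if_neg]
    · have := extVar_eq q m k h
      push_cast at this
      rw [show (m : ℤ) * k + r + 1 + 1 = m * k + (r + 1) + 1 by ring, this]
      simp
    · intro h'
      have := congrArg Fin.val h'
      simp only [Fin.ofNat, Nat.mod_eq_of_lt (show m - 1 < m by omega)] at this
      omega
  · rw [dif_neg (by simpa using h), if_pos]
    · have hr' : r = m - 1 := by omega
      have := extVar_eq q m (k + 1) (NeZero.pos m)
      rw [show (m : ℤ) * k + r + 1 + 1 = m * (k + 1) + (0 : ℕ) + 1 by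
        have : (r : ℤ) = m - 1 := by omega
        rw [this]; push_cast; ring, this, ← mul_assoc, ← map_mul, ← Units.val_mul]
      congr 4
      group
    · ext
      simp only [Fin.ofNat, Nat.mod_eq_of_lt (show m - 1 < m by omega)]
      omega

/-- The substitution in `s_i`. -/
def substS (i : ℕ) : RatFun K m ≃ₐ[K] RatFun K m :=
  if i % m = 0 then
    subst (fun j : Fin m => if j = Fin.ofNat m 0 then q
        else if j = Fin.ofNat m (m - 1) then q⁻¹ else 1)
      (Equiv.swap (Fin.ofNat m 0) (Fin.ofNat m (m - 1)))
  else subst (fun _ => (1 : Kˣ)) (Equiv.swap (Fin.ofNat m (i % m - 1)) (Fin.ofNat m (i % m)))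

theorem opS_eq (i : ℕ) : opS q m i =
    LinearMap.mulLeft K (if i % m = 0 then extVar q m 1 / extVar q m 0 else 1) *
      (substS q m i).toLinearMap := by
  rw [opS, substS]
  split_ifs
  · rfl
  · ext; simp

theorem ofNat_eq {r : ℕ} (h : r < m) : Fin.ofNat m r = ⟨r, h⟩ := by
  ext; simp [Fin.ofNat, Nat.mod_eq_of_lt h]

/-- Indexing the variables by all integers makes the affine reflection uniform in `i`: the powers of
`q` in the definition of `X_{i+km}` are those created by wrapping around. -/
theorem substS_extVar (hm : 2 ≤ m) (i : ℕ) (j : ℤ) : substS q m i (extVar q m j) =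
    extVar q m (if (m : ℤ) ∣ j - i then j + 1 else if (m : ℤ) ∣ j - i - 1 then j - 1 else j) := by
  obtain ⟨k, r, hr, rfl⟩ := exists_index m j
  obtain ⟨a, ha, l, hi⟩ : ∃ a, a < m ∧ ∃ l : ℕ, i = m * l + a :=
    ⟨i % m, Nat.mod_lt _ (by omega), i / m, (Nat.div_add_mod i m).symm⟩
  have hia : i % m = a := by rw [hi, Nat.mul_add_mod, Nat.mod_eq_of_lt ha]
  have hd : ∀ (x : ℤ), -(m : ℤ) < x → x < m → ((m : ℤ) ∣ x ↔ x = 0) := by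
    intro x h1 h2
    constructor
    · intro h
      exact Int.eq_zero_of_abs_lt_dvd h (abs_lt.2 ⟨h1, h2⟩)
    · rintro rfl; exact dvd_zero _
  have e1 : (m : ℤ) ∣ (m : ℤ) * k + r + 1 - i ↔ (m : ℤ) ∣ r + 1 - a := by
    rw [hi, show (m : ℤ) * k + r + 1 - ((m * l + a : ℕ) : ℤ) = (r + 1 - a) + m * (k - l) by
      push_cast; ring]
    exact (Int.dvd_add_left (dvd_mul_right _ _))
  have e2 : (m : ℤ) ∣ (m : ℤ) * k + r + 1 - i - 1 ↔ (m : ℤ) ∣ r - a := by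
    rw [hi, show (m : ℤ) * k + r + 1 - ((m * l + a : ℕ) : ℤ) - 1 = (r - a) + m * (k - l) by
      push_cast; ring]
    exact (Int.dvd_add_left (dvd_mul_right _ _))
  rw [if_congr e1 rfl (if_congr (e2.trans (hd (r - a) (by omega) (by omega))) rfl rfl),
    extVar_eq q m k hr, map_mul, AlgEquiv.commutes, substS, hia]
  by_cases ha0 : a = 0
  · subst ha0
    rw [if_pos rfl, subst_X, ofNat_eq m (show 0 < m by omega),
      ofNat_eq m (show m - 1 < m by omega)]
    by_cases hr0 : r = 0
    · subst hr0
      rw [Equiv.swap_apply_left, if_pos rfl, if_neg, if_pos (by simp)]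
      · have := extVar_eq q m (k - 1) (show m - 1 < m by omega)
        rw [show (m : ℤ) * k + (0 : ℕ) + 1 - 1 = m * (k - 1) + (m - 1 : ℕ) + 1 by
          rw [Nat.cast_sub (by omega)]; push_cast; ring, this, ← mul_assoc, ← map_mul,
          ← Units.val_mul]
        congr 4
        group
      · rw [hd _ (by omega) (by omega)]; omega
    by_cases hr1 : r = m - 1
    · subst hr1
      rw [Equiv.swap_apply_right, if_neg (by simp; omega), if_pos rfl, if_pos]
      · have := extVar_eq q m (k + 1) (show 0 < m by omega)
        rw [show (m : ℤ) * k + (m - 1 : ℕ) + 1 + 1 = m * (k + 1) + (0 : ℕ) + 1 by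
          rw [Nat.cast_sub (by omega)]; push_cast; ring, this, ← mul_assoc, ← map_mul,
          ← Units.val_mul]
        congr 4
        group
      · rw [Nat.cast_sub (by omega)]; simp
    · rw [Equiv.swap_apply_of_ne_of_ne (by simpa using hr0) (by simpa using hr1),
        if_neg (by simpa using hr0), if_neg (by simpa using hr1), if_neg, if_neg (by simpa using hr0),
        extVar_eq q m k hr]
      · simp
      · rw [hd _ (by omega) (by omega)]; omega
  · rw [if_neg ha0, subst_X, ofNat_eq m (show a - 1 < m by omega), ofNat_eq m ha,
      if_congr (hd (r + 1 - a) (by omega) (by omega)) rfl rfl]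
    by_cases hr0 : r = a - 1
    · subst hr0
      rw [Equiv.swap_apply_left, if_pos (by omega)]
      have := extVar_eq q m k ha
      rw [show (m : ℤ) * k + (a - 1 : ℕ) + 1 + 1 = m * k + a + 1 by omega, this]
      simp
    by_cases hr1 : r = a
    · subst hr1
      rw [Equiv.swap_apply_right, if_neg (by omega), if_pos (by omega)]
      have := extVar_eq q m k (show r - 1 < m by omega)
      rw [show (m : ℤ) * k + r + 1 - 1 = m * k + (r - 1 : ℕ) + 1 by omega, this]
      simp
    · rw [Equiv.swap_apply_of_ne_of_ne (by simpa using hr0) (by simpa using hr1),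
        if_neg (by omega), if_neg (by omega), extVar_eq q m k hr]
      simp

end Hecke

/-! ## The operators on rational functions -/

section Hecke

open MvPolynomial

variable {K : Type*} [Field K] (q : Kˣ) (t : K) (m : ℕ) [NeZero m]

theorem opPi_mulLeft (f : RatFun K m) :
    opPi q m * LinearMap.mulLeft K f = LinearMap.mulLeft K (substPi q m f) * opPi q m := by
  ext x; simp [opPi_eq]; ring

theorem opPi_opS (hm : 2 ≤ m) (i : ℕ) : opPi q m * opS q m i = opS q m (i + 1) * opPi q m := by
  have hcomp : ∀ x, substPi q m (substS q m i x) = substS q m (i + 1) (substPi q m x) := by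
    have : (substPi q m).toAlgHom.comp (substS q m i).toAlgHom =
        (substS q m (i + 1)).toAlgHom.comp (substPi q m).toAlgHom := by
      refine ratFun_algHom_ext' q m fun j => ?_
      change substPi q m (substS q m i _) = substS q m (i + 1) (substPi q m _)
      simp only [substPi_extVar, substS_extVar q m hm]
      rw [show j + 1 - ((i + 1 : ℕ) : ℤ) = j - i by push_cast; ring]
      split_ifs
      · rfl
      · congr 1; ring
      · rfl
    exact DFunLike.congr_fun this
  -- The multipliers must match too. They differ from those of a plain substitution only if `i` or
  -- `i + 1` is divisible by `m`, where the factor `X_1 / X_0` of `s_0` compensates for the factor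
  -- `X_1` of `Π`.
  have h1 : extVar q m 1 * substPi q m (if i % m = 0 then extVar q m 1 / extVar q m 0 else 1) =
      (if (i + 1) % m = 0 then extVar q m 1 / extVar q m 0 else 1) *
        substS q m (i + 1) (extVar q m 1) := by
    have hd : ∀ (x : ℤ), -(m : ℤ) < x → x < m → ((m : ℤ) ∣ x ↔ x = 0) := fun x h1 h2 =>
      ⟨fun h => Int.eq_zero_of_abs_lt_dvd h (abs_lt.2 ⟨h1, h2⟩), by rintro rfl; exact dvd_zero _⟩
    have e1 : (m : ℤ) ∣ 1 - ((i + 1 : ℕ) : ℤ) ↔ i % m = 0 := by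
      rw [show (1 : ℤ) - ((i + 1 : ℕ) : ℤ) = -(i : ℤ) by push_cast; ring, dvd_neg,
        Int.natCast_dvd_natCast, Nat.dvd_iff_mod_eq_zero]
    have e2 : (m : ℤ) ∣ 1 - ((i + 1 : ℕ) : ℤ) - 1 ↔ (i + 1) % m = 0 := by
      rw [show (1 : ℤ) - ((i + 1 : ℕ) : ℤ) - 1 = -((i + 1 : ℕ) : ℤ) by push_cast; ring, dvd_neg,
        Int.natCast_dvd_natCast, Nat.dvd_iff_mod_eq_zero]
    have h10 := extVar_ne_zero q m 1
    have h00 := extVar_ne_zero q m 0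
    rw [substS_extVar q m hm, if_congr e1 rfl (if_congr e2 rfl rfl)]
    by_cases hi : i % m = 0
    · have hi1 : ¬ (i + 1) % m = 0 := by
        rw [Nat.add_mod, hi, Nat.mod_eq_of_lt (show 1 < m by omega), zero_add,
          Nat.mod_eq_of_lt (show 1 < m by omega)]
        exact one_ne_zero
      rw [if_pos hi, if_pos hi, if_neg hi1, map_div₀, substPi_extVar, substPi_extVar, zero_add]
      field_simp
    · rw [if_neg hi, if_neg hi]
      by_cases hi1 : (i + 1) % m = 0
      · rw [if_pos hi1, if_pos hi1]
        simp [h00]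
      · rw [if_neg hi1, if_neg hi1]; simp
  rw [opS_eq, opS_eq, ← mul_assoc, opPi_mulLeft, opPi_eq]
  ext x
  simp only [Module.End.mul_apply, LinearMap.mulLeft_apply, AlgEquiv.toLinearMap_apply, map_mul,
    hcomp]
  linear_combination (substS q m (i + 1) (substPi q m x)) * h1

theorem opPi_opT (hm : 2 ≤ m) (i : ℕ) :
    opPi q m * opT q t m i = opT q t m (i + 1) * opPi q m := by
  have h : substPi q m (1 - extVar q m i * (extVar q m (i + 1))⁻¹)⁻¹ =
      (1 - extVar q m (i + 1 : ℕ) * (extVar q m ((i + 1 : ℕ) + 1))⁻¹)⁻¹ := by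
    rw [map_inv₀, map_sub, map_mul, map_inv₀, map_one, substPi_extVar, substPi_extVar]
    push_cast; rfl
  rw [opT, opT, mul_add, mul_smul_comm, opPi_opS q m hm, mul_smul_comm, ← mul_assoc, opPi_mulLeft,
    h, mul_assoc, mul_sub, mul_one, opPi_opS q m hm, add_mul, smul_mul_assoc, smul_mul_assoc,
    mul_assoc, sub_mul, one_mul]

theorem isUnit_opPi : IsUnit (opPi q m) := by
  rw [opPi_eq]
  have h := extVar_ne_zero q m 1
  refine IsUnit.mul ?_ ?_
  · refine ⟨⟨LinearMap.mulLeft K (extVar q m 1), LinearMap.mulLeft K (extVar q m 1)⁻¹, ?_, ?_⟩,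
      rfl⟩ <;> ext x <;> simp [h]
  · refine ⟨⟨(substPi q m).toLinearMap, (substPi q m).symm.toLinearMap, ?_, ?_⟩, rfl⟩ <;>
      ext x <;> simp

theorem isUnit_opT_one (hm : 2 ≤ m) (ht : t ≠ 0) : IsUnit (opT q t m 1) := by
  have hS : opS q m 1 = (substS q m 1).toLinearMap := by
    rw [opS_eq, if_neg (by rw [Nat.mod_eq_of_lt (by omega)]; exact one_ne_zero)]
    ext; simp
  set c := (1 - extVar q m (1 : ℕ) * (extVar q m ((1 : ℕ) + 1))⁻¹)⁻¹ with hc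
  have hss : ∀ x, substS q m 1 (substS q m 1 x) = x := by
    have hd : ∀ (x : ℤ), -(m : ℤ) < x → x < m → ((m : ℤ) ∣ x ↔ x = 0) := fun x h1 h2 =>
      ⟨fun h => Int.eq_zero_of_abs_lt_dvd h (abs_lt.2 ⟨h1, h2⟩), by rintro rfl; exact dvd_zero _⟩
    have : (substS q m 1).toAlgHom.comp (substS q m 1).toAlgHom = AlgHom.id K _ := by
      refine ratFun_algHom_ext' q m fun j => ?_
      change substS q m 1 (substS q m 1 _) = _
      simp only [substS_extVar q m hm, AlgHom.id_apply]
      by_cases h1 : (m : ℤ) ∣ j - (1 : ℕ)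
      · have h2 : ¬ (m : ℤ) ∣ j + 1 - (1 : ℕ) := by
          intro h
          have := dvd_sub h h1
          rw [hd _ (by push_cast; omega) (by push_cast; omega)] at this
          omega
        rw [if_pos h1, if_neg h2, if_pos (by convert h1 using 1; ring), add_sub_cancel_right]
      · rw [if_neg h1]
        by_cases h2 : (m : ℤ) ∣ j - (1 : ℕ) - 1
        · rw [if_pos h2, if_pos (by convert h2 using 1; ring), sub_add_cancel]
        · rw [if_neg h2, if_neg h1, if_neg h2]
    exact DFunLike.congr_fun this
  have hx : extVar q m (1 : ℕ) ≠ 0 := extVar_ne_zero _ _ _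
  have hy : extVar q m ((1 : ℕ) + 1) ≠ 0 := extVar_ne_zero _ _ _
  have hsx : substS q m 1 (extVar q m (1 : ℕ)) = extVar q m ((1 : ℕ) + 1) := by
    rw [substS_extVar q m hm, if_pos (by simp)]
  have hsy : substS q m 1 (extVar q m ((1 : ℕ) + 1)) = extVar q m (1 : ℕ) := by
    rw [← hsx, hss]
  have hxy : extVar q m ((1 : ℕ) + 1) - extVar q m (1 : ℕ) ≠ 0 := by
    rw [sub_ne_zero]
    have h1 := extVar_succ q m (show 0 < m by omega)
    have h2 := extVar_succ q m (show 1 < m by omega)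
    rw [show ((1 : ℕ) : ℤ) + 1 = ((1 + 1 : ℕ) : ℤ) by norm_num, h2]
    rw [zero_add] at h1
    rw [h1, toRat_apply, toRat_apply, toFin_X (show 0 < m by omega), toFin_X (show 1 < m by omega)]
    intro h
    have := X_injective (IsFractionRing.injective (MvPolynomial (Fin m) K) (RatFun K m) h)
    simp at this
  have hyx : extVar q m (1 : ℕ) - extVar q m ((1 : ℕ) + 1) ≠ 0 := by
    rw [← neg_sub]; exact neg_ne_zero.2 hxy
  -- Here `c = X_2 / (X_2 - X_1)`, and `s(c) = 1 - c` is what makes the quadratic relation, and with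
  -- it the explicit inverse, hold.
  have hcs : substS q m 1 c = 1 - c := by
    rw [hc, map_inv₀, map_sub, map_mul, map_inv₀, map_one, hsx, hsy]
    have h1 : (1 - extVar q m (1 : ℕ) * (extVar q m ((1 : ℕ) + 1))⁻¹) =
      (extVar q m ((1 : ℕ) + 1) - extVar q m (1 : ℕ)) / extVar q m ((1 : ℕ) + 1) := by field_simp
    have h2 : (1 - extVar q m ((1 : ℕ) + 1) * (extVar q m (1 : ℕ))⁻¹) =
      -(extVar q m ((1 : ℕ) + 1) - extVar q m (1 : ℕ)) / extVar q m (1 : ℕ) := by field_simp; ring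
    rw [h1, h2]
    field_simp
    ring
  have hT : ∀ F, opT q t m 1 F = algebraMap K _ t * substS q m 1 F +
      (algebraMap K _ t - 1) * (c * (F - substS q m 1 F)) := by
    intro F
    rw [opT, hS, ← hc]
    simp [Algebra.smul_def]
    ring
  have hquad : opT q t m 1 * opT q t m 1 = (t - 1) • opT q t m 1 + t • 1 := by
    refine LinearMap.ext fun F => ?_
    simp only [Module.End.mul_apply, LinearMap.add_apply, LinearMap.smul_apply, hT, map_add,
      map_mul, map_sub, hss, hcs, AlgEquiv.commutes, map_one, Module.End.one_apply]
    rw [Algebra.smul_def, Algebra.smul_def, map_sub, map_one]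
    ring
  refine ⟨⟨opT q t m 1, t⁻¹ • (opT q t m 1 - (t - 1) • 1), ?_, ?_⟩, rfl⟩
  · rw [mul_smul_comm, mul_sub, hquad, mul_smul_comm, mul_one, add_sub_cancel_left, smul_smul,
      inv_mul_cancel₀ ht, one_smul]
  · rw [smul_mul_assoc, sub_mul, hquad, smul_mul_assoc, one_mul, add_sub_cancel_left, smul_smul,
      inv_mul_cancel₀ ht, one_smul]

/-- `T_{i+1} = Π T_i Π⁻¹`, so invertibility spreads from `T_1` to all indices, including those
divisible by `m`, where `q` enters. -/
theorem isUnit_opT (hm : 2 ≤ m) (ht : t ≠ 0) (i : ℕ) : IsUnit (opT q t m (i + 1)) := by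
  induction i with
  | zero => exact isUnit_opT_one q t m hm ht
  | succ i ih =>
    have h := (isUnit_opPi q m).mul ih
    rw [opPi_opT q t m hm] at h
    obtain ⟨P, hP⟩ := isUnit_opPi q m
    rw [← hP] at h
    exact (Units.isUnit_mul_units _ P).1 h

theorem opTinv_mul_opT (hm : 2 ≤ m) (ht : t ≠ 0) (i : ℕ) :
    opTinv q t m (i + 1) * opT q t m (i + 1) = 1 :=
  Ring.inverse_mul_cancel _ (isUnit_opT q t m hm ht i)

theorem opT_mul_opTinv (hm : 2 ≤ m) (ht : t ≠ 0) (i : ℕ) :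
    opT q t m (i + 1) * opTinv q t m (i + 1) = 1 :=
  Ring.mul_inverse_cancel _ (isUnit_opT q t m hm ht i)

theorem opPi_opTinv (hm : 2 ≤ m) (ht : t ≠ 0) (i : ℕ) :
    opPi q m * opTinv q t m (i + 1) = opTinv q t m (i + 2) * opPi q m := by
  calc opPi q m * opTinv q t m (i + 1)
      = opTinv q t m (i + 2) * (opT q t m (i + 1 + 1) * opPi q m) * opTinv q t m (i + 1) := by
        rw [← mul_assoc, opTinv_mul_opT q t m hm ht, one_mul]
    _ = opTinv q t m (i + 2) * opPi q m := by
        rw [← opPi_opT q t m hm, mul_assoc, mul_assoc, opT_mul_opTinv q t m hm ht, mul_one]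

theorem opPi_descTinv (hm : 2 ≤ m) (ht : t ≠ 0) (i k : ℕ) :
    opPi q m * descTinv q t m (i + 1) k = descTinv q t m (i + 2) k * opPi q m := by
  induction k with
  | zero => simp [descTinv]
  | succ k ih =>
    rw [descTinv, descTinv, ← mul_assoc, show i + 1 + k = (i + k) + 1 by ring,
      opPi_opTinv q t m hm ht, mul_assoc, ih, ← mul_assoc, show i + 2 + k = i + k + 2 by ring]

/-- The alternative `k = 0` serves `m = 1`, where only empty products occur. -/
theorem opPi_pow_descTinv (ht : t ≠ 0) (i k : ℕ) (h : 2 ≤ m ∨ k = 0) :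
    opPi q m ^ i * descTinv q t m 1 k = descTinv q t m (i + 1) k * opPi q m ^ i := by
  rcases h with hm | rfl
  · induction i with
    | zero => simp
    | succ i ih =>
      rw [pow_succ', mul_assoc, ih, ← mul_assoc, opPi_descTinv q t m hm ht, mul_assoc, ← pow_succ']
  · simp [descTinv]

/-- `S_{1,-d} Π`. -/
def opB (d : ℕ) : Module.End K (RatFun K m) :=
  (∑ k ∈ Finset.range (m - d), descTinv q t m 1 k) * opPi q m

/-- Pulling `Π^i` to the left lowers all indices to those of `S_{1,e-i}`. Truncated subtraction in
`m - (i - e)` reproduces the convention that `S` vanishes when `e` is too small. -/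
theorem partialSymm_mul (ht : t ≠ 0) {i e : ℕ} (he : e ≤ i) :
    partialSymm q t m (i + 1) e * opPi q m ^ (i + 1) = opPi q m ^ i * opB q t m (i - e) := by
  have hm := NeZero.pos m
  have hr : partialSymm q t m (i + 1) e =
      ∑ k ∈ Finset.range (m - (i - e)), descTinv q t m (i + 1) k := by
    rw [partialSymm]
    split_ifs with h
    · congr 2; omega
    · rw [show m - (i - e) = 0 by omega]; simp
  rw [hr, opB, ← mul_assoc, Finset.mul_sum, pow_succ, ← mul_assoc, Finset.sum_mul]
  congr 1
  refine Finset.sum_congr rfl fun k hk => (opPi_pow_descTinv q t m ht i k ?_).symm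
  rw [Finset.mem_range] at hk
  omega

/-- The last symmetrizer uses one of the factors `Π` and passes the other ones to its left
neighbour. -/
theorem ofFn_partialSymm_prod (ht : t ≠ 0) {n : ℕ} (e : Fin n → ℕ) (he : ∀ v, e v ≤ v) :
    (List.ofFn fun v : Fin n => partialSymm q t m (v + 1) (e v)).prod * opPi q m ^ n =
      (List.ofFn fun v : Fin n => opB q t m (v - e v)).prod := by
  induction n with
  | zero => simp
  | succ n ih =>
    rw [List.ofFn_succ', List.ofFn_succ', List.prod_concat, List.prod_concat, mul_assoc]
    simp only [Fin.val_last, Fin.val_castSucc]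
    rw [partialSymm_mul q t m ht (by simpa using he (Fin.last n)), ← mul_assoc,
      ih (fun v => e v.castSucc) fun v => by simpa using he v.castSucc]

/-! ### Comparison with the operators on polynomials -/

theorem opS_toRat {i : ℕ} (h : i + 1 < m) (F : MvPolynomial ℕ K) :
    opS q m (i + 1) (toRat K m F) = toRat K m (sw K i F) := by
  have hS : opS q m (i + 1) = (substS q m (i + 1)).toLinearMap := by
    rw [opS_eq, if_neg (by rw [Nat.mod_eq_of_lt h]; omega)]
    ext; simp
  have hd : ∀ (x : ℤ), -(m : ℤ) < x → x < m → ((m : ℤ) ∣ x ↔ x = 0) := fun x h1 h2 =>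
    ⟨fun h => Int.eq_zero_of_abs_lt_dvd h (abs_lt.2 ⟨h1, h2⟩), by rintro rfl; exact dvd_zero _⟩
  have : (substS q m (i + 1)).toAlgHom.comp (toRat K m) =
      (toRat K m).comp (sw K i) := by
    ext1 j
    change substS q m (i + 1) (toRat K m (X j)) = toRat K m (sw K i (X j))
    by_cases hj : j < m
    · rw [← extVar_succ q m hj, substS_extVar q m (by omega),
        show ((j + 1 : ℕ) : ℤ) - (i + 1 : ℕ) = (j : ℤ) - i by push_cast; ring,
        if_congr (hd ((j : ℤ) - i) (by omega) (by omega)) rfl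
          (if_congr (hd ((j : ℤ) - i - 1) (by omega) (by omega)) rfl rfl)]
      by_cases h1 : j = i
      · subst h1
        rw [if_pos (by omega), sw_X_left, ← extVar_succ q m h]; rfl
      by_cases h2 : j = i + 1
      · subst h2
        rw [if_neg (by omega), if_pos (by omega), sw_X_right,
          ← extVar_succ q m (show i < m by omega)]
        congr 1; push_cast; ring
      · rw [if_neg (by omega), if_neg (by omega), sw_X_of_ne h1 h2, extVar_succ q m hj]
    · rw [sw_X_of_ne (by omega) (by omega), toRat_apply, toFin_X_of_le (not_lt.1 hj)]; simp
  rw [hS]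
  exact DFunLike.congr_fun this F

/-- The operator `T_i` on polynomials. -/
def opTp {R : Type*} [CommRing R] [IsDomain R] (u t : R) (i : ℕ) :
    Module.End R (MvPolynomial ℕ R) := t • opN u i + (t - 1) • 1

theorem opTp_apply {R : Type*} [CommRing R] [IsDomain R] (u t : R) (i : ℕ)
    (F : MvPolynomial ℕ R) : opTp u t i F = C t * opN u i F + (C t - 1) * F := by
  simp [opTp, smul_eq_C_mul]

theorem opTp_opN {R : Type*} [CommRing R] [IsDomain R] {u t : R} (hut : u * t = 1) (i : ℕ)
    (F : MvPolynomial ℕ R) : opTp u t i (opN u i F) = F := by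
  have hut' : (C u * C t : MvPolynomial ℕ R) = 1 := by rw [← C_mul, hut, C_1]
  rw [opTp_apply, opN_opN]
  linear_combination (opN u i F + F) * hut'

theorem opN_opTp {R : Type*} [CommRing R] [IsDomain R] {u t : R} (hut : u * t = 1) (i : ℕ)
    (F : MvPolynomial ℕ R) : opN u i (opTp u t i F) = F := by
  have hut' : (C u * C t : MvPolynomial ℕ R) = 1 := by rw [← C_mul, hut, C_1]
  have hc : (C t - 1 : MvPolynomial ℕ R) = C (t - 1) := by rw [C_sub, C_1]
  rw [opTp_apply, map_add, opN_C_mul, opN_opN, hc, opN_C_mul, ← hc]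
  linear_combination (opN u i F + F) * hut'

variable {t}

theorem opT_toRat {u : K} (hut : u * t = 1) {i : ℕ} (h : i + 1 < m) (F : MvPolynomial ℕ K) :
    opT q t m (i + 1) (toRat K m F) = toRat K m (opTp u t i F) := by
  have hx := extVar_succ q m (show i < m by omega)
  have hy := extVar_succ q m h
  have hy0 : toRat K m (X (i + 1)) ≠ 0 := by rw [← hy]; exact extVar_ne_zero _ _ _
  have hyx : toRat K m (X (i + 1)) - toRat K m (X i) ≠ 0 := by
    rw [sub_ne_zero, toRat_apply, toRat_apply, toFin_X h, toFin_X (show i < m by omega)]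
    intro h
    have := X_injective (IsFractionRing.injective (MvPolynomial (Fin m) K) (RatFun K m) h)
    simp at this
  rw [opT, show ((i + 1 : ℕ) : ℤ) + 1 = ((i + 1 + 1 : ℕ) : ℤ) by push_cast; ring, hx, hy]
  simp only [LinearMap.add_apply, LinearMap.smul_apply, Module.End.mul_apply, LinearMap.sub_apply,
    Module.End.one_apply, LinearMap.mulLeft_apply, opS_toRat q m h]
  have h1 : (1 - toRat K m (X i) * (toRat K m (X (i + 1)))⁻¹) =
    (toRat K m (X (i + 1)) - toRat K m (X i)) / toRat K m (X (i + 1)) := by field_simp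
  have hC : ∀ r : K, toRat K m (C r) = algebraMap K _ r := fun r => AlgHom.commutes _ _
  have hut' : algebraMap K (RatFun K m) u * algebraMap K (RatFun K m) t = 1 := by
    rw [← map_mul, hut, map_one]
  rw [h1, sw_eq, opTp_apply, opN_apply]
  simp only [map_add, map_mul, map_sub, map_one, hC, Algebra.smul_def]
  field_simp
  linear_combination -(toRat K m (X (i + 1)) - toRat K m (X i)) *
    (toRat K m F + toRat K m (X (i + 1)) * toRat K m (dd i F)) * hut'

theorem opTinv_toRat {u : K} (hut : u * t = 1) {i : ℕ} (h : i + 1 < m) (F : MvPolynomial ℕ K) :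
    opTinv q t m (i + 1) (toRat K m F) = toRat K m (opN u i F) := by
  have ht : t ≠ 0 := right_ne_zero_of_mul_eq_one hut
  have h1 := opT_toRat q m hut h (opN u i F)
  rw [opTp_opN hut] at h1
  rw [← h1]
  exact DFunLike.congr_fun (opTinv_mul_opT q t m (by omega) ht i) _

theorem opPi_toRat (F : MvPolynomial ℕ K) :
    opPi q m (toRat K m F) = toRat K m (opR ((q⁻¹ : Kˣ) : K) m F) := by
  have hm := NeZero.pos m
  have : (substPi q m).toAlgHom.comp (toRat K m) =
      (toRat K m).comp (rot ((q⁻¹ : Kˣ) : K) m) := by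
    ext1 j
    change substPi q m (toRat K m (X j)) = toRat K m (rot _ m (X j))
    rw [rot_X]
    by_cases hj : j < m
    · rw [← extVar_succ q m hj, substPi_extVar]
      split_ifs with h1 h2
      · rw [← extVar_succ q m h1]; rfl
      · rw [map_mul, show ((j + 1 : ℕ) : ℤ) + 1 = m * 1 + (0 : ℕ) + 1 by rw [h2]; push_cast; ring,
          extVar_eq q m 1 hm, toRat_apply m (X 0), toFin_X hm]
        congr 1
        rw [show toRat K m (C ((q⁻¹ : Kˣ) : K)) = algebraMap K _ ((q⁻¹ : Kˣ) : K) from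
          AlgHom.commutes _ _]
        simp
      · omega
    · rw [if_neg (by omega), if_neg (by omega), toRat_apply, toFin_X_of_le (not_lt.1 hj)]; simp
  rw [opPi_eq, opR_apply, map_mul, ← extVar_succ q m hm]
  exact congrArg _ (DFunLike.congr_fun this F)

theorem descTinv_toRat {u : K} (hut : u * t = 1) {k : ℕ} (h : k < m) (F : MvPolynomial ℕ K) :
    descTinv q t m 1 k (toRat K m F) = toRat K m (desc u k F) := by
  induction k with
  | zero => rfl
  | succ k ih =>
    rw [descTinv, Module.End.mul_apply, ih (by omega), add_comm 1 k, opTinv_toRat q m hut h]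
    rfl

theorem opB_toRat {u : K} (hut : u * t = 1) (d : ℕ) (F : MvPolynomial ℕ K) :
    opB q t m d (toRat K m F) = toRat K m (pSym u (m - d) (opR ((q⁻¹ : Kˣ) : K) m F)) := by
  rw [opB, Module.End.mul_apply, opPi_toRat, LinearMap.sum_apply, pSym_apply, map_sum]
  refine Finset.sum_congr rfl fun k hk => descTinv_toRat q m hut ?_ _
  rw [Finset.mem_range] at hk
  omega

theorem opB_prod_one {u : K} (hut : u * t = 1) (ds : List ℕ) :
    (ds.map (opB q t m)).prod 1 = toRat K m (word u ((q⁻¹ : Kˣ) : K) m ds) := by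
  induction ds with
  | nil => simp [word]
  | cons d ds ih =>
    rw [List.map_cons, List.prod_cons, Module.End.mul_apply, ih, opB_toRat q m hut]; rfl

/-- The list of the numbers of smaller neighbours `v - e(v)`. -/
def ESeq.area {n : ℕ} (e : ESeq n) : List ℕ := List.ofFn fun v : Fin n => (v : ℕ) - e.val v

theorem qtChromTrunc_eq {u : K} (hut : u * t = 1) {n : ℕ} (e : ESeq n) :
    qtChromTrunc q t m e =
      toRat K m (C t ^ (n * (m - 1)) * word u ((q⁻¹ : Kˣ) : K) m e.area) := by
  rw [qtChromTrunc, ofFn_partialSymm_prod q t m (right_ne_zero_of_mul_eq_one hut) e.val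
    fun v => Nat.lt_succ_iff.1 (e.val_lt v), LinearMap.smul_apply,
    show (List.ofFn fun v : Fin n => opB q t m (v - e.val v)) = e.area.map (opB q t m) by
      rw [ESeq.area, List.map_ofFn]; rfl, opB_prod_one q m hut, ← map_smul, smul_eq_C_mul, C_pow]

end Hecke

/-! ## Symmetric functions from words -/

open MvPolynomial

section

variable {R : Type*} [CommRing R]

theorem totalDegree_toFin_le [Nontrivial R] (m : ℕ) (F : MvPolynomial ℕ R) :
    (toFin R m F).totalDegree ≤ F.totalDegree := by
  refine totalDegree_aeval_le (fun i => ?_) F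
  split_ifs <;> simp

theorem map_toFin {R' : Type*} [CommRing R'] (f : R →+* R') (m : ℕ) (F : MvPolynomial ℕ R) :
    map f (toFin R m F) = toFin R' m (map f F) := by
  have : (map f).comp (toFin R m).toRingHom = (toFin R' m).toRingHom.comp (map f) := by
    refine ringHom_ext (fun r => ?_) fun j => ?_
    · simp
    · by_cases h : j < m
      · simp [toFin_X h]
      · simp [toFin_X_of_le (not_lt.1 h)]
  exact DFunLike.congr_fun this F

theorem toFin_cut (m : ℕ) (F : MvPolynomial ℕ R) : toFin R m (cut R m F) = toFin R m F := by
  have : (toFin R m).comp (cut R m) = toFin R m := by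
    ext1 j
    by_cases h : j < m
    · simp [cut_X, h]
    · simp [cut_X, h, toFin_X_of_le (not_lt.1 h)]
  exact DFunLike.congr_fun this F

theorem toFin_es (m r : ℕ) : toFin R m (es X m r) = esymm (Fin m) R r := by
  rw [map_es, ← aeval_esymm_fin (R := R) m r]
  have : (fun i : Fin m => toFin R m (X (i : ℕ))) = X := by
    ext1 i; rw [toFin_X i.2]
  rw [this, aeval_X_left_apply]

theorem trunc_toFin_succ (m : ℕ) (F : MvPolynomial ℕ R) :
    trunc R (m + 1) m (toFin R (m + 1) F) = toFin R m (kill R m F) := by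
  have : (trunc R (m + 1) m).comp (toFin R (m + 1)) = (toFin R m).comp (kill R m) := by
    ext1 j
    simp only [AlgHom.comp_apply, kill_X]
    rcases lt_trichotomy j m with h | h | h
    · rw [if_pos h, toFin_X (show j < m + 1 by omega), toFin_X h]; simp [trunc, h]
    · rw [if_neg (by omega), if_pos h, toFin_X (show j < m + 1 by omega)]; simp [trunc, h]
    · rw [if_neg (by omega), if_neg (by omega), toFin_X_of_le (show m + 1 ≤ j by omega),
        toFin_X_of_le (show m ≤ j - 1 by omega), map_zero]
  exact DFunLike.congr_fun this F

theorem trunc_trunc {m m' m'' : ℕ} (h : m'' ≤ m') (P : MvPolynomial (Fin m) R) :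
    trunc R m' m'' (trunc R m m' P) = trunc R m m'' P := by
  have : (trunc R m' m'').comp (trunc R m m') = trunc R m m'' := by
    ext1 j
    simp only [AlgHom.comp_apply, trunc, aeval_X]
    split_ifs with h1 h2 h2
    · simp [h2]
    · simp [h2]
    · omega
    · simp
  exact DFunLike.congr_fun this P

theorem trunc_self (m : ℕ) (P : MvPolynomial (Fin m) R) : trunc R m m P = P := by
  have : trunc R m m = AlgHom.id R _ := by
    ext1 j
    simp [trunc]
  exact DFunLike.congr_fun this P

theorem isSymmetric_of_swap {m : ℕ} {P : MvPolynomial (Fin m) R}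
    (h : ∀ (i : ℕ) (hi : i + 1 < m),
      rename (Equiv.swap (⟨i, by omega⟩ : Fin m) ⟨i + 1, hi⟩) P = P) : P.IsSymmetric := by
  intro e
  rcases m with _ | n
  · rw [Subsingleton.elim e (Equiv.refl _)]; simp
  have he : e ∈ Submonoid.closure
      (Set.range fun i : Fin n => Equiv.swap i.castSucc i.succ) := by
    rw [Equiv.Perm.mclosure_swap_castSucc_succ]; trivial
  induction he using Submonoid.closure_induction with
  | mem x hx =>
    obtain ⟨i, rfl⟩ := hx
    exact h i (by omega)
  | one => simp
  | mul x y _ _ hx hy =>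
    rw [Equiv.Perm.coe_mul, ← rename_rename, hy, hx]

variable [IsDomain R]

theorem isSymmetric_toFin {m : ℕ} {F : MvPolynomial ℕ R} (h : ∀ j, j + 1 < m → dd j F = 0) :
    (toFin R m F).IsSymmetric := by
  refine isSymmetric_of_swap fun i hi => ?_
  have : (rename (Equiv.swap (⟨i, by omega⟩ : Fin m) ⟨i + 1, hi⟩)).comp (toFin R m) =
      (toFin R m).comp (sw R i) := by
    ext1 j
    simp only [AlgHom.comp_apply]
    by_cases h1 : j = i
    · subst h1
      rw [sw_X_left, toFin_X (show j < m by omega), toFin_X hi, rename_X, Equiv.swap_apply_left]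
    by_cases h2 : j = i + 1
    · subst h2
      rw [sw_X_right, toFin_X (show i < m by omega), toFin_X hi, rename_X, Equiv.swap_apply_right]
    rw [sw_X_of_ne h1 h2]
    by_cases hj : j < m
    · rw [toFin_X hj, rename_X, Equiv.swap_apply_of_ne_of_ne]
      · simpa using h1
      · simpa using h2
    · rw [toFin_X_of_le (not_lt.1 hj), map_zero]
  have := DFunLike.congr_fun this F
  simp only [AlgHom.comp_apply] at this
  rw [this, dd_eq_zero_iff.1 (h i hi)]

/-- The family of polynomials `c t^{n(m-1)} (pSym Π) ⋯ (pSym Π) · 1`. -/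
def wordFam (u t p c : R) (ds : List ℕ) : Family R := fun m =>
  toFin R m (C (c * t ^ (ds.length * ((m : ℕ) - 1))) * word u p m ds)

/-- Truncating from `m + 1` to `m` variables costs `u^n` with `n = ds.length`, and the prefactor
grows by `t^n`. As `u t = 1` they cancel, which is the purpose of the power `t^{n(m-1)}`. -/
theorem wordFam_mem {u t : R} (hut : u * t = 1) (p c : R) {ds : List ℕ} (h : IsArea ds)
    (h0 : ds.headD 0 = 0) : wordFam u t p c ds ∈ SymmFun R := by
  have hdd : ∀ m j, j + 1 < m → dd j (word u p m ds) = 0 := fun m j hj =>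
    dd_word u p m h (by omega)
  have hsucc : ∀ m, 0 < m →
      trunc R (m + 1) m (toFin R (m + 1) (C (c * t ^ (ds.length * (m + 1 - 1))) *
        word u p (m + 1) ds)) =
      toFin R m (C (c * t ^ (ds.length * (m - 1))) * word u p m ds) := by
    intro m hm
    have hk := kill_word u p hm h (by omega)
    rw [h0, Nat.sub_zero] at hk
    rw [trunc_toFin_succ, map_mul, hk, ← mul_assoc]
    congr 2
    rw [show kill R m (C (c * t ^ (ds.length * (m + 1 - 1)))) =
      C (c * t ^ (ds.length * (m + 1 - 1))) from AlgHom.commutes _ _, ← C_pow, ← C_mul]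
    congr 1
    obtain ⟨k, rfl⟩ : ∃ k, m = k + 1 := ⟨m - 1, by omega⟩
    simp only [Nat.add_sub_cancel]
    have : u ^ ds.length * t ^ ds.length = 1 := by rw [← mul_pow, hut, one_pow]
    rw [mul_add, pow_add, mul_one]
    linear_combination c * t ^ (ds.length * k) * this
  refine ⟨fun m m' hm => ?_, fun m => ?_, ds.length, fun m => ?_⟩
  · have key : ∀ k, trunc R ((m' : ℕ) + k) m' (toFin R ((m' : ℕ) + k)
        (C (c * t ^ (ds.length * ((m' : ℕ) + k - 1))) * word u p ((m' : ℕ) + k) ds)) =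
        wordFam u t p c ds m' := by
      intro k
      induction k with
      | zero => exact trunc_self _ _
      | succ k ih =>
        rw [← trunc_trunc (m' := (m' : ℕ) + k) (Nat.le_add_right _ _), ← ih]
        exact congrArg _ (hsucc _ (Nat.add_pos_left m'.pos k))
    obtain ⟨k, hk⟩ : ∃ k, (m : ℕ) = (m' : ℕ) + k :=
      ⟨(m : ℕ) - m', by have : (m' : ℕ) < m := hm; omega⟩
    rw [← key k, ← hk]
    rfl
  · exact isSymmetric_toFin fun j hj => by
      rw [dd_mul_of_dd_eq_zero (dd_C _ _), hdd m j hj, mul_zero]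
  · refine (totalDegree_toFin_le _ _).trans ((totalDegree_mul _ _).trans ?_)
    rw [totalDegree_C, zero_add]
    exact totalDegree_word_le _ _ _ _

theorem map_wordFam {R' : Type*} [CommRing R'] [IsDomain R'] (f : R →+* R') (u t p c : R)
    (ds : List ℕ) (m : ℕ+) :
    map f (wordFam u t p c ds m) = wordFam (f u) (f t) (f p) (f c) ds m := by
  rw [wordFam, map_toFin, map_mul, map_word, map_C, wordFam]
  simp

theorem wordFam_zero {u t : R} (hut : u * t = 1) (c : R) {ds : List ℕ} (h : IsArea ds)
    (h0 : ds.headD 0 = 0) :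
    wordFam u t 0 c ds = (c * (t ^ ds.sum * tFac t ds.length)) • elemSymm R ds.length := by
  funext m
  have hc := cut_word_zero hut m.pos h
  rw [h0, Nat.sub_zero] at hc
  rw [wordFam, ← toFin_cut, map_mul, show ∀ r, cut R m (C r) = C r from
    fun r => AlgHom.commutes _ _, C_mul, mul_assoc, C_pow, hc, ← mul_assoc, ← C_mul, map_mul,
    toFin_es, Pi.smul_apply, smul_eq_C_mul]
  congr 1
  exact AlgHom.commutes _ _

end

/-! ### Area sequences of unit interval graphs -/

theorem isArea_ofFn {n : ℕ} {f : Fin n → ℕ}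
    (h : ∀ i j : Fin n, (j : ℕ) = i + 1 → f j ≤ f i + 1) : IsArea (List.ofFn f) := by
  induction n with
  | zero => simp [IsArea]
  | succ n ih =>
    rw [List.ofFn_succ]
    refine ⟨?_, ih fun i j hij => h i.succ j.succ (by simp [hij])⟩
    rcases n with _ | n
    · simp
    · rw [List.ofFn_succ, List.headD_cons]
      exact h 0 (Fin.succ 0) (by simp)

theorem ESeq.isArea {n : ℕ} (e : ESeq n) : IsArea e.area := by
  refine isArea_ofFn fun i j hij => ?_
  have h1 := e.val_lt i
  have h2 : e.val i ≤ e.val j := e.mono (by rw [Fin.le_def]; omega)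
  omega

theorem ESeq.headD_area {n : ℕ} (e : ESeq n) : e.area.headD 0 = 0 := by
  rcases n with _ | n
  · simp [ESeq.area]
  · simp [ESeq.area, List.ofFn_succ]

theorem ESeq.length_area {n : ℕ} (e : ESeq n) : e.area.length = n := by simp [ESeq.area]

theorem ESeq.sum_area {n : ℕ} (e : ESeq n) : e.area.sum + e.size = n * (n - 1) / 2 := by
  rw [ESeq.area, List.sum_ofFn, ESeq.size, ← Finset.sum_add_distrib, ← Finset.sum_range_id,
    Finset.sum_range]
  refine Finset.sum_congr rfl fun v _ => ?_
  have := e.val_lt v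
  omega

/-! ### The parameter `t` and the limit of a word -/

theorem tt_ne_zero : tt ≠ 0 := RatFunc.X_ne_zero

theorem tt_pow_ne_one {k : ℕ} (hk : k ≠ 0) : tt ^ k ≠ 1 := by
  intro h
  have h1 : algebraMap (Polynomial ℚ) Qt (Polynomial.X ^ k) = algebraMap (Polynomial ℚ) Qt 1 := by
    rw [map_pow, RatFunc.algebraMap_X, map_one]; exact h
  have h2 := RatFunc.algebraMap_injective ℚ h1
  have h3 := congrArg Polynomial.natDegree h2
  simp at h3
  exact hk h3

theorem tInt_eq (k : ℕ) : tInt k = tNum tt k := by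
  have : (1 - tt) ≠ 0 := by
    rw [sub_ne_zero]; exact fun h => tt_pow_ne_one one_ne_zero (by rw [pow_one]; exact h.symm)
  rw [tInt, div_eq_iff this, tNum, geom_sum_mul_neg]

theorem tFact_eq (n : ℕ) : tFact n = tFac tt n := by
  induction n with
  | zero => simp [tFact, tFac]
  | succ n ih => rw [tFact, Finset.prod_Icc_succ_top (by omega), ← tFact, ih, tFac_succ, tInt_eq]

theorem tNum_ne_zero {k : ℕ} (hk : k ≠ 0) : tNum tt k ≠ 0 := by
  rw [← tInt_eq, tInt, div_ne_zero_iff]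
  exact ⟨sub_ne_zero.2 (tt_pow_ne_one hk).symm,
    sub_ne_zero.2 fun h => tt_pow_ne_one one_ne_zero (by rw [pow_one]; exact h.symm)⟩

theorem tFac_ne_zero (n : ℕ) : tFac tt n ≠ 0 :=
  Finset.prod_ne_zero_iff.2 fun _ _ => tNum_ne_zero (Nat.succ_ne_zero _)

theorem C_tt_mul : RatFunc.C (tt⁻¹) * RatFunc.C tt = (1 : Qqt) := by
  rw [← map_mul, inv_mul_cancel₀ tt_ne_zero, map_one]

/-- The witness is the same word over `ℚ(t)[p]`, with the polynomial variable as `p`. -/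
theorem hasLimit_wordFam (c : Qt) {ds : List ℕ} (h : IsArea ds) (h0 : ds.headD 0 = 0) :
    HasLimit (wordFam (RatFunc.C tt⁻¹) (RatFunc.C tt) ((qq⁻¹ : Qqtˣ) : Qqt) (RatFunc.C c) ds)
      ((c * (tt ^ ds.sum * tFac tt ds.length)) • elemSymm Qt ds.length) := by
  intro m
  refine ⟨wordFam (Polynomial.C tt⁻¹) (Polynomial.C tt) Polynomial.X (Polynomial.C c) ds m, ?_, ?_⟩
  · rw [map_wordFam]
    simp [RatFunc.algebraMap_eq_C]
  · rw [map_wordFam, ← wordFam_zero (inv_mul_cancel₀ tt_ne_zero) c h h0]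
    simp

theorem exists_isQTChrom {n : ℕ} (e : ESeq n) : ∃ F : Family Qqt,
    IsQTChrom qq (RatFunc.C tt) e F ∧
      HasLimit F ((tt ^ (((n * (n - 1) / 2 : ℕ) : ℤ) - (e.size : ℤ)) * tFact n) •
        elemSymm Qt n) := by
  refine ⟨wordFam (RatFunc.C tt⁻¹) (RatFunc.C tt) ((qq⁻¹ : Qqtˣ) : Qqt) (RatFunc.C 1) e.area,
    ⟨wordFam_mem C_tt_mul _ _ e.isArea e.headD_area, fun m => ?_⟩, ?_⟩
  · rw [qtChromTrunc_eq qq m C_tt_mul, toRat_apply, wordFam, e.length_area, map_one, one_mul, C_pow]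
  · have := hasLimit_wordFam 1 e.isArea e.headD_area
    rw [e.length_area, one_mul] at this
    rw [← e.sum_area, tFact_eq]
    rw [Nat.cast_add, add_sub_cancel_right, zpow_natCast]
    exact this

section

variable {R : Type*} [CommRing R] [IsDomain R] {u t p : R}

/-! ## The commuting operators `Y_i` on polynomials -/

/-- `T_{k-1} ⋯ T_0`. -/
def descTp (u t : R) : ℕ → Module.End R (MvPolynomial ℕ R)
  | 0 => 1
  | k + 1 => opTp u t k * descTp u t k

/-- `T_0 ⋯ T_{k-1}`. -/
def ascTp (u t : R) : ℕ → Module.End R (MvPolynomial ℕ R)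
  | 0 => 1
  | k + 1 => ascTp u t k * opTp u t k

/-- `T_{i+k-1}⁻¹ ⋯ T_i⁻¹`. -/
def descN (u : R) (i : ℕ) : ℕ → Module.End R (MvPolynomial ℕ R)
  | 0 => 1
  | k + 1 => opN u (i + k) * descN u i k

/-- The operator `Y_i` on polynomials. -/
def opYp (u t p : R) (m i : ℕ) : Module.End R (MvPolynomial ℕ R) :=
  t ^ (m - (i + 1)) • (descTp u t i * opR p m * descN u i (m - (i + 1)))

theorem descN_zero (u : R) (k : ℕ) : descN u 0 k = desc u k := by
  induction k with
  | zero => rfl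
  | succ k ih => rw [descN, ih, zero_add]; rfl

theorem descN_succ' (u : R) (i k : ℕ) : descN u i (k + 1) = descN u (i + 1) k * opN u i := by
  induction k with
  | zero => simp [descN]
  | succ k ih => rw [descN, ih, descN, ← mul_assoc, show i + 1 + k = i + (k + 1) by ring]

theorem opN_mul_opTp (hut : u * t = 1) (i : ℕ) : opN u i * opTp u t i = 1 :=
  LinearMap.ext (opN_opTp hut i)

theorem opTp_mul_opN (hut : u * t = 1) (i : ℕ) : opTp u t i * opN u i = 1 :=
  LinearMap.ext (opTp_opN hut i)

theorem commute_opTp {i : ℕ} {A : Module.End R (MvPolynomial ℕ R)} (h : Commute (opN u i) A) :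
    Commute (opTp u t i) A :=
  (h.smul_left t).add_left ((Commute.one_left A).smul_left _)

/-- This recursion reduces statements about all `Y_i` to `Y_0`. -/
theorem opYp_succ (hut : u * t = 1) {m i : ℕ} (h : i + 1 < m) :
    opYp u t p m (i + 1) = u • (opTp u t i * opYp u t p m i * opTp u t i) := by
  obtain ⟨k, rfl⟩ : ∃ k, m = i + 2 + k := ⟨m - (i + 2), by omega⟩
  rw [opYp, opYp, show i + 2 + k - (i + 1 + 1) = k by omega,
    show i + 2 + k - (i + 1) = k + 1 by omega, descN_succ', descTp]
  simp only [mul_smul_comm, smul_mul_assoc, smul_smul, mul_assoc, opN_mul_opTp hut, mul_one]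
  congr 1
  rw [pow_succ', ← mul_assoc, hut, one_mul]

theorem opN_opYp_right (hut : u * t = 1) {m i : ℕ} (h : i + 1 < m) :
    opN u i * opYp u t p m (i + 1) = u • (opYp u t p m i * opTp u t i) := by
  rw [opYp_succ hut h, mul_smul_comm, mul_assoc, ← mul_assoc, opN_mul_opTp hut, one_mul]

theorem smul_opTp (hut : u * t = 1) (i : ℕ) : u • opTp u t i = opN u i - (u - 1) • 1 := by
  refine LinearMap.ext fun F => ?_
  have hut' : (C u * C t : MvPolynomial ℕ R) = 1 := by rw [← C_mul, hut, C_1]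
  simp only [LinearMap.smul_apply, LinearMap.sub_apply, opTp_apply, Module.End.one_apply,
    smul_eq_C_mul, C_sub, C_1]
  linear_combination (opN u i F + F) * hut'

/-- The counterpart of `opN_X_right` with `Y` in place of `X`; `opN_opYp_left` corresponds to
`opN_X_left`. -/
theorem opN_opYp_right' (hut : u * t = 1) {m i : ℕ} (h : i + 1 < m) :
    opN u i * opYp u t p m (i + 1) = opYp u t p m i * opN u i - (u - 1) • opYp u t p m i := by
  rw [opN_opYp_right hut h, ← mul_smul_comm, smul_opTp hut, mul_sub, mul_smul_comm, mul_one]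

theorem opN_opYp_left (hut : u * t = 1) {m i : ℕ} (h : i + 1 < m) :
    opN u i * opYp u t p m i = opYp u t p m (i + 1) * opN u i + (u - 1) • opYp u t p m i := by
  have h1 : opYp u t p m (i + 1) * opN u i = u • (opTp u t i * opYp u t p m i) := by
    rw [opYp_succ hut h, smul_mul_assoc, mul_assoc, opTp_mul_opN hut, mul_one]
  rw [h1, ← smul_mul_assoc, smul_opTp hut, sub_mul, smul_mul_assoc, one_mul, sub_add_cancel]

theorem opR_mul_opN {m i : ℕ} (h : i + 2 < m) :
    opR p m * opN u i = opN u (i + 1) * opR p m :=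
  LinearMap.ext fun F => by rw [Module.End.mul_apply, Module.End.mul_apply, opR_opN p u h]

theorem braid_opTp (hut : u * t = 1) (i : ℕ) :
    opN u i * (opTp u t (i + 1) * opTp u t i) =
      opTp u t (i + 1) * opTp u t i * opN u (i + 1) := by
  have hb := opN_braid u i
  set a := opN u i
  set b := opN u (i + 1)
  set A := opTp u t i
  set B := opTp u t (i + 1)
  have haA : a * A = 1 := opN_mul_opTp hut i
  have hAa : A * a = 1 := opTp_mul_opN hut i
  have hbB : b * B = 1 := opN_mul_opTp hut _
  have hBb : B * b = 1 := opTp_mul_opN hut _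
  have h1 : a * b * a * B * A = b := by
    rw [hb, mul_assoc (b * a), hbB, mul_one, mul_assoc, haA, mul_one]
  calc a * (B * A) = B * (A * a) * b * a * B * A := by rw [hAa, mul_one, hBb, one_mul, mul_assoc]
    _ = B * A * (a * b * a * B * A) := by simp only [mul_assoc]
    _ = B * A * b := by rw [h1]

theorem braid_opTp' (hut : u * t = 1) (i : ℕ) :
    opN u (i + 1) * (opTp u t i * opTp u t (i + 1)) =
      opTp u t i * opTp u t (i + 1) * opN u i := by
  have hb := opN_braid u i
  set a := opN u i
  set b := opN u (i + 1)
  set A := opTp u t i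
  set B := opTp u t (i + 1)
  have haA : a * A = 1 := opN_mul_opTp hut i
  have hAa : A * a = 1 := opTp_mul_opN hut i
  have hbB : b * B = 1 := opN_mul_opTp hut _
  have hBb : B * b = 1 := opTp_mul_opN hut _
  have h1 : b * a * b * A * B = a := by
    rw [← hb, mul_assoc (a * b), haA, mul_one, mul_assoc, hbB, mul_one]
  calc b * (A * B) = A * (B * b) * a * b * A * B := by rw [hBb, mul_one, hAa, one_mul, mul_assoc]
    _ = A * B * (b * a * b * A * B) := by simp only [mul_assoc]
    _ = A * B * a := by rw [h1]

theorem commute_opN_opN {i j : ℕ} (h : i + 2 ≤ j ∨ j + 2 ≤ i) : Commute (opN u i) (opN u j) :=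
  opN_comm u h

theorem commute_opN_opTp {i j : ℕ} (h : i + 2 ≤ j ∨ j + 2 ≤ i) : Commute (opN u i) (opTp u t j) :=
  (commute_opTp (commute_opN_opN h.symm)).symm

/-- For `i = 0`, passing `Π` lowers the index of `T_j⁻¹` by one and passing the descending product
raises it back. The recursion for `Y_i` carries this to larger `i`. -/
theorem commute_opN_opYp (hut : u * t = 1) {m i j : ℕ} (hi : i < m) (hj : j + 1 < m) (h1 : j ≠ i)
    (h2 : j + 1 ≠ i) : Commute (opN u j) (opYp u t p m i) := by
  induction i using Nat.strong_induction_on generalizing j with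
  | _ i ih =>
    rcases i with _ | _ | i
    · obtain ⟨k, rfl⟩ : ∃ k, j = k + 1 := ⟨j - 1, by omega⟩
      rw [opYp, descN_zero, descTp, one_mul]
      refine Commute.smul_right ?_ _
      rw [Commute, SemiconjBy, ← mul_assoc, ← opR_mul_opN (by omega), mul_assoc, mul_assoc]
      congr 1
      refine LinearMap.ext fun F => ?_
      rw [Module.End.mul_apply, Module.End.mul_apply, opN_desc_of_add_two_le u (by omega)]
    · rw [opYp_succ hut hi]
      have hT : Commute (opN u j) (opTp u t 0) := commute_opN_opTp (by omega)
      exact ((hT.mul_right (ih 0 (by omega) (by omega) hj (by omega) (by omega))).mul_right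
        hT).smul_right _
    -- The critical case: `T_j⁻¹` commutes with neither `T_{j+1}` nor `T_j`. The braid relation
    -- turns it into `T_{j+1}⁻¹` on one side of `Y_j` and back again on the other.
    · by_cases hji : j = i
      · subst hji
        rw [opYp_succ hut hi, opYp_succ hut (by omega)]
        refine Commute.smul_right ?_ _
        rw [mul_smul_comm, smul_mul_assoc]
        refine Commute.smul_right ?_ _
        have hc := ih j (by omega) (by omega) (show j + 1 + 1 < m by omega) (by omega) (by omega)
        rw [Commute, SemiconjBy]
        calc opN u j * (opTp u t (j + 1) * (opTp u t j * opYp u t p m j * opTp u t j) *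
              opTp u t (j + 1))
            = opN u j * (opTp u t (j + 1) * opTp u t j) * opYp u t p m j *
              (opTp u t j * opTp u t (j + 1)) := by simp only [mul_assoc]
          _ = opTp u t (j + 1) * opTp u t j * (opN u (j + 1) * opYp u t p m j) *
              (opTp u t j * opTp u t (j + 1)) := by rw [braid_opTp hut]; simp only [mul_assoc]
          _ = opTp u t (j + 1) * opTp u t j * opYp u t p m j *
              (opN u (j + 1) * (opTp u t j * opTp u t (j + 1))) := by
              rw [hc.eq]; simp only [mul_assoc]
          _ = _ := by rw [braid_opTp' hut]; simp only [mul_assoc]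
      · rw [opYp_succ hut hi]
        have hT : Commute (opN u j) (opTp u t (i + 1)) := commute_opN_opTp (by omega)
        exact ((hT.mul_right (ih (i + 1) (by omega) (by omega) hj (by omega) (by omega))).mul_right
          hT).smul_right _

/-- In braid terms, two parallel strands pass across `k` others and carry their own crossing along.
-/
theorem opN_desc_descN (u : R) (k : ℕ) :
    opN u k * (desc u k * descN u 1 k) = desc u k * descN u 1 k * opN u 0 := by
  induction k with
  | zero => simp [desc, descN]
  | succ k ih =>
    have h : opN u (k + 1) * desc u k = desc u k * opN u (k + 1) :=
      LinearMap.ext fun F => by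
        rw [Module.End.mul_apply, Module.End.mul_apply, opN_desc_of_lt u (Nat.lt_succ_self k)]
    have e : desc u (k + 1) * descN u 1 (k + 1) =
        opN u k * opN u (k + 1) * (desc u k * descN u 1 k) := by
      rw [descN, desc, add_comm 1 k, mul_assoc, ← mul_assoc (desc u k), ← h]
      simp only [mul_assoc]
    rw [e, mul_assoc _ _ (opN u 0), ← ih, ← mul_assoc, ← mul_assoc, ← mul_assoc (opN u (k + 1)),
      ← opN_braid]
    simp only [mul_assoc]

/-- Two rotations send `X_{m-2}, X_{m-1}` to `p X_0, p X_1`. The common factor `p` moves between the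
divided difference and its multiplier, and the prefactor `X_0 X_1` is symmetric. This takes the
index once around the cycle without passing through the affine operator. -/
theorem opN_opR_opR {m : ℕ} (h : 2 ≤ m) (F : MvPolynomial ℕ R) :
    opR p m (opR p m (opN u (m - 2) F)) = opN u 0 (opR p m (opR p m F)) := by
  obtain ⟨k, rfl⟩ : ∃ k, m = k + 2 := ⟨m - 2, by omega⟩
  have h0 : rot p (k + 2) (X 0) = X 1 := by rw [rot_X, if_pos (by omega)]
  have hk : rot p (k + 2) (rot p (k + 2) (X k)) = C p * X 0 := by
    rw [rot_X, if_pos (by omega), rot_X, if_neg (by omega), if_pos rfl]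
  have hC : ∀ r : R, rot p (k + 2) (C r) = C r := fun r => AlgHom.commutes _ _
  have hk1 : rot p (k + 2) (rot p (k + 2) (X (k + 1))) = C p * X 1 := by
    rw [rot_X, if_neg (by omega), if_pos rfl, map_mul, hC, h0]
  have hs : ∀ F, rot p (k + 2) (rot p (k + 2) (sw R k F)) =
      sw R 0 (rot p (k + 2) (rot p (k + 2) F)) := by
    intro F
    have : ((rot p (k + 2)).comp (rot p (k + 2))).comp (sw R k) =
        (sw R 0).comp ((rot p (k + 2)).comp (rot p (k + 2))) := by
      ext1 j
      simp only [AlgHom.comp_apply]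
      have hCs : sw R 0 (C p : MvPolynomial ℕ R) = C p := AlgHom.commutes _ _
      by_cases h1 : j = k
      · subst h1
        rw [sw_X_left, hk, hk1, map_mul, hCs, sw_X_left]
      by_cases h2 : j = k + 1
      · subst h2
        rw [sw_X_right, hk, hk1, map_mul, hCs]
        congr 1
        exact (sw_X_right 0).symm
      rw [sw_X_of_ne h1 h2]
      by_cases hj : j < k
      · rw [rot_X, if_pos (by omega), rot_X, if_pos (by omega), sw_X_of_ne (by omega) (by omega)]
      · rw [rot_X, if_neg (by omega), if_neg (by omega), rot_X, if_neg (by omega),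
          if_neg (by omega), sw_X_of_ne (by omega) (by omega)]
    exact DFunLike.congr_fun this F
  have hd : dd 0 (rot p (k + 2) (rot p (k + 2) F)) =
      C p * rot p (k + 2) (rot p (k + 2) (dd k F)) := by
    apply dd_eq_of
    rw [← hs, ← map_sub, ← map_sub, ← dd_spec, map_mul, map_mul, map_sub, map_sub, hk, hk1]
    ring
  have hX : dd 0 (X 0 * X 1 : MvPolynomial ℕ R) = 0 := by
    have := dd_mul 0 (X 0) (X 1 : MvPolynomial ℕ R)
    rw [dd_X_left, show (1 : ℕ) = 0 + 1 from rfl, dd_X_right, sw_X_left] at this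
    rw [this]; ring
  simp only [opR_apply, map_mul, h0, Nat.add_sub_cancel]
  rw [← mul_assoc, ← mul_assoc, opN_mul_of_dd_eq_zero hX, opN_apply, opN_apply, hd]
  simp only [map_add, map_mul, map_sub, hC, hk, hk1]
  ring

theorem opR_descN {m i k : ℕ} (h : i + k + 1 < m) :
    opR p m * descN u i k = descN u (i + 1) k * opR p m := by
  induction k with
  | zero => simp [descN]
  | succ k ih =>
    rw [descN, descN, ← mul_assoc, opR_mul_opN (by omega), mul_assoc, ih (by omega), mul_assoc,
      show i + k + 1 = i + 1 + k by ring]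

theorem commute_opYp_zero_one (hut : u * t = 1) {m : ℕ} (h : 1 < m) :
    Commute (opYp u t p m 0) (opYp u t p m 1) := by
  obtain ⟨k, rfl⟩ : ∃ k, m = k + 2 := ⟨m - 2, by omega⟩
  set P := opR p (k + 2) with hP
  have hY0 : opYp u t p (k + 2) 0 = t ^ (k + 1) • (P * (descN u 1 k * opN u 0)) := by
    rw [opYp, descTp, one_mul, show k + 2 - (0 + 1) = k + 1 by omega, descN_succ']
  have hY1 : opYp u t p (k + 2) 1 = t ^ k • (opTp u t 0 * P * descN u 1 k) := by
    rw [opYp, descTp, descTp, mul_one]; rfl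
  -- With `W = Π T_{m-2}⁻¹ ⋯ T_1⁻¹`, up to scalars `Y_0 = W T_0⁻¹` and `Y_1 = T_0 W`. They commute
  -- because `T_0⁻¹` commutes with `W²`.
  have hW : opN u 0 * (P * descN u 1 k * (P * descN u 1 k)) =
      P * descN u 1 k * (P * descN u 1 k) * opN u 0 := by
    have e : P * descN u 1 k * (P * descN u 1 k) = P * P * (desc u k * descN u 1 k) := by
      have := opR_descN (p := p) (u := u) (m := k + 2) (i := 0) (k := k) (by omega)
      rw [descN_zero, zero_add] at this
      rw [mul_assoc P (descN u 1 k), ← mul_assoc (descN u 1 k), ← this]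
      simp only [mul_assoc, hP]
    have e2 : opN u 0 * (P * P) = P * P * opN u k :=
      LinearMap.ext fun F => by
        simp only [Module.End.mul_apply]
        exact (opN_opR_opR (u := u) (p := p) (m := k + 2) (by omega) F).symm
    rw [e, ← mul_assoc, e2, mul_assoc, opN_desc_descN, ← mul_assoc]
  rw [hY0, hY1]
  refine Commute.smul_left (Commute.smul_right ?_ _) _
  rw [Commute, SemiconjBy]
  calc P * (descN u 1 k * opN u 0) * (opTp u t 0 * P * descN u 1 k)
      = P * descN u 1 k * (opN u 0 * opTp u t 0) * P * descN u 1 k := by simp only [mul_assoc]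
    _ = P * descN u 1 k * (P * descN u 1 k) := by
        rw [opN_mul_opTp hut, mul_one]; simp only [mul_assoc]
    _ = opTp u t 0 * (opN u 0 * (P * descN u 1 k * (P * descN u 1 k))) := by
        rw [← mul_assoc (opTp u t 0), opTp_mul_opN hut, one_mul]
    _ = opTp u t 0 * P * descN u 1 k * (P * (descN u 1 k * opN u 0)) := by
        rw [hW]; simp only [mul_assoc]

theorem commute_opYp_of_lt (hut : u * t = 1) {m i j : ℕ} (hij : i < j) (hj : j < m) :
    Commute (opYp u t p m i) (opYp u t p m j) := by
  induction i generalizing j with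
  | zero =>
    induction j, hij using Nat.le_induction with
    | base => exact commute_opYp_zero_one hut hj
    | succ j hj' ih =>
      rw [opYp_succ hut hj]
      have hT : Commute (opYp u t p m 0) (opTp u t j) :=
        (commute_opTp (commute_opN_opYp hut (by omega) hj (by omega) (by omega))).symm
      exact ((hT.mul_right (ih (by omega))).mul_right hT).smul_right _
  | succ i ih =>
    rw [opYp_succ hut (show i + 1 < m by omega)]
    have hT : Commute (opTp u t i) (opYp u t p m j) :=
      commute_opTp (commute_opN_opYp hut hj (by omega) (by omega) (by omega))
    exact ((hT.mul_left (ih (by omega) hj)).mul_left hT).smul_left _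

theorem commute_opYp (hut : u * t = 1) {m i j : ℕ} (hi : i < m) (hj : j < m) :
    Commute (opYp u t p m i) (opYp u t p m j) := by
  rcases lt_trichotomy i j with h | rfl | h
  · exact commute_opYp_of_lt hut h hj
  · exact Commute.refl _
  · exact (commute_opYp_of_lt hut h hi).symm

end

/-! ## The map `F(X) ↦ F(Y) · 1` -/

/-- Evaluation of polynomials at commuting elements of an algebra. -/
theorem exists_algHom_of_commute {R A σ : Type*} [CommRing R] [Ring A] [Algebra R A] (y : σ → A)
    (hy : ∀ i j, Commute (y i) (y j)) : ∃ φ : MvPolynomial σ R →ₐ[R] A, ∀ i, φ (X i) = y i := by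
  have h : ∀ a ∈ Set.range y, ∀ b ∈ Set.range y, a * b = b * a := by
    rintro _ ⟨i, rfl⟩ _ ⟨j, rfl⟩
    exact hy i j
  let _ : CommRing (Algebra.adjoin R (Set.range y)) :=
    { (inferInstance : Ring (Algebra.adjoin R (Set.range y))) with
      mul_comm := (Algebra.isMulCommutative_adjoin R h).is_comm.comm }
  refine ⟨(Algebra.adjoin R (Set.range y)).val.comp
    (aeval fun i => (⟨y i, Algebra.subset_adjoin ⟨i, rfl⟩⟩ : Algebra.adjoin R (Set.range y))),
    fun i => ?_⟩
  simp

section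

variable {R : Type*} [CommRing R] [IsDomain R] {u t p : R}

/-- The algebra homomorphism `X_i ↦ Y_i`. -/
def evalY (hut : u * t = 1) (p : R) (m : ℕ) :
    MvPolynomial (Fin m) R →ₐ[R] Module.End R (MvPolynomial ℕ R) :=
  (exists_algHom_of_commute (fun i : Fin m => opYp u t p m i)
    fun i j => commute_opYp hut i.2 j.2).choose

theorem evalY_X (hut : u * t = 1) (p : R) (m : ℕ) (i : Fin m) :
    evalY hut p m (X i) = opYp u t p m i :=
  (exists_algHom_of_commute (fun i : Fin m => opYp u t p m i)
    fun i j => commute_opYp hut i.2 j.2).choose_spec i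

/-- The linear map `F(X) ↦ F(Y) · 1`. -/
def quant (hut : u * t = 1) (p : R) (m : ℕ) : MvPolynomial ℕ R →ₗ[R] MvPolynomial ℕ R :=
  LinearMap.applyₗ (1 : MvPolynomial ℕ R) ∘ₗ (evalY hut p m).toLinearMap ∘ₗ
    (toFin R m).toLinearMap

variable (hut : u * t = 1) (p : R) (m : ℕ)

theorem quant_apply (F : MvPolynomial ℕ R) : quant hut p m F = evalY hut p m (toFin R m F) 1 := rfl

theorem quant_C (r : R) : quant hut p m (C r) = C r := by
  rw [quant_apply, show toFin R m (C r) = algebraMap R _ r from AlgHom.commutes _ _,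
    AlgHom.commutes]
  simp [smul_eq_C_mul]

theorem quant_C_mul (r : R) (F : MvPolynomial ℕ R) :
    quant hut p m (C r * F) = C r * quant hut p m F := by
  rw [← smul_eq_C_mul, map_smul, smul_eq_C_mul]

theorem quant_X_mul {i : ℕ} (h : i < m) (F : MvPolynomial ℕ R) :
    quant hut p m (X i * F) = opYp u t p m i (quant hut p m F) := by
  rw [quant_apply, map_mul, map_mul, toFin_X h, evalY_X]; rfl

theorem quant_X_mul_of_le {i : ℕ} (h : m ≤ i) (F : MvPolynomial ℕ R) :
    quant hut p m (X i * F) = 0 := by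
  rw [quant_apply, map_mul, toFin_X_of_le h]; simp

/-- Induction on the polynomial: `T_i⁻¹` has the same cross relations with multiplication by `X_k`
and with `Y_k`, and it acts on constants by `u` on both sides. -/
theorem quant_opN {i : ℕ} (h : i + 1 < m) (F : MvPolynomial ℕ R) :
    quant hut p m (opN u i F) = opN u i (quant hut p m F) := by
  induction F using MvPolynomial.induction_on with
  | C a =>
    rw [opN_of_dd_eq_zero (dd_C _ _), quant_C_mul, quant_C, opN_of_dd_eq_zero (dd_C _ _)]
  | add P Q hP hQ => simp only [map_add, hP, hQ]
  | mul_X P k hP =>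
    rw [mul_comm]
    have hc : ∀ F : MvPolynomial ℕ R, (C u - 1) * F = (u - 1) • F := by
      intro F; rw [smul_eq_C_mul, C_sub, C_1]
    by_cases h1 : k = i
    · subst h1
      have := LinearMap.congr_fun (opN_opYp_left (p := p) hut h) (quant hut p m P)
      simp only [Module.End.mul_apply, LinearMap.add_apply, LinearMap.smul_apply] at this
      rw [opN_X_left, hc, map_add, map_smul, quant_X_mul hut p m h,
        quant_X_mul hut p m (show k < m by omega), hP, this]
    by_cases h2 : k = i + 1
    · subst h2
      have := LinearMap.congr_fun (opN_opYp_right' (p := p) hut h) (quant hut p m P)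
      simp only [Module.End.mul_apply, LinearMap.sub_apply, LinearMap.smul_apply] at this
      rw [opN_X_right, hc, map_sub, map_smul, quant_X_mul hut p m h,
        quant_X_mul hut p m (show i < m by omega), quant_X_mul hut p m (show i < m by omega), hP,
        this]
    rw [opN_X_of_ne u h1 h2]
    by_cases hk : k < m
    · have := LinearMap.congr_fun (commute_opN_opYp (p := p) hut hk h (Ne.symm h1)
        (Ne.symm h2)).eq (quant hut p m P)
      simp only [Module.End.mul_apply] at this
      rw [quant_X_mul hut p m hk, quant_X_mul hut p m hk, hP, this]
    · rw [quant_X_mul_of_le hut p m (not_lt.1 hk), quant_X_mul_of_le hut p m (not_lt.1 hk),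
        map_zero]

theorem quant_opTp {i : ℕ} (h : i + 1 < m) (F : MvPolynomial ℕ R) :
    quant hut p m (opTp u t i F) = opTp u t i (quant hut p m F) := by
  have hc : ∀ F : MvPolynomial ℕ R, (C t - 1) * F = (t - 1) • F := by
    intro F; rw [smul_eq_C_mul, C_sub, C_1]
  rw [opTp_apply, opTp_apply, map_add, quant_C_mul, hc, hc, map_smul, quant_opN hut p m h]

theorem quant_pSym {M : ℕ} (h : M ≤ m) (F : MvPolynomial ℕ R) :
    quant hut p m (pSym u M F) = pSym u M (quant hut p m F) := by
  have : ∀ k < M, quant hut p m (desc u k F) = desc u k (quant hut p m F) := by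
    intro k hk
    induction k with
    | zero => rfl
    | succ k ih => rw [desc_succ, quant_opN hut p m (by omega), ih (by omega), desc_succ]
  rw [pSym_apply, pSym_apply, map_sum]
  exact Finset.sum_congr rfl fun k hk => this k (Finset.mem_range.1 hk)

theorem ascTp_succ (k : ℕ) (F : MvPolynomial ℕ R) :
    ascTp u t (k + 1) F = ascTp u t k (opTp u t k F) := rfl

theorem quant_ascTp {k : ℕ} (h : k < m) (F : MvPolynomial ℕ R) :
    quant hut p m (ascTp u t k F) = ascTp u t k (quant hut p m F) := by
  induction k generalizing F with
  | zero => rfl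
  | succ k ih => rw [ascTp_succ, ih (by omega), quant_opTp hut p m h, ascTp_succ]

theorem desc_ascTp (hut : u * t = 1) (k : ℕ) (F : MvPolynomial ℕ R) : desc u k (ascTp u t k F) = F := by
  induction k generalizing F with
  | zero => rfl
  | succ k ih => rw [desc_succ, ascTp_succ, ih, opN_opTp hut]

theorem ascTp_desc (hut : u * t = 1) (k : ℕ) (F : MvPolynomial ℕ R) : ascTp u t k (desc u k F) = F := by
  induction k generalizing F with
  | zero => rfl
  | succ k ih => rw [desc_succ, ascTp_succ, opTp_opN hut, ih]

/-- `t^{1-m} X_0 T_0 ⋯ T_{m-2}`, which corresponds to `Π` under the map `F(X) ↦ F(Y) · 1`. -/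
def opPt (u t : R) (m : ℕ) (F : MvPolynomial ℕ R) : MvPolynomial ℕ R :=
  C (u ^ (m - 1)) * (X 0 * ascTp u t (m - 1) F)

/-- Solve `Y_0 = t^{m-1} Π T_{m-2}⁻¹ ⋯ T_0⁻¹` for `Π`. -/
theorem opR_quant (hm : 0 < m) (F : MvPolynomial ℕ R) :
    opR p m (quant hut p m F) = quant hut p m (opPt u t m F) := by
  have hY : ∀ F, opYp u t p m 0 F = t ^ (m - 1) • opR p m (desc u (m - 1) F) := by
    intro F; rw [opYp, descN_zero, descTp, one_mul]; rfl
  rw [opPt, quant_C_mul, quant_X_mul hut p m hm, quant_ascTp hut p m (by omega), hY,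
    desc_ascTp hut, ← smul_eq_C_mul, smul_smul, ← mul_pow, hut, one_pow, one_smul]

theorem totalDegree_opTp_le (i : ℕ) (F : MvPolynomial ℕ R) :
    (opTp u t i F).totalDegree ≤ F.totalDegree := by
  rw [opTp_apply]
  refine (totalDegree_add _ _).trans (max_le ?_ ?_)
  · refine (totalDegree_mul _ _).trans ?_
    rw [totalDegree_C, zero_add]
    exact totalDegree_opN_le _ _ _
  · refine (totalDegree_mul _ _).trans ?_
    rw [← C_1, ← C_sub, totalDegree_C, zero_add]

theorem totalDegree_opPt_le (F : MvPolynomial ℕ R) :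
    (opPt u t m F).totalDegree ≤ F.totalDegree + 1 := by
  have h : ∀ k F, (ascTp u t k F).totalDegree ≤ F.totalDegree := by
    intro k
    induction k with
    | zero => intro F; exact le_rfl
    | succ k ih =>
      intro F; rw [ascTp_succ]; exact (ih _).trans (totalDegree_opTp_le _ _)
  have h1 := totalDegree_mul (C (u ^ (m - 1))) (X 0 * ascTp u t (m - 1) F)
  have h2 := totalDegree_mul (X 0) (ascTp u t (m - 1) F)
  have h3 := h (m - 1) F
  rw [totalDegree_C] at h1
  rw [totalDegree_X] at h2
  rw [opPt]
  omega

/-! ## Cliques -/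

/-- Read backwards, this gives `T_0 ⋯ T_{M-1}` on `e_r(X_0, …, X_{M-1})`, as needed for `opPt`. -/
theorem desc_es_shift (hut : u * t = 1) (M r : ℕ) : desc u M (es (fun i => (X (i + 1) : MvPolynomial ℕ R)) M r) =
    C (u ^ M * t ^ r) * es X M r := by
  have hut' : (C u * C t : MvPolynomial ℕ R) = 1 := by rw [← C_mul, hut, C_1]
  have hX' : ∀ M, opN u M (X (M + 1) : MvPolynomial ℕ R) = X M := by
    intro M
    rw [opN_apply, dd_X_right]; ring
  induction M generalizing r with
  | zero => cases r <;> simp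
  | succ M ih =>
    cases r with
    | zero =>
      have := ih 0
      rw [es_zero_right, es_zero_right] at this
      rw [es_zero_right, es_zero_right, desc_succ, this, opN_C_mul, opN_of_dd_eq_zero (dd_one _)]
      simp only [C_mul, C_pow, pow_zero]
      ring
    | succ r =>
      rw [desc_succ, es_succ, map_add, desc_mul_of_ge (P := X (M + 1)) fun j hj =>
        dd_X_of_ne (by omega) (by omega), ih, ih, map_add, opN_C_mul, mul_left_comm, opN_C_mul,
        opN_of_dd_eq_zero (dd_es_of_lt le_rfl _), mul_comm (X (M + 1)) (es X M r),
        opN_mul_of_dd_eq_zero (dd_es_of_lt le_rfl _), hX', es_succ]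
      simp only [C_mul, C_pow]
      linear_combination (-(C u ^ M * C t ^ r * X M * es X M r)) * hut'

theorem ascTp_mul {k : ℕ} {P : MvPolynomial ℕ R} (hP : ∀ j < k, dd j P = 0)
    (F : MvPolynomial ℕ R) : ascTp u t k (P * F) = P * ascTp u t k F := by
  induction k generalizing F with
  | zero => rfl
  | succ k ih =>
    rw [ascTp_succ, opTp_apply, opN_mul_of_dd_eq_zero (hP k (by omega)),
      show C t * (P * opN u k F) + (C t - 1) * (P * F) = P * opTp u t k F by
        rw [opTp_apply]; ring, ih fun j hj => hP j (by omega), ascTp_succ]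

/-- The symmetric factor `P` passes through every `T_i`, the operators `T_i` with `i ≥ M` act by
`t`, and the other ones shift the variables. -/
theorem opPt_mul_es (hut : u * t = 1) (m : ℕ) {M r : ℕ} (hM : M < m) {P : MvPolynomial ℕ R}
    (hP : ∀ j, j + 1 < m → dd j P = 0) :
    opPt u t m (P * es X M r) = C (u ^ r) * (P * (X 0 * es (fun i => X (i + 1)) M r)) := by
  have hut' : (C u * C t : MvPolynomial ℕ R) = 1 := by rw [← C_mul, hut, C_1]
  have h1 : ∀ k, M + k < m → ascTp u t (M + k) (es X M r) =
      C (t ^ k) * ascTp u t M (es X M r) := by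
    intro k hk
    induction k with
    | zero => simp
    | succ k ih =>
      have : opTp u t (M + k) (es X M r : MvPolynomial ℕ R) = C t * es X M r := by
        rw [opTp_apply, opN_of_dd_eq_zero (dd_es_of_lt (Nat.le_add_right _ _) _)]
        linear_combination (es X M r) * hut'
      rw [← add_assoc, ascTp_succ, this, ascTp_mul fun _ _ => dd_C _ _, ih (by omega), pow_succ',
        C_mul, mul_assoc]
  have h2 : ascTp u t M (es X M r : MvPolynomial ℕ R) =
      C (t ^ M * u ^ r) * es (fun i => X (i + 1)) M r := by
    have := congrArg (ascTp u t M) (desc_es_shift hut M r)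
    rw [ascTp_desc hut, ascTp_mul fun _ _ => dd_C _ _] at this
    rw [this, ← mul_assoc, ← C_mul,
      show t ^ M * u ^ r * (u ^ M * t ^ r) = (u * t) ^ M * (u * t) ^ r by ring, hut]
    simp
  obtain ⟨k, hk⟩ : ∃ k, m - 1 = M + k := ⟨m - 1 - M, by omega⟩
  rw [opPt, ascTp_mul fun j hj => hP j (by omega), hk, h1 k (by omega), h2, pow_add]
  simp only [C_mul, C_pow]
  have e : (C u ^ M * C t ^ M : MvPolynomial ℕ R) = 1 := by rw [← mul_pow, hut', one_pow]
  have e' : (C u ^ k * C t ^ k : MvPolynomial ℕ R) = 1 := by rw [← mul_pow, hut', one_pow]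
  linear_combination (C u ^ r * P * X 0 * es (fun i => X (i + 1)) M r) *
    (C u ^ M * C t ^ M * e' + e)

/-- A clique placed before a word multiplies by an elementary symmetric polynomial on the `Y` side.
Starting at an arbitrary `s` lets the induction peel letters off the front, with the intermediate
polynomials `e_j` in only `m - s` variables. -/
theorem word_range'_append (hm : 0 < m) {P : MvPolynomial ℕ R} (hP : ∀ j, j + 1 < m → dd j P = 0)
    {ds : List ℕ} {c : R} (h : C c * word u p m ds = quant hut p m P) (s j : ℕ) :
    C (c * t ^ (j * (m - 1))) * word u p m (List.range' s j ++ ds) =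
      quant hut p m (C (∏ i ∈ Finset.range j, t ^ (s + j - 1 - i) * u ^ i * tNum t (i + 1)) *
        (P * es X (m - s) j)) := by
  induction j generalizing s with
  | zero => simpa using h
  | succ j ih =>
    rw [List.range'_succ, List.cons_append, word]
    rcases Nat.lt_or_ge s m with hs | hs
    swap
    · rw [Nat.sub_eq_zero_of_le hs]; simp
    obtain ⟨M, hM⟩ : ∃ M, m - s = M + 1 := ⟨m - s - 1, by omega⟩
    have hM' : m - (s + 1) = M := by omega
    have hC : ∀ (k : ℕ) (r : R) (F : MvPolynomial ℕ R), C r * pSym u k F = pSym u k (C r * F) :=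
      fun k r F => (pSym_mul (fun _ _ => dd_C _ _) F).symm
    have hR : ∀ (r : R) (F : MvPolynomial ℕ R), C r * opR p m F = opR p m (C r * F) := by
      intro r F; rw [← smul_eq_C_mul, ← smul_eq_C_mul, map_smul]
    have hPt : ∀ (r : R) (F : MvPolynomial ℕ R), opPt u t m (C r * F) = C r * opPt u t m F := by
      intro r F; rw [opPt, opPt, ascTp_mul fun _ _ => dd_C _ _]; ring
    have key := pSym_X_mul_es hut M j
    have ih' := ih (s + 1)
    rw [hM'] at ih'
    rw [hM, show c * t ^ ((j + 1) * (m - 1)) = t ^ (m - 1) * (c * t ^ (j * (m - 1))) by ring, C_mul,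
      mul_assoc, hC, hR, ih', opR_quant hut p m hm, hPt, opPt_mul_es hut m (by omega) hP,
      ← quant_pSym hut p m (by omega), ← quant_C_mul]
    congr 1
    have e1 : ∏ i ∈ Finset.range (j + 1), t ^ (s + (j + 1) - 1 - i) * u ^ i * tNum t (i + 1) =
        (∏ i ∈ Finset.range j, t ^ (s + 1 + j - 1 - i) * u ^ i * tNum t (i + 1)) *
          (t ^ s * u ^ j * tNum t (j + 1)) := by
      rw [Finset.prod_range_succ]
      congr 1
      · refine Finset.prod_congr rfl fun i _ => ?_
        rw [show s + (j + 1) - 1 - i = s + 1 + j - 1 - i by omega]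
      · rw [show s + (j + 1) - 1 - j = s by omega]
    rw [← hC, ← hC, pSym_mul fun i hi => hP i (by omega), e1, show m - 1 = s + M by omega, pow_add]
    simp only [C_mul, C_pow] at key ⊢
    linear_combination (C t ^ s *
      C (∏ i ∈ Finset.range j, t ^ (s + 1 + j - 1 - i) * u ^ i * tNum t (i + 1)) *
      C u ^ j * P) * key

/-- The product `t^0 t^1 ⋯ t^{r-1}`. -/
def tPow (t : R) (r : ℕ) : R := ∏ i ∈ Finset.range r, t ^ i

theorem word_range_append (hm : 0 < m) {P : MvPolynomial ℕ R} (hP : ∀ j, j + 1 < m → dd j P = 0)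
    {ds : List ℕ} {c : R} (h : C c * word u p m ds = quant hut p m P) (r : ℕ) :
    C (c * t ^ (r * (m - 1))) * word u p m (List.range r ++ ds) =
      quant hut p m (C (tFac t r) * (P * es X m r)) := by
  have := word_range'_append hut p m hm hP h 0 r
  rw [List.range_eq_range', this, Nat.sub_zero, Finset.prod_mul_distrib, Finset.prod_mul_distrib]
  simp only [zero_add]
  rw [Finset.prod_range_reflect (fun i => t ^ i) r, ← Finset.prod_mul_distrib]
  simp only [← mul_pow, mul_comm t u, hut, one_pow, Finset.prod_const_one, one_mul]
  rfl

/-- The same word evaluated on the `X` side. Each `Π` acts on a polynomial that does not involve the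
last variable, so `p` never enters. -/
theorem word_range' (hut : u * t = 1) (p : R) (m : ℕ) (hm : 0 < m) (s j : ℕ) :
    C (t ^ (j * (m - 1))) * word u p m (List.range' s j) =
      C (∏ i ∈ Finset.range j, t ^ (s + j - 1 - i) * tNum t (i + 1)) * es X (m - s) j := by
  induction j generalizing s with
  | zero => simp [word]
  | succ j ih =>
    rw [List.range'_succ, word]
    rcases Nat.lt_or_ge s m with hs | hs
    swap
    · rw [Nat.sub_eq_zero_of_le hs]; simp
    obtain ⟨M, hM⟩ : ∃ M, m - s = M + 1 := ⟨m - s - 1, by omega⟩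
    have hM' : m - (s + 1) = M := by omega
    have hC : ∀ (k : ℕ) (r : R) (F : MvPolynomial ℕ R), C r * pSym u k F = pSym u k (C r * F) :=
      fun k r F => (pSym_mul (fun _ _ => dd_C _ _) F).symm
    have hR : ∀ (r : R) (F : MvPolynomial ℕ R), C r * opR p m F = opR p m (C r * F) := by
      intro r F; rw [← smul_eq_C_mul, ← smul_eq_C_mul, map_smul]
    have hes : opR p m (es X M j) = X 0 * es (fun i => X (i + 1)) M j := by
      rw [opR_apply, map_es]
      congr 1
      exact es_congr (fun i hi => by rw [rot_X, if_pos (by omega)]) _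
    have key := pSym_X_mul_es hut M j
    have ih' := ih (s + 1)
    rw [hM'] at ih'
    have e1 : ∏ i ∈ Finset.range (j + 1), t ^ (s + (j + 1) - 1 - i) * tNum t (i + 1) =
        (∏ i ∈ Finset.range j, t ^ (s + 1 + j - 1 - i) * tNum t (i + 1)) *
          (t ^ s * tNum t (j + 1)) := by
      rw [Finset.prod_range_succ]
      congr 1
      · refine Finset.prod_congr rfl fun i _ => ?_
        rw [show s + (j + 1) - 1 - i = s + 1 + j - 1 - i by omega]
      · rw [show s + (j + 1) - 1 - j = s by omega]
    rw [hM, show t ^ ((j + 1) * (m - 1)) = t ^ (m - 1) * t ^ (j * (m - 1)) by ring, C_mul,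
      mul_assoc, hC, hR, ih', ← hR, hes, ← hC, e1, show m - 1 = s + M by omega, pow_add]
    simp only [C_mul, C_pow] at key ⊢
    linear_combination (C t ^ s *
      C (∏ i ∈ Finset.range j, t ^ (s + 1 + j - 1 - i) * tNum t (i + 1))) * key

/-- The word of a clique is computed on both sides, by `word_range_append` and by `word_range'`; the
scalars differ by `t^{r(r-1)/2}`. -/
theorem quant_es (hm : 0 < m) {r : ℕ} (hr : tFac t r ≠ 0) :
    quant hut p m (es X m r) = C (tPow t r) * es X m r := by
  have h1 := word_range_append hut p m hm (P := 1) (ds := []) (c := 1) (by simp)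
    (by rw [← C_1, quant_C]; simp [word]) r
  have h2 := word_range' hut p m hm 0 r
  rw [List.append_nil, one_mul, one_mul, List.range_eq_range', h2, quant_C_mul, Nat.sub_zero,
    Finset.prod_mul_distrib] at h1
  simp only [zero_add] at h1
  rw [Finset.prod_range_reflect (fun i => t ^ i) r] at h1
  apply mul_left_cancel₀ (C_ne_zero.2 hr)
  rw [← h1, ← mul_assoc, ← C_mul, mul_comm (tFac t r)]
  rfl

/-- The area sequence of a disjoint union of cliques. -/
def cliques (L : List ℕ) : List ℕ := L.flatMap List.range

theorem word_cliques (hm : 0 < m) (L : List ℕ) :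
    C (t ^ (L.sum * (m - 1))) * word u p m (cliques L) =
      quant hut p m (L.map fun r => C (tFac t r) * es X m r).prod := by
  induction L with
  | nil => rw [List.map_nil, List.prod_nil, ← C_1, quant_C]; simp [cliques, word]
  | cons r L ih =>
    have hP : ∀ j, j + 1 < m → dd j (L.map fun r => C (tFac t r) *
        (es X m r : MvPolynomial ℕ R)).prod = 0 := by
      intro j hj
      induction L with
      | nil => simp
      | cons a L ihL =>
        clear ih
        induction a :: L with
        | nil => simp
        | cons b L' ih' =>
          rw [List.map_cons, List.prod_cons, mul_assoc, dd_mul_of_dd_eq_zero (dd_C _ _),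
            dd_mul_of_dd_eq_zero (dd_es hj _), ih', mul_zero, mul_zero]
    have := word_range_append hut p m hm hP ih r
    rw [cliques, List.flatMap_cons, List.sum_cons,
      show t ^ ((r + L.sum) * (m - 1)) = t ^ (L.sum * (m - 1)) * t ^ (r * (m - 1)) by ring]
    rw [cliques] at this
    rw [this, List.map_cons, List.prod_cons]
    congr 1
    ring

theorem isArea_range'_append {ds : List ℕ} (h : IsArea ds) (h0 : ds.headD 0 = 0) (s j : ℕ) :
    IsArea (List.range' s j ++ ds) := by
  induction j generalizing s with
  | zero => simpa using h
  | succ j ih =>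
    rw [List.range'_succ, List.cons_append]
    refine ⟨?_, ih _⟩
    cases j with
    | zero => exact h0.le.trans (Nat.zero_le _)
    | succ j => simp [List.range'_succ]

theorem headD_cliques (L : List ℕ) : (cliques L).headD 0 = 0 := by
  induction L with
  | nil => rfl
  | cons r L ih =>
    rw [cliques, List.flatMap_cons]
    cases r with
    | zero => exact ih
    | succ r => simp [List.range_eq_range', List.range'_succ]

theorem isArea_cliques (L : List ℕ) : IsArea (cliques L) := by
  induction L with
  | nil => exact trivial
  | cons r L ih =>
    rw [cliques, List.flatMap_cons, List.range_eq_range']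
    exact isArea_range'_append ih (headD_cliques L) 0 r

theorem length_cliques (L : List ℕ) : (cliques L).length = L.sum := by
  simp [cliques, List.length_flatMap]

theorem pow_sum_cliques (L : List ℕ) : t ^ (cliques L).sum = (L.map (tPow t)).prod := by
  induction L with
  | nil => simp [cliques]
  | cons r L ih =>
    rw [cliques, List.flatMap_cons, List.sum_append, pow_add, List.map_cons, List.prod_cons, ← ih,
      cliques, tPow, Finset.prod_pow_eq_pow_sum]
    congr 2
    clear ih
    induction r with
    | zero => rfl
    | succ r ih => rw [List.range_succ, List.sum_append, Finset.sum_range_succ, ih]; simp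

end

/-! ## The `(q,t)`-elementary symmetric functions -/

section

variable {K : Type*} [Field K] (q : Kˣ) {u t : K} (m : ℕ) [NeZero m]

theorem descT_toRat (hut : u * t = 1) {k : ℕ} (h : k < m) (F : MvPolynomial ℕ K) :
    descT q t m 1 k (toRat K m F) = toRat K m (descTp u t k F) := by
  induction k with
  | zero => rfl
  | succ k ih =>
    rw [descT, Module.End.mul_apply, ih (by omega), add_comm 1 k, opT_toRat q m hut h]
    rfl

theorem descTinv_succ_toRat (hut : u * t = 1) {i k : ℕ} (h : i + k < m) (F : MvPolynomial ℕ K) :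
    descTinv q t m (i + 1) k (toRat K m F) = toRat K m (descN u i k F) := by
  induction k with
  | zero => rfl
  | succ k ih =>
    rw [descTinv, Module.End.mul_apply, ih (by omega), show i + 1 + k = i + k + 1 by ring,
      opTinv_toRat q m hut (by omega)]
    rfl

theorem opY_toRat (hut : u * t = 1) {i : ℕ} (h : i < m) (F : MvPolynomial ℕ K) :
    opY q t m (i + 1) (toRat K m F) = toRat K m (opYp u t ((q⁻¹ : Kˣ) : K) m i F) := by
  rw [opY, opYp, LinearMap.smul_apply, Module.End.mul_apply, Module.End.mul_apply,
    descTinv_succ_toRat q m hut (by omega), opPi_toRat, Nat.add_sub_cancel,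
    descT_toRat q m hut h, LinearMap.smul_apply, map_smul]
  rfl

theorem qMap_eq (hut : u * t = 1) (P : MvPolynomial (Fin m) K) :
    qMap q t m P = toRat K m (evalY hut ((q⁻¹ : Kˣ) : K) m P 1) := by
  have key : qMap q t m = (toRat K m).toLinearMap ∘ₗ LinearMap.applyₗ (1 : MvPolynomial ℕ K) ∘ₗ
      (evalY hut ((q⁻¹ : Kˣ) : K) m).toLinearMap := by
    refine (basisMonomials (Fin m) K).ext fun a => ?_
    rw [qMap, Module.Basis.constr_basis, coe_basisMonomials]
    change _ = toRat K m (evalY hut ((q⁻¹ : Kˣ) : K) m (monomial a 1) 1)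
    have hpow : ∀ (i : Fin m) (k : ℕ) F, (opY q t m (i + 1) ^ k) (toRat K m F) =
        toRat K m ((opYp u t ((q⁻¹ : Kˣ) : K) m i ^ k) F) := by
      intro i k
      induction k with
      | zero => intro F; rfl
      | succ k ih =>
        intro F
        rw [pow_succ, Module.End.mul_apply, opY_toRat q m hut i.2, ih, pow_succ]
        rfl
    have hlist : ∀ (L : List (Fin m)),
        (L.map fun i : Fin m => opY q t m (i + 1) ^ a i).prod (toRat K m 1) =
          toRat K m (evalY hut ((q⁻¹ : Kˣ) : K) m (L.map fun i => X i ^ a i).prod 1) := by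
      intro L
      induction L with
      | nil => simp
      | cons i L ih =>
        rw [List.map_cons, List.prod_cons, Module.End.mul_apply, ih, hpow, List.map_cons,
          List.prod_cons, map_mul, map_pow, evalY_X]
        rfl
    rw [List.ofFn_eq_map, show (1 : RatFun K m) = toRat K m 1 from (map_one _).symm, hlist,
      ← List.ofFn_eq_map, List.prod_ofFn, monomial_eq, C_1, one_mul,
      Finsupp.prod_fintype _ _ fun _ => pow_zero _]
  rw [key]
  rfl

theorem qMap_toFin (hut : u * t = 1) (F : MvPolynomial ℕ K) :
    qMap q t m (toFin K m F) = toRat K m (quant hut ((q⁻¹ : Kˣ) : K) m F) :=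
  qMap_eq q m hut _

/-! ### Injectivity of `F ↦ F(Y) · 1` and the quantum product -/

/-- The inverse of the substitution `rot`. -/
def rotInv (p : K) (m : ℕ) : MvPolynomial ℕ K →ₐ[K] MvPolynomial ℕ K :=
  aeval fun j => if j = 0 then C p * X (m - 1) else if j < m then X (j - 1) else X j

theorem rot_rotInv (F : MvPolynomial ℕ K) : rot ((q⁻¹ : Kˣ) : K) m (rotInv (q : K) m F) = F := by
  have hm := NeZero.pos m
  have : (rot ((q⁻¹ : Kˣ) : K) m).comp (rotInv (q : K) m) = AlgHom.id K _ := by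
    ext1 j
    rw [AlgHom.comp_apply, rotInv, aeval_X]
    split_ifs with h1 h2
    · rw [map_mul, rot_X, if_neg (by omega), if_pos (by omega), ← mul_assoc,
        show rot ((q⁻¹ : Kˣ) : K) m (C (q : K)) = C (q : K) from AlgHom.commutes _ _, ← C_mul,
        Units.mul_inv, C_1, one_mul, h1]
      rfl
    · rw [rot_X, if_pos (by omega), Nat.sub_add_cancel (by omega)]; rfl
    · rw [rot_X, if_neg (by omega), if_neg (by omega)]; rfl
  exact DFunLike.congr_fun this F

theorem totalDegree_rotInv_le (p : K) (F : MvPolynomial ℕ K) :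
    (rotInv p m F).totalDegree ≤ F.totalDegree := by
  refine totalDegree_aeval_le (fun j => ?_) F
  split_ifs
  · refine (totalDegree_mul _ _).trans ?_
    simp
  · simp
  · simp

/-- The image is closed under `Π` and under the `T_i`. It therefore contains `X_0 g`, which is `Π`
applied to a rotation of `g`, and then every `X_{j+1} g`. The degree bound prepares a comparison of
dimensions. -/
theorem exists_quant (hut : u * t = 1) (n : ℕ) (g : MvPolynomial ℕ K) (hg : g.totalDegree ≤ n) :
    ∃ f : MvPolynomial ℕ K, f.totalDegree ≤ n ∧
      toRat K m (quant hut ((q⁻¹ : Kˣ) : K) m f) = toRat K m g := by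
  induction n generalizing g with
  | zero =>
    rw [Nat.le_zero, totalDegree_eq_zero_iff_eq_C] at hg
    exact ⟨g, by rw [hg]; simp, by rw [hg, quant_C]⟩
  | succ n ih =>
    have hX : ∀ j < m, ∀ g : MvPolynomial ℕ K, g.totalDegree ≤ n →
        ∃ f : MvPolynomial ℕ K, f.totalDegree ≤ n + 1 ∧
          toRat K m (quant hut ((q⁻¹ : Kˣ) : K) m f) = toRat K m (X j * g) := by
      intro j
      induction j with
      | zero =>
        intro hm g hg
        obtain ⟨f, hf, hfg⟩ := ih (rotInv (q : K) m g) ((totalDegree_rotInv_le m _ g).trans hg)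
        refine ⟨opPt u t m f, (totalDegree_opPt_le m f).trans (by omega), ?_⟩
        rw [← opR_quant hut _ m hm, ← opPi_toRat, hfg, opPi_toRat, opR_apply, rot_rotInv]
      | succ j ihj =>
        intro hj g hg
        -- Solving `opN_X_right` for `X_{j+1} g` writes it as `T_j` applied to a multiple of `X_j`.
        have hX : X (j + 1) * g = opTp u t j (X j * (opN u j g - (C u - 1) * g)) := by
          have := congrArg (opTp u t j) (opN_X_right u j g)
          rw [opTp_opN hut] at this
          rw [this]
          congr 1
          ring
        obtain ⟨f, hf, hfg⟩ := ihj (by omega) (opN u j g - (C u - 1) * g) (by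
          refine (totalDegree_sub _ _).trans (max_le ((totalDegree_opN_le _ _ _).trans hg) ?_)
          refine (totalDegree_mul _ _).trans ?_
          rw [← C_1, ← C_sub, totalDegree_C, zero_add]
          exact hg)
        refine ⟨opTp u t j f, (totalDegree_opTp_le j f).trans hf, ?_⟩
        rw [quant_opTp hut _ m hj, ← opT_toRat q m hut hj, hfg, opT_toRat q m hut hj, hX]
    have hmon : ∀ s ∈ g.support, ∃ f : MvPolynomial ℕ K, f.totalDegree ≤ n + 1 ∧
        toRat K m (quant hut ((q⁻¹ : Kˣ) : K) m f) = toRat K m (monomial s (g.coeff s)) := by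
      intro s hs
      have hd : s.degree ≤ n + 1 := (le_totalDegree hs).trans hg
      by_cases h0 : s = 0
      · subst h0
        exact ⟨C (g.coeff 0), by simp, by rw [quant_C]; rfl⟩
      obtain ⟨j, hj⟩ : ∃ j, s j ≠ 0 := by
        by_contra! h
        exact h0 (Finsupp.ext h)
      have hs' : s = Finsupp.single j 1 + (s - Finsupp.single j 1) := by
        rw [add_tsub_cancel_of_le]
        exact Finsupp.single_le_iff.2 (Nat.one_le_iff_ne_zero.2 hj)
      set s' := s - Finsupp.single j 1
      have e : (monomial s (g.coeff s) : MvPolynomial ℕ K) = X j * monomial s' (g.coeff s) := by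
        rw [X, monomial_mul, one_mul, ← hs']
      have hd' : s'.degree ≤ n := by
        rw [hs', map_add, Finsupp.degree_single] at hd
        omega
      rw [e]
      rcases lt_or_ge j m with hjm | hjm
      · exact hX j hjm _ ((totalDegree_monomial_le _ _).trans hd')
      · refine ⟨0, by simp, ?_⟩
        rw [map_zero, toRat_apply, toRat_apply, map_mul, toFin_X_of_le hjm, map_zero, zero_mul]
    choose! f hf hfg using hmon
    refine ⟨∑ s ∈ g.support, f s, totalDegree_finsetSum_le hf, ?_⟩
    rw [map_sum, map_sum, Finset.sum_congr rfl hfg, ← map_sum, support_sum_monomial_coeff]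

/-- On polynomials of degree at most `n`, the range contains a space of the same finite dimension as
the source by `exists_quant`, so rank–nullity kills the kernel. -/
theorem qMap_injective (hut : u * t = 1) : Function.Injective (qMap q t m) := by
  rw [← LinearMap.ker_eq_bot, LinearMap.ker_eq_bot']
  intro P hP
  set n := P.totalDegree
  let W := restrictTotalDegree (Fin m) K n
  let φ : W →ₗ[K] RatFun K m := (qMap q t m).domRestrict W
  let ι : W →ₗ[K] RatFun K m :=
    (IsScalarTower.toAlgHom K (MvPolynomial (Fin m) K) (RatFun K m)).toLinearMap.domRestrict W
  have hι : Function.Injective ι := fun x y h =>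
    Subtype.ext (IsFractionRing.injective (MvPolynomial (Fin m) K) (RatFun K m) h)
  have hle : LinearMap.range ι ≤ LinearMap.range φ := by
    rintro _ ⟨⟨Q, hQ⟩, rfl⟩
    rw [mem_restrictTotalDegree] at hQ
    have hQ' : (rename (fun i : Fin m => (i : ℕ)) Q).totalDegree ≤ n :=
      (totalDegree_rename_le _ _).trans hQ
    obtain ⟨f, hf, hfg⟩ := exists_quant q m hut n _ hQ'
    refine ⟨⟨toFin K m f, ?_⟩, ?_⟩
    · rw [mem_restrictTotalDegree]
      exact (totalDegree_toFin_le m f).trans hf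
    · change qMap q t m (toFin K m f) = algebraMap _ _ Q
      rw [qMap_toFin q m hut, hfg, toRat_apply]
      congr 1
      have : (toFin K m).comp (rename fun i : Fin m => (i : ℕ)) = AlgHom.id K _ := by
        ext1 i
        rw [AlgHom.comp_apply, rename_X, toFin_X i.2]; rfl
      exact DFunLike.congr_fun this Q
  have h1 := LinearMap.finrank_range_add_finrank_ker φ
  have h2 := Submodule.finrank_mono hle
  rw [LinearMap.finrank_range_of_inj hι] at h2
  have h3 : Module.finrank K (LinearMap.ker φ) = 0 := by omega
  rw [Submodule.finrank_eq_zero] at h3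
  have h4 := LinearMap.ker_eq_bot'.1 h3 ⟨P, (mem_restrictTotalDegree _ _ _).2 le_rfl⟩ hP
  exact congrArg Subtype.val h4

/-- `Function.invFun` is a meaningful inverse only on the image of an injective map; both arguments
here lie in the image. -/
theorem qStar_qMap (hut : u * t = 1) (P Q : MvPolynomial (Fin m) K) :
    qStar q t m (qMap q t m P) (qMap q t m Q) = qMap q t m (P * Q) := by
  rw [qStar, Function.leftInverse_invFun (qMap_injective q m hut),
    Function.leftInverse_invFun (qMap_injective q m hut)]

theorem tPow_ne_zero (ht : t ≠ 0) (r : ℕ) : tPow t r ≠ 0 :=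
  Finset.prod_ne_zero_iff.2 fun _ _ => pow_ne_zero _ ht

theorem map_tPow {R R' : Type*} [CommRing R] [CommRing R'] (f : R →+* R') (t : R) (r : ℕ) :
    f (tPow t r) = tPow (f t) r := by
  simp [tPow]

theorem qtElemTrunc_eq (hut : u * t = 1) (hF : ∀ r, tFac t r ≠ 0) {n : ℕ} (lam : n.Partition) :
    qtElemTrunc q t m lam = toRat K m (C ((((lam.parts.sort (· ≥ ·)).map
      fun r => tPow t r * tFac t r).prod)⁻¹ * t ^ (n * (m - 1))) *
        word u ((q⁻¹ : Kˣ) : K) m (cliques (lam.parts.sort (· ≥ ·)))) := by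
  have ht : t ≠ 0 := right_ne_zero_of_mul_eq_one hut
  have hm := NeZero.pos m
  have hsum : (lam.parts.sort (· ≥ ·)).sum = n := by
    rw [← Multiset.sum_coe, Multiset.sort_eq, lam.parts_sum]
  rw [qtElemTrunc]
  revert hsum
  generalize lam.parts.sort (· ≥ ·) = L
  rintro rfl
  clear lam
  have h1 : (L.map fun r => algebraMap (MvPolynomial (Fin m) K) (RatFun K m)
      (esymm (Fin m) K r)).foldr (qStar q t m) 1 =
      qMap q t m (toFin K m (L.map fun r => C (tPow t r)⁻¹ * es X m r).prod) := by
    induction L with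
    | nil =>
      rw [List.map_nil, List.foldr_nil, List.map_nil, List.prod_nil, qMap_toFin q m hut, ← C_1,
        quant_C, C_1, map_one]
    | cons r L ih =>
      rw [List.map_cons, List.foldr_cons, ih, List.map_cons, List.prod_cons, map_mul,
        ← qStar_qMap q m hut]
      congr 1
      rw [qMap_toFin q m hut, quant_C_mul, quant_es hut _ m hm (hF r), ← mul_assoc, ← C_mul,
        inv_mul_cancel₀ (tPow_ne_zero ht r), C_1, one_mul, toRat_apply, toFin_es]
  have h2 : (L.map fun r => C (tPow t r)⁻¹ * (es X m r : MvPolynomial ℕ K)).prod =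
      C (L.map fun r => tPow t r * tFac t r).prod⁻¹ *
        (L.map fun r => C (tFac t r) * (es X m r : MvPolynomial ℕ K)).prod := by
    clear h1
    induction L with
    | nil => simp
    | cons r L ih =>
      have hr : (C (tFac t r)⁻¹ * C (tFac t r) : MvPolynomial ℕ K) = 1 := by
        rw [← C_mul, inv_mul_cancel₀ (hF r), C_1]
      simp only [List.map_cons, List.prod_cons, mul_inv_rev, C_mul]
      rw [ih]
      linear_combination (-(C (tPow t r)⁻¹ * es X m r *
        C (L.map fun r => tPow t r * tFac t r).prod⁻¹ *
        (L.map fun r => C (tFac t r) * (es X m r : MvPolynomial ℕ K)).prod)) * hr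
  rw [h1, qMap_toFin q m hut, h2, quant_C_mul, ← word_cliques hut _ m hm, ← mul_assoc, ← C_mul]

end

theorem exists_isQTElem {n : ℕ} (lam : n.Partition) : ∃ F : Family Qqt,
    IsQTElem qq (RatFunc.C tt) lam F ∧
      HasLimit F ((tFact n / tFactPart lam) • elemSymm Qt n) := by
  set L := lam.parts.sort (· ≥ ·) with hL
  have hsum : L.sum = n := by
    rw [← Multiset.sum_coe, Multiset.sort_eq, lam.parts_sum]
  have hF : ∀ r, tFac (RatFunc.C tt : Qqt) r ≠ 0 := by
    intro r
    rw [← map_tFac]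
    exact (map_ne_zero _).2 (tFac_ne_zero r)
  -- `tPow` comes from the action of `e_r(Y)` on 1, and `tFac` from the scalar in the word of a
  -- clique. In the limit `tPow` cancels against the power of `t` in `pow_sum_cliques`.
  set c : Qt := (L.map fun r => tPow tt r * tFac tt r).prod⁻¹ with hc
  refine ⟨wordFam (RatFunc.C tt⁻¹) (RatFunc.C tt) ((qq⁻¹ : Qqtˣ) : Qqt) (RatFunc.C c) (cliques L),
    ⟨wordFam_mem C_tt_mul _ _ (isArea_cliques L) (headD_cliques L), fun m => ?_⟩, ?_⟩
  · rw [qtElemTrunc_eq qq m C_tt_mul hF, toRat_apply, wordFam, length_cliques, hsum, ← hL, hc,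
      map_inv₀, map_list_prod, List.map_map]
    simp only [Function.comp_def, map_mul, map_tPow, map_tFac]
  · have := hasLimit_wordFam c (isArea_cliques L) (headD_cliques L)
    rw [length_cliques, hsum, pow_sum_cliques] at this
    convert this using 2
    have hp : tFactPart lam = (L.map (tFac tt)).prod := by
      rw [tFactPart, show tFact = tFac tt from funext tFact_eq, ← Multiset.sort_eq lam.parts (· ≥ ·),
        ← hL, Multiset.map_coe, Multiset.prod_coe]
    have h0 : (L.map (tPow tt)).prod ≠ 0 := by
      rw [Ne, List.prod_eq_zero_iff, List.mem_map]
      rintro ⟨r, -, h⟩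
      exact tPow_ne_zero tt_ne_zero r h
    rw [hc, List.prod_map_mul, hp, tFact_eq, mul_inv, div_eq_mul_inv]
    field_simp

/-! ## Sums over colorings of unit interval graphs -/

section

variable {A : Type*} [CommRing A]

/-- The weight of an edge from a vertex of color `c` to a vertex of color `d`. -/
def edgeWt (t : A) (c d : ℕ) : A := if c = d then 0 else if c < d then t else 1

/-- The weight of the edges from a vertex of color `c` to vertices with given colors. -/
def linkWt (t : A) (c : ℕ) (cs : List ℕ) : A := (cs.map (edgeWt t c)).prod

@[simp] theorem linkWt_nil (t : A) (c : ℕ) : linkWt t c [] = 1 := rfl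

@[simp] theorem linkWt_cons (t : A) (c d : ℕ) (cs : List ℕ) :
    linkWt t c (d :: cs) = edgeWt t c d * linkWt t c cs := by simp [linkWt]

theorem linkWt_of_mem (t : A) {c : ℕ} {cs : List ℕ} (h : c ∈ cs) : linkWt t c cs = 0 :=
  List.prod_eq_zero (List.mem_map.2 ⟨c, h, if_pos rfl⟩)

/-- The weighted sum over the colorings with `m` colors of the graph with vertices `1, …, n` where
the vertex `i` is joined to the `k_i` next ones, for a list `[k_1, …, k_n]`. -/
def colSum (t : A) (x : ℕ → A) (m : ℕ) : List ℕ → (List ℕ → A) → A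
  | [], g => g []
  | k :: ks, g => ∑ c ∈ Finset.range m,
      x c * colSum t x m ks fun cs => linkWt t c (cs.take k) * g (c :: cs)

/-- The lists `[k_1, …, k_n]` that define unit interval graphs. -/
def IsReach : List ℕ → Prop
  | [] => True
  | k :: ks => k ≤ ks.headD 0 + 1 ∧ k ≤ ks.length ∧ IsReach ks

variable (t : A) (x : ℕ → A) (m : ℕ)

theorem colSum_add (ks : List ℕ) (g h : List ℕ → A) :
    colSum t x m ks (fun cs => g cs + h cs) = colSum t x m ks g + colSum t x m ks h := by
  induction ks generalizing g h with
  | nil => rfl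
  | cons k ks ih => simp only [colSum, mul_add, ih, Finset.sum_add_distrib]

theorem colSum_const_mul (ks : List ℕ) (r : A) (g : List ℕ → A) :
    colSum t x m ks (fun cs => r * g cs) = r * colSum t x m ks g := by
  induction ks generalizing g with
  | nil => rfl
  | cons k ks ih => simp only [colSum, mul_left_comm _ r, ih, Finset.mul_sum]

theorem colSum_sum {ι : Type*} (s : Finset ι) (ks : List ℕ) (g : ι → List ℕ → A) :
    colSum t x m ks (fun cs => ∑ i ∈ s, g i cs) = ∑ i ∈ s, colSum t x m ks (g i) := by
  classical
  induction s using Finset.induction_on with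
  | empty =>
    have := colSum_const_mul t x m ks 0 fun _ => 0
    simpa using this
  | insert i s hi ih => simp only [Finset.sum_insert hi, colSum_add, ih]

/-- Only proper colorings contribute, and the first `k` vertices form a clique, so their colors may
be assumed distinct. -/
theorem colSum_congr {ks : List ℕ} (hks : IsReach ks) {k : ℕ} (hk : k ≤ ks.headD 0 + 1)
    {g h : List ℕ → A}
    (H : ∀ cs : List ℕ, cs.length = ks.length → (∀ c ∈ cs, c < m) → (cs.take k).Nodup →
      g cs = h cs) : colSum t x m ks g = colSum t x m ks h := by
  induction ks generalizing k g h with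
  | nil => exact H [] rfl (by simp) (by simp)
  | cons k₀ ks ih =>
    simp only [colSum]
    refine Finset.sum_congr rfl fun c hc => congrArg _ (ih hks.2.2 hks.1 fun cs h1 h2 h3 => ?_)
    by_cases hmem : c ∈ cs.take k₀
    · rw [linkWt_of_mem t hmem, zero_mul, zero_mul]
    · rw [H (c :: cs) (by simp [h1])]
      · intro d hd
        rcases List.mem_cons.1 hd with rfl | hd
        · exact Finset.mem_range.1 hc
        · exact h2 d hd
      · cases k with
        | zero => simp
        | succ k =>
          have hs : (cs.take k).Sublist (cs.take k₀) := by
            apply List.IsPrefix.sublist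
            apply List.take_prefix_take_left
            simpa using hk
          rw [List.take_succ_cons, List.nodup_cons]
          exact ⟨fun h => hmem (hs.subset h), h3.sublist hs⟩

/-! ### Symmetry -/

/-- The color that is obtained by identifying `a + 1` with `a`. -/
def merge (a c : ℕ) : ℕ := if c = a + 1 then a else c

/-- The value that depends on the first occurrence of `a` or `a + 1` in a list. -/
def firstVal (a : ℕ) (r p q : A) : List ℕ → A
  | [] => r
  | c :: cs => if c = a then p else if c = a + 1 then q else firstVal a r p q cs

/-- The weight of the edges to the vertices that do not have the colors `a`, `a + 1`. -/
def offWt (a : ℕ) (cs : List ℕ) : A :=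
  (cs.map fun d => if d = a ∨ d = a + 1 then 1 else edgeWt t a d).prod

/-- The number of occurrences of `a` and `a + 1`. -/
def numOn (a : ℕ) (cs : List ℕ) : ℕ := cs.count a + cs.count (a + 1)

theorem map_merge_merge (a : ℕ) (cs : List ℕ) :
    (cs.map (merge a)).map (merge a) = cs.map (merge a) := by
  rw [List.map_map]
  congr 1
  funext c
  rw [Function.comp_apply]
  unfold merge
  split_ifs <;> rfl

theorem edgeWt_merge {a c : ℕ} (h1 : c ≠ a) (h2 : c ≠ a + 1) (d : ℕ) :
    edgeWt t c (merge a d) = edgeWt t c d := by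
  unfold edgeWt merge
  split_ifs <;> first | rfl | omega

theorem linkWt_merge {a c : ℕ} (h1 : c ≠ a) (h2 : c ≠ a + 1) (cs : List ℕ) :
    linkWt t c (cs.map (merge a)) = linkWt t c cs := by
  induction cs with
  | nil => rfl
  | cons d cs ih => rw [List.map_cons, linkWt_cons, ih, edgeWt_merge t h1 h2, linkWt_cons]

theorem offWt_merge (a : ℕ) (cs : List ℕ) : offWt t a (cs.map (merge a)) = offWt t a cs := by
  rw [offWt, offWt, List.map_map]
  congr 2
  funext d
  unfold merge
  by_cases h : d = a + 1 <;> simp [h]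

theorem numOn_cons (a d : ℕ) (cs : List ℕ) :
    numOn a (d :: cs) = numOn a cs + if d = a ∨ d = a + 1 then 1 else 0 := by
  unfold numOn
  rw [List.count_cons, List.count_cons]
  by_cases h1 : d = a
  · simp [h1]; omega
  · by_cases h2 : d = a + 1
    · simp [h2]; omega
    · simp [h1, h2]

theorem numOn_merge (a : ℕ) (cs : List ℕ) : numOn a (cs.map (merge a)) = numOn a cs := by
  induction cs with
  | nil => rfl
  | cons d cs ih =>
    rw [List.map_cons, numOn_cons, numOn_cons, ih]
    congr 2
    unfold merge
    by_cases h : d = a + 1 <;> simp [h]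

theorem firstVal_take {a : ℕ} (r p q : A) {k : ℕ} {cs : List ℕ} (h : numOn a (cs.take k) ≠ 0) :
    firstVal a r p q (cs.take k) = firstVal a r p q cs := by
  induction cs generalizing k with
  | nil => simp
  | cons d cs ih =>
    cases k with
    | zero => simp [numOn] at h
    | succ k =>
      rw [List.take_succ_cons] at h ⊢
      rw [firstVal, firstVal]
      by_cases h1 : d = a
      · simp [h1]
      · by_cases h2 : d = a + 1
        · simp [h2]
        · rw [numOn_cons, if_neg (by tauto), add_zero] at h
          rw [ih h]

theorem firstVal_one (a : ℕ) (cs : List ℕ) : firstVal a (1 : A) 1 1 cs = 1 := by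
  induction cs with
  | nil => rfl
  | cons d cs ih => rw [firstVal, ih]; simp

theorem numOn_le_one {a c : ℕ} (hc : c = a ∨ c = a + 1) {cs : List ℕ} (h : cs.Nodup)
    (hmem : c ∉ cs) : numOn a cs ≤ 1 := by
  have h1 := List.nodup_iff_count_le_one.1 h a
  have h2 := List.nodup_iff_count_le_one.1 h (a + 1)
  have h3 := List.count_eq_zero_of_not_mem hmem
  unfold numOn
  rcases hc with rfl | rfl <;> omega

theorem linkWt_of_numOn_zero {a c : ℕ} (hc : c = a ∨ c = a + 1) {cs : List ℕ}
    (h : numOn a cs = 0) : linkWt t c cs = offWt t a cs := by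
  induction cs with
  | nil => rfl
  | cons d cs ih =>
    rw [numOn_cons] at h
    by_cases hd : d = a ∨ d = a + 1
    · simp [hd] at h
    · rw [if_neg hd, add_zero] at h
      rw [linkWt_cons, ih h, offWt, offWt, List.map_cons, List.prod_cons, if_neg hd]
      congr 1
      unfold edgeWt
      split_ifs <;> first | rfl | omega

theorem linkWt_of_numOn_one {a c : ℕ} (hc : c = a ∨ c = a + 1) {cs : List ℕ}
    (h : numOn a cs = 1) : linkWt t c cs =
      offWt t a cs * firstVal a 0 (if c = a then 0 else 1) (if c = a then t else 0) cs := by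
  induction cs with
  | nil => simp [numOn] at h
  | cons d cs ih =>
    rw [numOn_cons] at h
    by_cases hd : d = a ∨ d = a + 1
    · rw [if_pos hd] at h
      rw [linkWt_cons, linkWt_of_numOn_zero t hc (by omega), firstVal, offWt, offWt, List.map_cons,
        List.prod_cons, if_pos hd, one_mul, mul_comm]
      congr 1
      unfold edgeWt
      split_ifs <;> first | rfl | omega
    · rw [if_neg hd, add_zero] at h
      rw [linkWt_cons, ih h, firstVal, if_neg (fun h => hd (Or.inl h)),
        if_neg (fun h => hd (Or.inr h)), offWt, offWt, List.map_cons, List.prod_cons, if_neg hd, mul_assoc]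
      congr 1
      unfold edgeWt
      split_ifs <;> first | rfl | omega

/-- In a clique the colors `a, a + 1` occur at most twice in total. Two occurrences force a conflict
with `c`. A single one is the first occurrence in the whole list, so its effect is a value of
`firstVal`. -/
theorem linkWt_of_nodup {a c : ℕ} (hc : c = a ∨ c = a + 1) {cs : List ℕ} {k : ℕ}
    (h : (cs.take k).Nodup) : linkWt t c (cs.take k) =
      (offWt t a (cs.take k) * if numOn a (cs.take k) = 0 then 1 else 0) * firstVal a 1 1 1 cs +
      (offWt t a (cs.take k) * if numOn a (cs.take k) = 1 then 1 else 0) *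
        firstVal a 0 (if c = a then 0 else 1) (if c = a then t else 0) cs := by
  rw [firstVal_one]
  by_cases h0 : numOn a (cs.take k) = 0
  · rw [linkWt_of_numOn_zero t hc h0, h0]; simp
  by_cases h1 : numOn a (cs.take k) = 1
  · rw [linkWt_of_numOn_one t hc h1, firstVal_take _ _ _ h0, h1]; simp
  · rw [linkWt_of_mem, if_neg h0, if_neg h1]
    · simp
    · by_contra hmem
      have := numOn_le_one hc h hmem
      omega

/-- The weights with prescribed values at `a` and `a + 1`. -/
def setWt (a : ℕ) (y z : A) (c : ℕ) : A := if c = a then y else if c = a + 1 then z else x c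

/-- The vertices colored `a` or `a + 1` form paths with alternating colors. Recoloring the path of
the first such vertex changes its weight as in `y p + z q` for odd length and as in `y z (t p + q)`
for even length. The `S_i` collect everything symmetric in `y, z`. The induction adds a vertex in
front, which lengthens the first path or starts a new one. -/
theorem exists_colSum_setWt {a : ℕ} (ha : a + 1 < m) {ks : List ℕ} (hks : IsReach ks)
    (g : List ℕ → A) (hg : ∀ cs, g (cs.map (merge a)) = g cs) :
    ∃ S₀ S₁ S₂ : A → A → A, (∀ y z, S₀ y z = S₀ z y) ∧ (∀ y z, S₁ y z = S₁ z y) ∧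
      (∀ y z, S₂ y z = S₂ z y) ∧ ∀ y z r p q,
      colSum t (setWt x a y z) m ks (fun cs => g cs * firstVal a r p q cs) =
        S₀ y z * r + S₁ y z * (y * p + z * q) + S₂ y z * (y * z * (t * p + q)) := by
  induction ks generalizing g with
  | nil =>
    refine ⟨fun _ _ => g [], fun _ _ => 0, fun _ _ => 0, fun _ _ => rfl, fun _ _ => rfl,
      fun _ _ => rfl, fun y z r p q => ?_⟩
    simp [colSum, firstVal]
  | cons k ks ih =>
    have hoff : ∀ c, c ≠ a → c ≠ a + 1 → ∃ S₀ S₁ S₂ : A → A → A,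
        (∀ y z, S₀ y z = S₀ z y) ∧ (∀ y z, S₁ y z = S₁ z y) ∧ (∀ y z, S₂ y z = S₂ z y) ∧
        ∀ y z r p q, colSum t (setWt x a y z) m ks
          (fun cs => linkWt t c (cs.take k) * g (c :: cs) * firstVal a r p q cs) =
          S₀ y z * r + S₁ y z * (y * p + z * q) + S₂ y z * (y * z * (t * p + q)) := by
      intro c h1 h2
      refine ih hks.2.2 (fun cs => linkWt t c (cs.take k) * g (c :: cs)) fun cs => ?_
      rw [← List.map_take, linkWt_merge t h1 h2]
      congr 1
      rw [← hg (c :: cs), ← hg (c :: cs.map (merge a)), List.map_cons, List.map_cons,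
        map_merge_merge]
    have hon : ∀ i : ℕ, ∃ S₀ S₁ S₂ : A → A → A,
        (∀ y z, S₀ y z = S₀ z y) ∧ (∀ y z, S₁ y z = S₁ z y) ∧ (∀ y z, S₂ y z = S₂ z y) ∧
        ∀ y z r p q, colSum t (setWt x a y z) m ks
          (fun cs => g (a :: cs) * (offWt t a (cs.take k) *
            if numOn a (cs.take k) = i then 1 else 0) * firstVal a r p q cs) =
          S₀ y z * r + S₁ y z * (y * p + z * q) + S₂ y z * (y * z * (t * p + q)) := by
      intro i
      refine ih hks.2.2 (fun cs => g (a :: cs) * (offWt t a (cs.take k) *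
            if numOn a (cs.take k) = i then 1 else 0)) fun cs => ?_
      rw [← List.map_take, offWt_merge, numOn_merge]
      congr 1
      rw [← hg (a :: cs), ← hg (a :: cs.map (merge a)), List.map_cons, List.map_cons,
        map_merge_merge]
    have hgon : ∀ cs, g ((a + 1) :: cs) = g (a :: cs) := by
      intro cs
      rw [← hg ((a + 1) :: cs), ← hg (a :: cs)]
      simp [merge]
    choose! S₀ S₁ S₂ h₀ h₁ h₂ hS using hoff
    obtain ⟨U₀, U₁, U₂, u₀, u₁, u₂, hU⟩ := hon 0
    obtain ⟨V₀, V₁, V₂, v₀, v₁, v₂, hV⟩ := hon 1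
    set s := ((Finset.range m).erase a).erase (a + 1) with hs
    have hs' : ∀ c ∈ s, c ≠ a ∧ c ≠ a + 1 := by
      intro c hc
      rw [hs, Finset.mem_erase, Finset.mem_erase] at hc
      exact ⟨hc.2.1, hc.1⟩
    refine ⟨fun y z => ∑ c ∈ s, x c * S₀ c y z,
      fun y z => ∑ c ∈ s, x c * S₁ c y z + (U₀ y z + U₁ y z * (y + z) + U₂ y z * (y * z * (t + 1)) +
        V₂ y z * (y * z * t)),
      fun y z => ∑ c ∈ s, x c * S₂ c y z + V₁ y z, fun y z => ?_, fun y z => ?_, fun y z => ?_,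
      fun y z r p q => ?_⟩
    · exact Finset.sum_congr rfl fun c hc => by rw [h₀ c (hs' c hc).1 (hs' c hc).2]
    · beta_reduce
      rw [Finset.sum_congr rfl fun c hc => by rw [h₁ c (hs' c hc).1 (hs' c hc).2 y z], u₀ y z,
        u₁ y z, u₂ y z, v₂ y z]
      ring
    · beta_reduce
      rw [Finset.sum_congr rfl fun c hc => by rw [h₂ c (hs' c hc).1 (hs' c hc).2 y z], v₁ y z]
    -- `U` counts colorings where the new vertex has no neighbour of color `a` or `a + 1`, and `V`
    -- those with exactly one. Only the term `V₁`, which extends an odd path to an even one, depends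
    -- on the color chosen.
    · have hcol : ∀ c, c = a ∨ c = a + 1 → colSum t (setWt x a y z) m ks
          (fun cs => linkWt t c (cs.take k) * (g (c :: cs) * firstVal a r p q (c :: cs))) =
          (if c = a then p else q) * ((U₀ y z + U₁ y z * (y + z) + U₂ y z * (y * z * (t + 1))) +
            (V₁ y z * (if c = a then z * t else y) + V₂ y z * (y * z * t))) := by
        intro c hc
        have e0 := hU y z 1 1 1
        have e1 := hV y z 0 (if c = a then 0 else 1) (if c = a then t else 0)
        rw [colSum_congr t _ m hks.2.2 hks.1 (h := fun cs => (if c = a then p else q) *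
          (g (a :: cs) * (offWt t a (cs.take k) *
            if numOn a (cs.take k) = 0 then 1 else 0) * firstVal a 1 1 1 cs +
          g (a :: cs) * (offWt t a (cs.take k) *
            if numOn a (cs.take k) = 1 then 1 else 0) *
              firstVal a 0 (if c = a then 0 else 1) (if c = a then t else 0) cs)),
          colSum_const_mul, colSum_add, e0, e1]
        · split_ifs <;> ring
        · intro cs _ _ hnd
          rw [linkWt_of_nodup t hc hnd, firstVal,
            show g (c :: cs) = g (a :: cs) by rcases hc with rfl | rfl; exacts [rfl, hgon cs]]
          have : (if c = a then p else if c = a + 1 then q else firstVal a r p q cs) =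
              if c = a then p else q := by
            rcases hc with rfl | rfl <;> simp
          rw [this]
          ring
      have hoffc : ∀ c ∈ s, setWt x a y z c * colSum t (setWt x a y z) m ks
          (fun cs => linkWt t c (cs.take k) * (g (c :: cs) * firstVal a r p q (c :: cs))) =
          x c * S₀ c y z * r + x c * S₁ c y z * (y * p + z * q) +
            x c * S₂ c y z * (y * z * (t * p + q)) := by
        intro c hc
        obtain ⟨h1, h2⟩ := hs' c hc
        have := hS c h1 h2 y z r p q
        simp only [firstVal, if_neg h1, if_neg h2, ← mul_assoc]
        rw [this, setWt, if_neg h1, if_neg h2]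
        ring
      rw [colSum, ← Finset.add_sum_erase _ _ (Finset.mem_range.2 (show a < m by omega)),
        ← Finset.add_sum_erase _ _ (Finset.mem_erase.2 ⟨show a + 1 ≠ a by omega,
          Finset.mem_range.2 ha⟩), ← hs, Finset.sum_congr rfl hoffc, hcol a (Or.inl rfl),
        hcol (a + 1) (Or.inr rfl), Finset.sum_add_distrib, Finset.sum_add_distrib,
        ← Finset.sum_mul, ← Finset.sum_mul, ← Finset.sum_mul]
      simp only [setWt, if_true, Nat.succ_ne_self, if_false]
      ring

/-- At `r = p = q = 1` the expressions `y + z` and `y z (t + 1)` are symmetric as well. -/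
theorem colSum_swap {a : ℕ} (ha : a + 1 < m) {ks : List ℕ} (hks : IsReach ks) :
    colSum t (fun c => x (Equiv.swap a (a + 1) c)) m ks (fun _ => 1) =
      colSum t x m ks fun _ => 1 := by
  obtain ⟨S₀, S₁, S₂, h₀, h₁, h₂, h⟩ := exists_colSum_setWt t x m ha hks (fun _ => 1) fun _ => rfl
  have e1 : setWt x a (x a) (x (a + 1)) = x := by
    funext c
    unfold setWt
    split_ifs with h1 h2
    · rw [h1]
    · rw [h2]
    · rfl
  have e2 : setWt x a (x (a + 1)) (x a) = fun c => x (Equiv.swap a (a + 1) c) := by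
    funext c
    unfold setWt
    split_ifs with h1 h2
    · rw [h1, Equiv.swap_apply_left]
    · rw [h2, Equiv.swap_apply_right]
    · rw [Equiv.swap_apply_of_ne_of_ne h1 h2]
  have k1 := h (x a) (x (a + 1)) 1 1 1
  have k2 := h (x (a + 1)) (x a) 1 1 1
  simp only [firstVal_one, mul_one, e1, e2] at k1 k2
  rw [k1, k2, h₀, h₁, h₂]
  ring

/-! ### Principal specialization -/

theorem linkWt_eq (c : ℕ) (cs : List ℕ) :
    linkWt t c cs = if c ∈ cs then 0 else t ^ cs.countP (c < ·) := by
  induction cs with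
  | nil => simp
  | cons d cs ih =>
    rw [linkWt_cons, ih, edgeWt, List.countP_cons]
    by_cases h1 : c = d
    · simp [h1]
    by_cases h2 : c ∈ cs
    · simp [h2]
    by_cases h3 : c < d
    · simp [h1, h2, h3, pow_succ']
    · simp [h1, h2, h3]

/-- The sum telescopes: each forbidden color lowers the exponent of the later terms. Counting the
colors `≥ m` is needed for the induction; the count is zero in the application. -/
theorem sum_pow_mul_linkWt {cs : List ℕ} (h : cs.Nodup) :
    (1 - t) * ∑ c ∈ Finset.range m, t ^ c * linkWt t c cs =
      t ^ cs.length - t ^ (m + cs.countP (m ≤ ·)) := by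
  induction m with
  | zero => simp
  | succ m ih =>
    have hcount : cs.countP (m ≤ ·) = cs.countP (m + 1 ≤ ·) + cs.count m := by
      clear ih h
      induction cs with
      | nil => rfl
      | cons d cs ih =>
        rw [List.countP_cons, List.countP_cons, List.count_cons, ih]
        by_cases h1 : m + 1 ≤ d
        · simp [h1, show m ≤ d by omega, show d ≠ m by omega]; omega
        · by_cases h2 : d = m
          · simp [h2]; omega
          · simp [h1, h2, show ¬ m ≤ d by omega]
    rw [Finset.sum_range_succ, mul_add, ih, linkWt_eq]
    split_ifs with hm
    · rw [hcount, List.count_eq_one_of_mem h hm]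
      ring
    · rw [hcount, List.count_eq_zero_of_not_mem hm]
      simp only [Nat.succ_le_iff, Nat.add_zero]
      ring

/-- Whatever colors the later vertices have, the sum over the color of the first one depends only on
the number of its neighbours, so the sum factors. -/
theorem colSum_pow {ks : List ℕ} (hks : IsReach ks) :
    (1 - t) ^ ks.length * colSum t (fun c => t ^ c) m ks (fun _ => 1) =
      (ks.map fun k => t ^ k - t ^ m).prod := by
  induction ks with
  | nil => simp [colSum]
  | cons k ks ih =>
    have : colSum t (fun c => t ^ c) m (k :: ks) (fun _ => 1) * (1 - t) =
        (t ^ k - t ^ m) * colSum t (fun c => t ^ c) m ks (fun _ => 1) := by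
      simp only [colSum, ← colSum_const_mul]
      rw [← colSum_sum, mul_comm, ← colSum_const_mul]
      refine colSum_congr t _ m hks.2.2 hks.1 fun cs h1 h2 h3 => ?_
      simp only [mul_one]
      rw [sum_pow_mul_linkWt t m h3, List.length_take, h1, min_eq_left hks.2.1,
        List.countP_eq_zero.2, add_zero]
      intro c hc
      simpa using h2 c (List.mem_of_mem_take hc)
    rw [List.length_cons, pow_succ, mul_assoc, mul_comm (1 - t), this, List.map_cons,
      List.prod_cons, ← ih hks.2.2]
    ring

theorem colSum_of_eq_zero {m' : ℕ} (h : m' ≤ m) (hx : ∀ c, m' ≤ c → x c = 0) (ks : List ℕ)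
    (g : List ℕ → A) : colSum t x m ks g = colSum t x m' ks g := by
  induction ks generalizing g with
  | nil => rfl
  | cons k ks ih =>
    simp only [colSum, ih]
    refine (Finset.sum_subset (Finset.range_mono h) fun c _ hc => ?_).symm
    rw [hx c (by simpa using hc), zero_mul]

end

/-! ## Chromatic quasisymmetric functions of unit interval graphs -/

section

variable {A : Type*} [CommRing A]

theorem linkWt_take_ofFn (t : A) (c : ℕ) {n : ℕ} (f : Fin n → ℕ) (k : ℕ) :
    linkWt t c ((List.ofFn f).take k) = ∏ w : Fin n, if (w : ℕ) < k then edgeWt t c (f w) else 1 := by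
  induction n generalizing k with
  | zero => simp
  | succ n ih =>
    cases k with
    | zero => simp
    | succ k =>
      rw [List.ofFn_succ, List.take_succ_cons, linkWt_cons, ih, Fin.prod_univ_succ]
      simp

theorem colSum_ofFn (t : A) (x : ℕ → A) (m : ℕ) {n : ℕ} (k : Fin n → ℕ) (g : List ℕ → A) :
    colSum t x m (List.ofFn k) g = ∑ κ : Fin n → Fin m,
      (∏ v, (x (κ v) * ∏ w : Fin n, if (v : ℕ) < w ∧ (w : ℕ) ≤ v + k v then edgeWt t (κ v) (κ w) else 1)) *
        g (List.ofFn fun v => (κ v : ℕ)) := by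
  induction n generalizing g with
  | zero => simp [colSum]
  | succ n ih =>
    rw [List.ofFn_succ, colSum, Finset.sum_range, ← (Fin.consEquiv fun _ => Fin m).sum_comp,
      Fintype.sum_prod_type]
    refine Finset.sum_congr rfl fun c _ => ?_
    rw [ih, Finset.mul_sum]
    refine Finset.sum_congr rfl fun κ _ => ?_
    rw [Fin.prod_univ_succ, linkWt_take_ofFn]
    simp only [Fin.consEquiv_apply, Fin.cons_zero, Fin.cons_succ, Fin.prod_univ_succ, Fin.val_zero,
      Fin.val_succ, lt_irrefl, false_and, if_false, one_mul, Nat.zero_lt_succ, true_and, zero_add,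
      Nat.succ_le_iff, Nat.not_lt_zero, Nat.add_lt_add_iff_right, List.ofFn_succ]
    have : ∀ v w : Fin n, ((w : ℕ) < v + 1 + k v.succ ↔ (w : ℕ) ≤ v + k v.succ) := by
      intro v w; omega
    simp only [this]
    ring

namespace ESeq

variable {n : ℕ} (e : ESeq n)

/-- The number of edges from the vertex `v`. -/
def reach (v : Fin n) : ℕ := (Finset.univ.filter fun w => e.val w ≤ v).card - (v + 1)

/-- As `e` is monotone, the set is an initial segment, and its cardinality is its end. -/
theorem lt_card_iff (v w : Fin n) :
    (w : ℕ) < (Finset.univ.filter fun w => e.val w ≤ v).card ↔ e.val w ≤ v := by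
  constructor
  · intro h
    by_contra hw
    have : (Finset.univ.filter fun w => e.val w ≤ v) ⊆ Finset.Iio w := by
      intro u hu
      rw [Finset.mem_filter] at hu
      rw [Finset.mem_Iio]
      by_contra hwu
      exact hw ((e.mono (not_lt.1 hwu)).trans hu.2)
    have := Finset.card_le_card this
    rw [Fin.card_Iio] at this
    omega
  · intro h
    have : Finset.Iic w ⊆ (Finset.univ.filter fun w => e.val w ≤ v) := by
      intro u hu
      rw [Finset.mem_filter]
      exact ⟨Finset.mem_univ _, (e.mono (Finset.mem_Iic.1 hu)).trans h⟩
    have := Finset.card_le_card this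
    rw [Fin.card_Iic] at this
    omega

theorem reach_add (v : Fin n) :
    e.reach v + (v + 1) = (Finset.univ.filter fun w => e.val w ≤ v).card := by
  have := (e.lt_card_iff v v).2 (Nat.lt_succ_iff.1 (e.val_lt v))
  unfold reach
  omega

theorem adj_iff (v w : Fin n) :
    e.graph.Adj v w ↔ (v : ℕ) < w ∧ (w : ℕ) ≤ v + e.reach v := by
  have h1 := e.lt_card_iff v w
  have h2 := e.reach_add v
  change (e.val w + 1 ≤ (v : ℕ) + 1 ∧ (v : ℕ) + 1 ≤ w) ↔ _
  omega

/-- Count the pairs `(v, w)` with `e(w) ≤ v` in two ways. -/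
theorem sum_reach : (List.ofFn e.reach).sum + e.size = n * (n - 1) / 2 := by
  have h1 : ∑ v : Fin n, (e.reach v + (v + 1)) + e.size = n * n := by
    simp only [reach_add, Finset.card_filter]
    rw [Finset.sum_comm, size, ← Finset.sum_add_distrib]
    have : ∀ w : Fin n, (∑ v : Fin n, if e.val w ≤ v then 1 else 0) + e.val w = n := by
      intro w
      have hw := e.val_lt w
      rw [← Finset.card_filter]
      have : (Finset.univ.filter fun v : Fin n => e.val w ≤ v) =
          Finset.Ici ⟨e.val w, by omega⟩ := by
        ext v
        simp [Fin.le_def]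
      rw [this, Fin.card_Ici]
      simp only
      omega
    rw [Finset.sum_congr rfl fun w _ => this w]
    simp
  have h2 : ∑ v : Fin n, ((v : ℕ) + 1) = n * (n - 1) / 2 + n := by
    rw [Finset.sum_add_distrib, Fin.sum_univ_eq_sum_range (fun i => i) n, Finset.sum_range_id]
    simp
  have h3 : n * n = n * (n - 1) / 2 + n + n * (n - 1) / 2 := by
    have : n * (n - 1) / 2 * 2 = n * (n - 1) := Nat.div_mul_cancel (Nat.even_mul_pred_self n).two_dvd
    cases n with
    | zero => rfl
    | succ n => simp only [Nat.add_sub_cancel] at this ⊢; nlinarith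
  rw [Finset.sum_add_distrib, h2] at h1
  rw [List.sum_ofFn]
  omega

theorem isReach : IsReach (List.ofFn e.reach) := by
  have key : ∀ (n : ℕ) (k : Fin n → ℕ), (∀ v w : Fin n, (w : ℕ) = v + 1 → k v ≤ k w + 1) →
      (∀ v : Fin n, (v : ℕ) + 1 + k v ≤ n) → IsReach (List.ofFn k) := by
    intro n
    induction n with
    | zero => intro k _ _; simp [IsReach]
    | succ n ih =>
      intro k h1 h2
      rw [List.ofFn_succ]
      refine ⟨?_, ?_, ih _ (fun v w hvw => h1 _ _ (by simp [hvw])) fun v => ?_⟩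
      · cases n with
        | zero => have := h2 0; simp at this; omega
        | succ n => rw [List.ofFn_succ]; exact h1 _ _ rfl
      · have := h2 0
        rw [Fin.val_zero] at this
        rw [List.length_ofFn]
        omega
      · have := h2 v.succ
        rw [Fin.val_succ] at this
        omega
  refine key n e.reach (fun v w hvw => ?_) fun v => ?_
  · have h1 := e.reach_add v
    have h2 := e.reach_add w
    have h3 : (Finset.univ.filter fun u => e.val u ≤ (v : ℕ)).card ≤
        (Finset.univ.filter fun u => e.val u ≤ (w : ℕ)).card := by
      apply Finset.card_le_card
      intro u hu
      rw [Finset.mem_filter] at hu ⊢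
      exact ⟨hu.1, by omega⟩
    omega
  · have h1 := e.reach_add v
    have h2 := Finset.card_le_univ (Finset.univ.filter fun u => e.val u ≤ (v : ℕ))
    rw [Fintype.card_fin] at h2
    omega

end ESeq

theorem aeval_chromQS {R : Type*} [CommRing R] [Algebra R A] (t : R) (x : ℕ → A) {n : ℕ} (e : ESeq n)
    (m : ℕ+) : aeval (fun i : Fin m => x i) (chromQS t e.graph m) =
      colSum (algebraMap R A t) x m (List.ofFn e.reach) fun _ => 1 := by
  classical
  rw [colSum_ofFn, chromQS, map_sum, Finset.sum_filter]
  refine Finset.sum_congr (Finset.ext fun κ => by simp only [Finset.mem_univ]) fun κ _ => ?_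
  simp only [← e.adj_iff]
  rw [mul_one, Finset.prod_mul_distrib, mul_comm, ← Fintype.prod_prod_type'
    (f := fun v w => if e.graph.Adj v w then edgeWt (algebraMap R A t) (κ v) (κ w) else 1)]
  split_ifs with h
  · rw [map_mul, map_prod, algHom_C, map_pow]
    simp only [aeval_X]
    congr 1
    rw [Finset.card_filter, ← Finset.prod_pow_eq_pow_sum]
    refine Finset.prod_congr rfl fun p _ => ?_
    by_cases h1 : e.graph.Adj p.1 p.2
    · have h2 : (κ p.1 : ℕ) ≠ κ p.2 := fun h3 => h _ _ h1 (Fin.ext h3)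
      by_cases h4 : κ p.1 < κ p.2
      · have h4' : (κ p.1 : ℕ) < κ p.2 := h4
        simp [edgeWt, h1, h2, h4]
      · simp [edgeWt, h1, h2, h4]
    · simp [h1]
  · push Not at h
    obtain ⟨u, v, h1, h2⟩ := h
    rw [Finset.prod_eq_zero (Finset.mem_univ (u, v)) (by simp [h1, h2, edgeWt]), mul_zero]

theorem chromQS_mem {R : Type*} [CommRing R] (t : R) {n : ℕ} (e : ESeq n) :
    chromQS t e.graph ∈ SymmFun R := by
  -- Evaluating at the variables themselves turns statements on `chromQS` into statements on
  -- `colSum`.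
  have hself : ∀ m : ℕ+, chromQS t e.graph m =
      colSum (C t) (fun c => toFin R m (X c)) m (List.ofFn e.reach) fun _ => 1 := by
    intro m
    have := aeval_chromQS t (fun c => toFin R m (X c)) e m
    simp only [toFin_X (Fin.isLt _)] at this
    rw [show (fun i : Fin m => (X ⟨(i : ℕ), i.2⟩ : MvPolynomial (Fin m) R)) = X from rfl,
      aeval_X_left, AlgHom.id_apply] at this
    exact this
  refine ⟨fun m m' hm => ?_, fun m => isSymmetric_of_swap fun i hi => ?_, n, fun m => ?_⟩
  · have hm : (m' : ℕ) < m := hm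
    have hx : (fun j : Fin m => if h : (j : ℕ) < m' then X (⟨j, h⟩ : Fin m') else 0) =
        fun j : Fin m => toFin R m' (X j) := by
      funext j
      split_ifs with h
      · rw [toFin_X h]
      · rw [toFin_X_of_le (not_lt.1 h)]
    rw [trunc, hx, aeval_chromQS t (fun c => toFin R m' (X c)),
      colSum_of_eq_zero _ _ _ hm.le fun c hc => toFin_X_of_le hc, hself m']
    rfl
  · have hx : (X ∘ Equiv.swap (⟨i, by omega⟩ : Fin m) ⟨i + 1, hi⟩ : Fin m → MvPolynomial (Fin m) R) =
        fun j : Fin m => toFin R m (X (Equiv.swap i (i + 1) (j : ℕ))) := by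
      funext j
      rw [Function.comp_apply]
      by_cases h1 : (j : ℕ) = i
      · rw [show j = ⟨i, by omega⟩ from Fin.ext h1, Equiv.swap_apply_left, Equiv.swap_apply_left,
          toFin_X hi]
      by_cases h2 : (j : ℕ) = i + 1
      · rw [show j = ⟨i + 1, hi⟩ from Fin.ext h2, Equiv.swap_apply_right, Equiv.swap_apply_right,
          toFin_X (by omega)]
      · rw [Equiv.swap_apply_of_ne_of_ne h1 h2, Equiv.swap_apply_of_ne_of_ne
          (fun h => h1 (congrArg Fin.val h)) (fun h => h2 (congrArg Fin.val h)), toFin_X j.2]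
    rw [show rename (Equiv.swap (⟨i, by omega⟩ : Fin m) ⟨i + 1, hi⟩) =
        aeval (R := R) (X ∘ Equiv.swap (⟨i, by omega⟩ : Fin m) ⟨i + 1, hi⟩) by ext1 j; simp,
      hx, aeval_chromQS t fun c => toFin R m (X (Equiv.swap i (i + 1) c)),
      colSum_swap _ (fun c => toFin R m (X c)) _ hi e.isReach, hself m]
    rfl
  · rw [chromQS]
    refine totalDegree_finsetSum_le fun κ _ => (totalDegree_mul _ _).trans ?_
    rw [totalDegree_C, zero_add]
    refine (totalDegree_finsetProd _ _).trans ?_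
    refine (Finset.sum_le_sum fun v _ => ?_).trans (by simp : ∑ _v : Fin n, 1 ≤ n)
    exact (totalDegree_monomial_le _ _).trans (by simp)

end

/-! ### Expansions in the basis of elementary symmetric functions -/

section

variable (K : Type*) [Field K]

theorem isHomogeneous_esymm (m r : ℕ) : (esymm (Fin m) K r).IsHomogeneous r := by
  refine IsHomogeneous.sum _ _ _ fun s hs => ?_
  have := IsHomogeneous.prod s (fun i : Fin m => (X i : MvPolynomial (Fin m) K)) (fun _ => 1)
    fun i _ => isHomogeneous_X K i
  rwa [Finset.sum_const, smul_eq_mul, mul_one, (Finset.mem_powersetCard.1 hs).2] at this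

theorem elemSymmPart_apply {n : ℕ} (lam : n.Partition) (m : ℕ+) :
    elemSymmPart K lam m = (lam.parts.map (esymm (Fin m) K)).prod := by
  have := map_multiset_prod (Pi.evalMonoidHom (fun m : ℕ+ => MvPolynomial (Fin m) K) m)
    (lam.parts.map (elemSymm K))
  rw [Multiset.map_map] at this
  exact this

theorem elemSymm_mem (r : ℕ) : elemSymm K r ∈ SymmFun K := by
  refine ⟨fun m m' hm => ?_, fun m => esymm_isSymmetric _ _ _, r, fun m =>
    (isHomogeneous_esymm K m r).totalDegree_le⟩
  have hm : (m' : ℕ) < m := hm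
  have hx : (fun j : Fin m => if h : (j : ℕ) < m' then X (⟨j, h⟩ : Fin m') else 0) =
      fun j : Fin m => toFin K m' (X j) := by
    funext j
    split_ifs with h
    · rw [toFin_X h]
    · rw [toFin_X_of_le (not_lt.1 h)]
  rw [trunc, hx, elemSymm, aeval_esymm_fin (a := fun j => toFin K m' (X j)),
    es_of_eq_zero hm.le fun i hi _ => toFin_X_of_le hi, ← map_es, toFin_es]
  rfl

theorem elemSymmPart_mem {n : ℕ} (lam : n.Partition) : elemSymmPart K lam ∈ SymmFun K := by
  refine Subalgebra.multiset_prod_mem _ fun F hF => ?_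
  obtain ⟨r, -, rfl⟩ := Multiset.mem_map.1 hF
  exact elemSymm_mem K r

/-- The multiset with `a_i` elements equal to `i + 1`. -/
def multOf {m : ℕ} (a : Fin m → ℕ) : Multiset ℕ :=
  ∑ i, Multiset.replicate (a i) ((i : ℕ) + 1)

theorem multOf_map_prod {M : Type*} [CommMonoid M] (f : ℕ → M) {m : ℕ} (a : Fin m → ℕ) :
    ((multOf a).map f).prod = ∏ i : Fin m, f (i + 1) ^ a i := by
  rw [multOf, ← Multiset.coe_mapAddMonoidHom, map_sum, Multiset.prod_sum]
  simp

theorem multOf_sum {m : ℕ} (a : Fin m → ℕ) : (multOf a).sum = ∑ i, a i * (i + 1) := by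
  rw [multOf, Multiset.sum_sum]
  simp

theorem multOf_pos {m : ℕ} (a : Fin m → ℕ) {r : ℕ} (h : r ∈ multOf a) : 0 < r := by
  obtain ⟨i, -, hi⟩ := Multiset.mem_sum.1 h
  rw [Multiset.eq_of_mem_replicate hi]
  exact Nat.succ_pos _

theorem multOf_count {n m : ℕ} (h : n ≤ m) (lam : n.Partition) :
    multOf (fun i : Fin m => lam.parts.count ((i : ℕ) + 1)) = lam.parts := by
  ext r
  rw [multOf, Multiset.count_sum']
  simp only [Multiset.count_replicate]
  by_cases hr : r ∈ lam.parts
  · have h1 := lam.parts_pos hr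
    have h2 : r ≤ m := ((Multiset.le_sum_of_mem hr).trans_eq lam.parts_sum).trans h
    rw [Finset.sum_eq_single ⟨r - 1, by omega⟩]
    · simp [Nat.sub_add_cancel h1]
    · intro i _ hi
      rw [if_neg]
      intro h3
      apply hi
      ext
      simp only
      omega
    · simp
  · rw [Multiset.count_eq_zero_of_notMem hr]
    refine Finset.sum_eq_zero fun i _ => ?_
    split_ifs with h1
    · rw [h1]; exact Multiset.count_eq_zero_of_notMem hr
    · rfl

theorem aeval_esymm_injective (m : ℕ) :
    Function.Injective (aeval (R := K) fun i : Fin m => esymm (Fin m) K (i + 1)) := by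
  intro P Q h
  apply esymmAlgHom_fin_injective K le_rfl
  apply Subtype.ext
  change (esymmAlgHom (Fin m) K m P).val = (esymmAlgHom (Fin m) K m Q).val
  rw [esymmAlgHom_apply, esymmAlgHom_apply]
  exact h

/-- The parts of `λ` are at most `n ≤ m`, so distinct partitions give distinct monomials in the
algebraically independent `e_1, …, e_m`. -/
theorem linearIndependent_esymm {n m : ℕ} (h : n ≤ m) : LinearIndependent K
    fun lam : n.Partition => (lam.parts.map (esymm (Fin m) K)).prod := by
  have h1 := (basisMonomials (Fin m) K).linearIndependent.comp
    (fun lam : n.Partition => Finsupp.equivFunOnFinite.symm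
      fun i : Fin m => lam.parts.count ((i : ℕ) + 1)) (by
    intro lam mu hlm
    have := Finsupp.equivFunOnFinite.symm.injective hlm
    rw [Nat.Partition.ext_iff, ← multOf_count h lam, ← multOf_count h mu, this])
  have h2 := h1.map' (aeval (R := K) fun i : Fin m => esymm (Fin m) K (i + 1)).toLinearMap
    (LinearMap.ker_eq_bot.2 (aeval_esymm_injective K m))
  have h3 : (fun lam : n.Partition => (lam.parts.map (esymm (Fin m) K)).prod) =
      fun lam => aeval (R := K) (fun i : Fin m => esymm (Fin m) K (i + 1))
        (monomial (Finsupp.equivFunOnFinite.symm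
          fun i : Fin m => lam.parts.count ((i : ℕ) + 1)) (1 : K)) := by
    funext lam
    rw [aeval_monomial, map_one, one_mul, Finsupp.prod_fintype _ _ fun _ => pow_zero _]
    conv_lhs => rw [← multOf_count h lam]
    exact multOf_map_prod _ _
  rw [h3]
  exact h2

/-- Write `P` as a polynomial in the `e_i` and keep the component of degree `n`. -/
theorem mem_span_esymm {n m : ℕ} {P : MvPolynomial (Fin m) K} (h1 : P.IsSymmetric)
    (h2 : P.IsHomogeneous n) : P ∈ Submodule.span K (Set.range
      fun lam : n.Partition => (lam.parts.map (esymm (Fin m) K)).prod) := by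
  obtain ⟨Q, hQ⟩ := esymmAlgHom_fin_surjective K (le_refl m) ⟨P, h1⟩
  have hQ' : aeval (fun i : Fin m => esymm (Fin m) K (i + 1)) Q = P := by
    rw [← esymmAlgHom_apply, hQ]
  have h3 : homogeneousComponent n P = P := by
    rw [homogeneousComponent_of_mem h2, if_pos rfl]
  rw [← h3, ← hQ', Q.as_sum, map_sum, map_sum]
  refine Submodule.sum_mem _ fun a _ => ?_
  have h4 : (∏ i : Fin m, esymm (Fin m) K (i + 1) ^ a i).IsHomogeneous (∑ i : Fin m, a i * (i + 1)) := by
    refine IsHomogeneous.prod _ _ _ fun i _ => ?_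
    rw [mul_comm]
    exact (isHomogeneous_esymm K m (i + 1)).pow (a i)
  rw [aeval_monomial, Finsupp.prod_fintype _ _ fun _ => pow_zero _, algebraMap_eq,
    homogeneousComponent_C_mul, homogeneousComponent_of_mem h4, ← smul_eq_C_mul]
  split_ifs with hn
  · refine Submodule.smul_mem _ _ (Submodule.subset_span
      ⟨⟨multOf a, multOf_pos a, (multOf_sum a).trans hn.symm⟩, ?_⟩)
    exact multOf_map_prod _ _
  · rw [smul_zero]; exact Submodule.zero_mem _

theorem existsUnique_expansion {n : ℕ} {F : Family K} (hF : F ∈ SymmFun K)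
    (hn : ∀ m, (F m).IsHomogeneous n) :
    ∃! c : n.Partition → K, F = ∑ lam, c lam • elemSymmPart K lam := by
  have hsum : ∀ (c : n.Partition → K) (m : ℕ+), (∑ lam, c lam • elemSymmPart K lam) m =
      ∑ lam, c lam • (lam.parts.map (esymm (Fin m) K)).prod := by
    intro c m
    rw [Finset.sum_apply]
    simp only [Pi.smul_apply, elemSymmPart_apply]
  have hex : ∀ m : ℕ+, ∃ c : n.Partition → K,
      F m = (∑ lam, c lam • elemSymmPart K lam) m := by
    intro m
    obtain ⟨c, hc⟩ := (Submodule.mem_span_range_iff_exists_fun K).1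
      (mem_span_esymm K (hF.2.1 m) (hn m))
    exact ⟨c, by rw [hsum, hc]⟩
  have huniq : ∀ (m : ℕ+) (c d : n.Partition → K), n ≤ m →
      (∑ lam, c lam • elemSymmPart K lam) m = (∑ lam, d lam • elemSymmPart K lam) m → c = d := by
    intro m c d hm h
    rw [hsum, hsum] at h
    exact (linearIndependent_esymm K hm).fintypeLinearCombination_injective h
  have htr : ∀ {G : Family K}, G ∈ SymmFun K → ∀ m m' : ℕ+, m' ≤ m → trunc K m m' (G m) = G m' := by
    intro G hG m m' h
    rcases eq_or_lt_of_le h with rfl | h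
    · exact trunc_self _ _
    · exact hG.1 m m' h
  have hmem : ∀ c : n.Partition → K, ∑ lam, c lam • elemSymmPart K lam ∈ SymmFun K := fun c =>
    Subalgebra.sum_mem _ fun lam _ => Subalgebra.smul_mem _ (elemSymmPart_mem K lam) _
  have hn0 : n ≤ (n.succPNat : ℕ) := by simp
  obtain ⟨c, hc⟩ := hex n.succPNat
  refine ⟨c, funext fun m => ?_, fun d hd => huniq n.succPNat d c hn0 (by rw [← hc, ← hd])⟩
  -- Coefficients are unique only in at least `n` variables. The expansion in a larger number of
  -- variables is compared with that in `n + 1`, and then truncated to `m`.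
  obtain ⟨d, hd⟩ := hex (max m n.succPNat)
  have hdc : d = c := by
    apply huniq n.succPNat d c hn0
    rw [← hc, ← htr hF _ _ (le_max_right m _), hd, htr (hmem d) _ _ (le_max_right m _)]
  rw [← htr hF _ _ (le_max_left m n.succPNat), hd, htr (hmem d) _ _ (le_max_left m _), hdc]

theorem isHomogeneous_chromQS (t : K) {n : ℕ} (e : ESeq n) (m : ℕ+) :
    (chromQS t e.graph m).IsHomogeneous n := by
  refine IsHomogeneous.sum _ _ _ fun κ _ => IsHomogeneous.C_mul ?_ _
  have := IsHomogeneous.prod Finset.univ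
    (fun v : Fin n => (X (κ v) : MvPolynomial (Fin m) K)) (fun _ => 1)
    fun v _ => isHomogeneous_X K (κ v)
  simpa using this

end

/-! ### The principal specialization of an expansion -/

section

variable {A : Type*} [CommRing A]

theorem prod_mul_es (t : A) (m r : ℕ) :
    (1 - t) ^ r * tFac t r * es (fun i => t ^ i) m r = ∏ j ∈ Finset.range r, (t ^ j - t ^ m) := by
  induction m generalizing r with
  | zero =>
    cases r with
    | zero => simp [tFac]
    | succ r => rw [es_zero_left, mul_zero, Finset.prod_range_succ']; simp
  | succ m ih =>
    cases r with
    | zero => simp [tFac]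
    | succ r =>
      have h1 : ∏ j ∈ Finset.range (r + 1), (t ^ j - t ^ (m + 1)) =
          (1 - t ^ (m + 1)) * (t ^ r * ∏ j ∈ Finset.range r, (t ^ j - t ^ m)) := by
        rw [Finset.prod_range_succ', pow_zero, mul_comm]
        congr 1
        have : ∀ j, t ^ (j + 1) - t ^ (m + 1) = t * (t ^ j - t ^ m) := fun j => by ring
        simp only [this, Finset.prod_mul_distrib, Finset.prod_const, Finset.card_range]
      have h2 := ih r
      have h3 := ih (r + 1)
      have h4 : (1 - t) * tNum t (r + 1) = 1 - t ^ (r + 1) := by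
        rw [mul_comm, tNum, geom_sum_mul_neg]
      rw [Finset.prod_range_succ, ← h2] at h3
      rw [h1, ← h2, es_succ, mul_add, h3, tFac_succ]
      linear_combination ((1 - t) ^ r * tFac t r * t ^ m * es (fun i => t ^ i) m r) * h4

theorem tPow_add (t : A) (a b : ℕ) : tPow t (a + b) = tPow t a * tPow t b * t ^ (a * b) := by
  rw [tPow, Finset.prod_range_add]
  simp only [pow_add, Finset.prod_mul_distrib, Finset.prod_const, Finset.card_range]
  rw [tPow, tPow, pow_mul]
  ring

theorem tPow_eq (t : A) (n : ℕ) : tPow t n = t ^ (n * (n - 1) / 2) := by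
  rw [tPow, Finset.prod_pow_eq_pow_sum, Finset.sum_range_id]

theorem prod_tPow_mul (t : A) (s : Multiset ℕ) :
    (s.map (tPow t)).prod * t ^ s.esymm 2 = tPow t s.sum := by
  induction s using Multiset.induction_on with
  | empty => simp [Multiset.esymm, tPow, Multiset.powersetCard_zero_right]
  | cons a s ih =>
    have : (a ::ₘ s).esymm 2 = s.esymm 2 + a * s.sum := by
      have h := Multiset.sum_map_mul_left (s := s) (a := a) (f := id)
      rw [Multiset.map_id] at h
      rw [← h]
      simp [Multiset.esymm, Multiset.powersetCard_cons, Multiset.powersetCard_one]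
    rw [this, Multiset.map_cons, Multiset.prod_cons, Multiset.sum_cons, tPow_add, ← ih, pow_add]
    ring

end

/-! ### Comparison of principal specializations -/

theorem tt_pow_injective : Function.Injective fun k : ℕ => tt ^ k := by
  intro a b h
  wlog hab : a ≤ b generalizing a b
  · exact (this h.symm (le_of_not_ge hab)).symm
  obtain ⟨k, rfl⟩ := Nat.exists_eq_add_of_le hab
  by_contra hk
  refine tt_pow_ne_one (k := k) (by omega) (mul_left_cancel₀ (pow_ne_zero a tt_ne_zero) ?_)
  rw [← pow_add, mul_one]
  exact h.symm

theorem sum_coeff_mul {n : ℕ} (e : ESeq n) {c : n.Partition → Qt} (hc : IsElemExpansion e c) :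
    ∑ lam, c lam * ((tFactPart lam)⁻¹ * (lam.parts.map (tPow tt)).prod) =
      tt ^ (List.ofFn e.reach).sum := by
  have hval : ∀ m : ℕ+, ((List.ofFn e.reach).map fun k => tt ^ k - tt ^ (m : ℕ)).prod =
      ∑ lam, c lam * (lam.parts.map fun r =>
        (tFac tt r)⁻¹ * ∏ j ∈ Finset.range r, (tt ^ j - tt ^ (m : ℕ))).prod := by
    intro m
    have h1 := colSum_pow tt (m : ℕ) e.isReach
    have h2 := aeval_chromQS tt (fun i => tt ^ i) e m
    rw [hc, Finset.sum_apply, map_sum] at h2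
    rw [← h1, Algebra.algebraMap_self_apply] at *
    rw [← h2, Finset.mul_sum, List.length_ofFn]
    refine Finset.sum_congr rfl fun lam _ => ?_
    rw [Pi.smul_apply, map_smul, elemSymmPart_apply, map_multiset_prod, Multiset.map_map, smul_eq_mul,
      mul_left_comm]
    congr 1
    have : ∀ s : Multiset ℕ, (1 - tt) ^ s.sum * (s.map fun r => es (fun i => tt ^ i) m r).prod =
        (s.map fun r => (tFac tt r)⁻¹ * ∏ j ∈ Finset.range r, (tt ^ j - tt ^ (m : ℕ))).prod := by
      intro s
      induction s using Multiset.induction_on with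
      | empty => simp
      | cons r s ih =>
        rw [Multiset.map_cons, Multiset.map_cons, Multiset.prod_cons, Multiset.prod_cons, ← ih,
          Multiset.sum_cons, ← prod_mul_es, pow_add]
        field_simp [tFac_ne_zero r]
    rw [← this, lam.parts_sum]
    congr 3
    funext r
    exact aeval_esymm_fin _ _ fun i => tt ^ i
  -- Both sides of `hval` become polynomials in `z`, evaluated at `z = t^m`. These are infinitely
  -- many points, so the polynomials agree, and in particular they agree at `z = 0`.
  set L : Polynomial Qt :=
    ((List.ofFn e.reach).map fun k => Polynomial.C (tt ^ k) - Polynomial.X).prod with hL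
  set Q : Polynomial Qt := ∑ lam, Polynomial.C (c lam) * (lam.parts.map fun r =>
    Polynomial.C (tFac tt r)⁻¹ *
      ∏ j ∈ Finset.range r, (Polynomial.C (tt ^ j) - Polynomial.X)).prod with hQ
  have hLe : ∀ z, L.eval z = ((List.ofFn e.reach).map fun k => tt ^ k - z).prod := by
    intro z
    rw [hL, Polynomial.eval_list_prod, List.map_map]
    congr 2
    funext k
    simp
  have hQe : ∀ z, Q.eval z = ∑ lam, c lam * (lam.parts.map fun r =>
      (tFac tt r)⁻¹ * ∏ j ∈ Finset.range r, (tt ^ j - z)).prod := by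
    intro z
    rw [hQ, Polynomial.eval_finsetSum]
    refine Finset.sum_congr rfl fun lam _ => ?_
    rw [Polynomial.eval_mul, Polynomial.eval_C, Polynomial.eval_multiset_prod, Multiset.map_map]
    congr 3
    funext r
    simp [Polynomial.eval_prod]
  have hLQ : L = Q := by
    apply Polynomial.eq_of_infinite_eval_eq
    refine Set.infinite_of_injective_forall_mem (f := fun m : ℕ+ => tt ^ (m : ℕ))
      (fun a b h => PNat.coe_injective (tt_pow_injective h)) fun m => ?_
    rw [Set.mem_ofPred_eq, hLe, hQe]
    exact hval m
  have h0 := (hQe 0).symm.trans ((congrArg (Polynomial.eval 0) hLQ).symm.trans (hLe 0))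
  simp only [sub_zero] at h0
  have h1 : ∀ l : List ℕ, (l.map fun k => tt ^ k).prod = tt ^ l.sum := by
    intro l
    induction l with
    | nil => simp
    | cons a l ih => rw [List.map_cons, List.prod_cons, ih, List.sum_cons, pow_add]
  rw [h1] at h0
  rw [← h0]
  refine Finset.sum_congr rfl fun lam _ => ?_
  congr 1
  rw [Multiset.prod_map_mul, Multiset.prod_map_inv, tFactPart,
    show tFact = tFac tt from funext tFact_eq]
  rfl

/-- The exponents are matched by `∑ k_v = n(n-1)/2 - |e|` and `∑ λ_i(λ_i-1)/2 = n(n-1)/2 - |e_λ|`.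
-/
theorem sum_coeff_eq_one {n : ℕ} (e : ESeq n) {c : n.Partition → Qt} (hc : IsElemExpansion e c) :
    ∑ lam : n.Partition, tt ^ ((e.size : ℤ) - (partSize lam : ℤ)) * (c lam / tFactPart lam) = 1 := by
  have h1 := sum_coeff_mul e hc
  have h2 := e.sum_reach
  have hn : tPow tt n ≠ 0 := tPow_ne_zero tt_ne_zero n
  have h3 : ∀ lam : n.Partition, tt ^ ((e.size : ℤ) - (partSize lam : ℤ)) * (c lam / tFactPart lam) =
      tt ^ e.size / tPow tt n * (c lam * ((tFactPart lam)⁻¹ * (lam.parts.map (tPow tt)).prod)) := by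
    intro lam
    have h4 := prod_tPow_mul tt lam.parts
    rw [lam.parts_sum] at h4
    have h5 : tt ^ partSize lam ≠ 0 := pow_ne_zero _ tt_ne_zero
    rw [zpow_sub₀ tt_ne_zero, zpow_natCast, zpow_natCast, ← h4,
      show lam.parts.esymm 2 = partSize lam from rfl]
    have h6 : (lam.parts.map (tPow tt)).prod ≠ 0 := by
      intro h
      rw [h, zero_mul] at h4
      exact hn h4.symm
    field_simp
  rw [Finset.sum_congr rfl fun lam _ => h3 lam, ← Finset.mul_sum, h1, div_mul_eq_mul_div, ← pow_add,
    add_comm, h2, ← tPow_eq, div_self hn]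

end QTChromatic

end

open QTChromatic in
theorem theoremC :
    (∀ (n : ℕ) (e : ESeq n), ∃ F : Family Qqt,
      IsQTChrom qq (RatFunc.C tt) e F ∧
        HasLimit F ((tt ^ (((n * (n - 1) / 2 : ℕ) : ℤ) - (e.size : ℤ)) * tFact n) •
          elemSymm Qt n)) ∧
    (∀ (n : ℕ) (lam : n.Partition), ∃ F : Family Qqt,
      IsQTElem qq (RatFunc.C tt) lam F ∧
        HasLimit F ((tFact n / tFactPart lam) • elemSymm Qt n)) ∧
    (∀ (n : ℕ) (e : ESeq n),
      (∃! c : n.Partition → Qt, IsElemExpansion e c) ∧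
      ∀ c : n.Partition → Qt, IsElemExpansion e c →
        ∑ lam : n.Partition,
          tt ^ ((e.size : ℤ) - (partSize lam : ℤ)) * (c lam / tFactPart lam) = 1) := by
  refine ⟨fun n e => exists_isQTChrom e, fun n lam => exists_isQTElem lam, fun n e =>
    ⟨existsUnique_expansion Qt (chromQS_mem tt e) (isHomogeneous_chromQS Qt tt e),
      fun c hc => sum_coeff_eq_one e hc⟩⟩
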